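/- **Setting.** Let $A$ be a finite-dimensional differential $\mathbb Z/2$-graded Frobenius algebra over $\mathbb R$: an associative graded algebra (no unit is required) with an odd differential $d$ that is a graded derivation and a nondegenerate, graded symmetric, even inner product with $\langle a,bc\rangle=\langle ab,c\rangle$ and $\langle da,b\rangle=-(-1)^a\langle a,db\rangle$. Let $(s,\pi)$ be a Hodge decomposition: $s$ odd, $\pi$ even, $ds+sd=\mathrm{id}-\pi$, $s^2=0$, $\pi^2=\pi$, $d\pi=\pi d=0$, $\pi s=s\pi=0$, $\langle sa,b\rangle=(-1)^a\langle a,sb\rangle$, $\langle \pi a,b\rangle=\langle a,\pi b\rangle$. Put $\Delta=ds+sd$ and, for $t\ge 0$, $K_t=(e^{-t\Delta}\otimes\mathrm{id})[\langle-,-\rangle^{-1}]\in A\otimes A$ and $\alpha=K_t+(s\otimes\mathrm{id})[K_t]\,dt$. A *stable ribbon graph* is a connected graph (half-edges, vertices, edges) each of whose vertices $v$ carries a connected compact oriented topological surface $S_v$ with nonempty boundary, together with an embedding of the half-edges at $v$ in $\partial S_v$; $S_v$ is taken up to homeomorphism and is stable, that is, $2b_1(S_v)+|v|-2>0$, where $b_1(S_v)$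 is the rank of $H_1(S_v)$ and $|v|$ the number of half-edges at $v$. It has *type* $(g,n)$ if gluing the surfaces $S_v$ along strips corresponding to the edges gives a surface of genus $g$ with $n$ boundary circles. Edges are black (finite length) or white (infinite length), and an orientation is an ordering of the black edges modulo even permutations. The graph $\gamma/e$ arises from $\gamma$ by gluing a strip along $e$ to the surface(s) at the ends of the edge or loop $e$, and $e\backslash\gamma$ by making the black edge $e$ white. Fix $g\ge 0$ and $n\ge 1$ with $2g+n>2$. The orbi-cellular chains of $\mathcal L^\infty_{g,n}$ are generated by the oriented stable ribbon graphs of type $(g,n)$ with black and white edges, up to isomorphism and with $-\gamma$ for the reversed orientation; the degree is the number of black edges, and $\partial\gamma=\sum_{e\ \text{black}}(\gamma/e+e\backslash\gamma)$, where the summands carry the boundary orientation of the faces $t_e=0$ and $t_e=\infty$ of the cube $[0,\infty]^{E_{\rm Black}(\gamma)}$. The orbi-cellular chains of the one-point compactification $\mathcal L^\circ_{g,n}$ are generated in the same way by the graphs all of whose edges are black (including the edgeless one) and by one $0$-cell at infinity, and $\partial\gamma=\sum_e\gamma/e$ with boundary orientations, plus the $0$-cell at infinity if $\gamma$ has exactly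 one edge. Cochains are the linear functions on chains. The collapse map $\mathcal L^\infty_{g,n}\to\mathcal L^\circ_{g,n}$ contracts all orbi-cells with at least one white edge to the point at infinity. The form $\omega_\gamma$ on $[0,\infty]^{E_{\rm Black}(\gamma)}$ is obtained by putting $\alpha$ on the black edges and $(\pi\otimes\mathrm{id})[\langle-,-\rangle^{-1}]$ on the white edges, and by contracting at each vertex $v$ with the value on $S_v$ of the open topological field theory determined by $A$. Integrating the top-degree part of $\omega_\gamma$ over the orbi-cell of $\gamma$, for each $\gamma$, gives the cochain $\int\omega$ on $\mathcal L^\infty_{g,n}$. **Statement.** Suppose that $A$ is contractible, that is, its homology vanishes. Then $\pi=0$ and $K_t\to 0$ in $A\otimes A$ as $t\to\infty$. For all $g\ge 0$, $n\ge 1$ with $2g+n>2$, the integrals of $\omega$ over all orbi-cells converge absolutely, $\int\omega$ is a well-defined orbi-cellular cocycle on $\mathcal L^\infty_{g,n}$, and there is exactly one orbi-cellular cochain on $\mathcal L^\circ_{g,n}$ whose pullback under the collapse map is $\int\omega$; this cochain is a cocycle. -/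

import Mathlib

open Filter Topology MeasureTheory
open scoped TensorProduct

namespace CellTCFT

/-! ## Differential graded Frobenius algebras and Hodge decompositions -/

/-- The sign `(-1) ^ p` attached to a parity `p`. -/
def sgn (p : ZMod 2) : ℝ := (-1) ^ p.val

/-- A differential `ℤ/2`-graded Frobenius algebra structure on an associative real algebra `A`
(no unit is required): a `ℤ/2`-grading, an odd differential which is a graded derivation, and a
nondegenerate, graded symmetric, even, invariant inner product compatible with the differential.
Finite dimensionality is imposed separately. -/
structure DGFrobenius (A : Type*) [NonUnitalRing A] [Module ℝ A] where
  /-- the homogeneous components -/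
  gr : ZMod 2 → Submodule ℝ A
  isInternal : DirectSum.IsInternal gr
  mul_mem : ∀ {p q : ZMod 2} {a b : A}, a ∈ gr p → b ∈ gr q → a * b ∈ gr (p + q)
  /-- the differential -/
  d : A →ₗ[ℝ] A
  d_mem : ∀ {p : ZMod 2} {a : A}, a ∈ gr p → d a ∈ gr (p + 1)
  d_d : ∀ a, d (d a) = 0
  leibniz : ∀ {p : ZMod 2} {a : A} (b : A), a ∈ gr p → d (a * b) = d a * b + sgn p • (a * d b)
  /-- the inner product -/
  form : LinearMap.BilinForm ℝ A
  nondegenerate : form.Nondegenerate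
  form_even : ∀ {p q : ZMod 2} {a b : A}, a ∈ gr p → b ∈ gr q → p ≠ q → form a b = 0
  form_symm : ∀ {p q : ZMod 2} {a b : A}, a ∈ gr p → b ∈ gr q →
    form a b = sgn (p * q) * form b a
  form_mul : ∀ a b c, form a (b * c) = form (a * b) c
  form_d : ∀ {p : ZMod 2} {a : A} (b : A), a ∈ gr p → form (d a) b = -(sgn p * form a (d b))

variable {A : Type*} [NonUnitalRing A] [Module ℝ A]

/-- The algebra is contractible: its homology vanishes. -/
def DGFrobenius.Contractible (F : DGFrobenius A) : Prop :=
  ∀ a, F.d a = 0 → ∃ b, F.d b = a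

/-- An abstract Hodge decomposition: an odd operator `s` and an even operator `π` with the
usual identities. -/
structure HodgeDecomposition (F : DGFrobenius A) where
  s : A →ₗ[ℝ] A
  π : A →ₗ[ℝ] A
  s_mem : ∀ {p : ZMod 2} {a : A}, a ∈ F.gr p → s a ∈ F.gr (p + 1)
  π_mem : ∀ {p : ZMod 2} {a : A}, a ∈ F.gr p → π a ∈ F.gr p
  homotopy : ∀ a, F.d (s a) + s (F.d a) = a - π a
  s_s : ∀ a, s (s a) = 0
  π_π : ∀ a, π (π a) = π a
  d_π : ∀ a, F.d (π a) = 0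
  π_d : ∀ a, π (F.d a) = 0
  π_s : ∀ a, π (s a) = 0
  s_π : ∀ a, s (π a) = 0
  form_s : ∀ {p : ZMod 2} {a : A} (b : A), a ∈ F.gr p → F.form (s a) b = sgn p * F.form a (s b)
  form_π : ∀ a b, F.form (π a) b = F.form a (π b)

section Kernel

variable [FiniteDimensional ℝ A]

/-- Index set of a homogeneous basis; the first component is the parity of the basis vector. -/
abbrev DGFrobenius.Idx (F : DGFrobenius A) : Type :=
  Σ p : ZMod 2, Fin (Module.finrank ℝ (F.gr p))

/-- A homogeneous basis of `A`. -/
noncomputable def DGFrobenius.basis (F : DGFrobenius A) : Module.Basis F.Idx ℝ A :=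
  F.isInternal.collectedBasis fun p => Module.finBasis ℝ (F.gr p)

/-- The inverse inner product `∑ᵢ xᵢ ⊗ xᵢ'` in `A ⊗ A`, characterised by
`∑ᵢ ⟨xᵢ', b⟩ xᵢ = b` for all `b`. -/
noncomputable def DGFrobenius.invForm (F : DGFrobenius A) : A ⊗[ℝ] A :=
  ∑ i, F.basis i ⊗ₜ[ℝ] F.form.dualBasis F.nondegenerate F.basis i

/-- Coordinates of an element of `A ⊗ A` in the homogeneous basis. -/
noncomputable def DGFrobenius.coef (F : DGFrobenius A) (P : A ⊗[ℝ] A) (i j : F.Idx) : ℝ :=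
  (F.basis.tensorProduct F.basis).repr P (i, j)

/-- The exponential series of an endomorphism of the finite-dimensional space `A`, with respect to
the canonical topology of the finite-dimensional algebra of endomorphisms. -/
noncomputable def expEnd (f : Module.End ℝ A) : Module.End ℝ A :=
  letI : TopologicalSpace (Module.End ℝ A) := moduleTopology ℝ (Module.End ℝ A)
  haveI : IsModuleTopology ℝ (Module.End ℝ A) := ⟨rfl⟩
  haveI : IsTopologicalRing (Module.End ℝ A) := IsModuleTopology.isTopologicalRing ℝ _
  NormedSpace.exp f

namespace HodgeDecomposition

variable {F : DGFrobenius A} (h : HodgeDecomposition F)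

/-- The Laplacian `Δ = ds + sd`. -/
def laplacian : Module.End ℝ A := F.d ∘ₗ h.s + h.s ∘ₗ F.d

/-- The heat kernel `K_t = (e^{-tΔ} ⊗ id)[⟨-,-⟩⁻¹]`. -/
noncomputable def heatKernel (t : ℝ) : A ⊗[ℝ] A :=
  (expEnd (-t • h.laplacian)).rTensor A F.invForm

/-- The coefficient `(s ⊗ id)[K_t]` of `dt` in `α = K_t + (s ⊗ id)[K_t] dt`. -/
noncomputable def heatKernelDt (t : ℝ) : A ⊗[ℝ] A :=
  h.s.rTensor A (h.heatKernel t)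

/-- The tensor `(π ⊗ id)[⟨-,-⟩⁻¹]` placed on the edges of infinite length. -/
noncomputable def kernelAtInfinity : A ⊗[ℝ] A :=
  h.π.rTensor A F.invForm

end HodgeDecomposition

/-! ## The open topological field theory -/

/-- `⟨a₁ ⋯ aₙ₋₁, aₙ⟩`, written with an accumulator `a` for the product of the first letters. -/
noncomputable def DGFrobenius.diskAux (F : DGFrobenius A) : A → List A → ℝ
  | _, [] => 0
  | a, [b] => F.form a b
  | a, b :: c :: l => F.diskAux (a * b) (c :: l)

/-- The tensor of a disk with `n ≥ 2` marked intervals, in cyclic order along its boundary: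
`tₙ(a₁, …, aₙ) = ⟨a₁ ⋯ aₙ₋₁, aₙ⟩`. -/
noncomputable def DGFrobenius.disk (F : DGFrobenius A) : List A → ℝ
  | [] => 0
  | a :: l => F.diskAux a l

/-- The parity of a word in the homogeneous basis. -/
def DGFrobenius.parity (F : DGFrobenius A) (w : List F.Idx) : ZMod 2 := (w.map Sigma.fst).sum

/-- The tensor of the surface which is obtained from a disk by gluing strips, i.e. by contracting
with the inverse inner product. The word `u` stands on the boundary circle of the disk. Every
further word `w` sits on its own boundary circle (possibly without intervals), which is cut off by a
strip joining the two sides of `w`; then each of the `g` handles is made by two strips whose ends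
interlace. The signs are the Koszul signs for bringing the two ends of a strip to their places. -/
noncomputable def DGFrobenius.surfaceAux (F : DGFrobenius A) :
    List F.Idx → List (List F.Idx) → ℕ → ℝ
  | u, [], 0 => F.disk (u.map F.basis)
  | u, [], g + 1 => ∑ i, ∑ j, ∑ k, ∑ l,
      F.coef F.invForm i j * F.coef F.invForm k l * sgn (j.1 * k.1) *
        F.surfaceAux (u ++ [i, k, j, l]) [] g
  | u, w :: ws, g => ∑ i, ∑ j,
      F.coef F.invForm i j * sgn (j.1 * F.parity w) * F.surfaceAux (u ++ [i] ++ w ++ [j]) ws g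

/-- The value of the open topological field theory of `A` on the connected oriented surface of genus
`g` whose boundary circles carry the given cyclic words (one word for each circle; the empty word
for a circle without marked intervals), evaluated on basis vectors. -/
noncomputable def DGFrobenius.surface (F : DGFrobenius A) (g : ℕ) : List (List F.Idx) → ℝ
  | [] => 0
  | u :: ws => F.surfaceAux u ws g

end Kernel

/-! ## Stable ribbon graphs with black and white edges -/

/-- Combinatorial data of a ribbon graph with surfaces at its vertices, with black and white edges,
and with an orientation, given by an ordering of its `k` black edges. The connected compact oriented
surface at a vertex is recorded up to homeomorphism: by its genus, by the cyclic orders of the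
half-edges embedded in its boundary circles, and by the number of boundary circles without
half-edges. An edge is white if none of its half-edges is listed by `black`. -/
structure BWGraph (k : ℕ) where
  /-- half-edges -/
  H : Type
  /-- vertices -/
  V : Type
  [finite_H : Finite H]
  [finite_V : Finite V]
  /-- the vertex of a half-edge -/
  vert : H → V
  /-- the other half of an edge -/
  inv : Equiv.Perm H
  inv_inv : ∀ x, inv (inv x) = x
  inv_ne : ∀ x, inv x ≠ x
  /-- the next half-edge on the same boundary circle of the surface at the vertex -/
  next : Equiv.Perm H
  vert_next : ∀ x, vert (next x) = vert x
  /-- the genus of the surface at a vertex -/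
  genus : V → ℕ
  /-- the number of boundary circles without half-edges of the surface at a vertex -/
  holes : V → ℕ
  /-- one of the two halves of each black edge, in the order given by the orientation -/
  black : Fin k → H
  black_injective : Function.Injective black
  black_ne_inv : ∀ i j, black i ≠ inv (black j)

namespace BWGraph

variable {k : ℕ} (γ : BWGraph k)

instance : Finite γ.H := γ.finite_H
instance : Finite γ.V := γ.finite_V
noncomputable instance : Fintype γ.H := Fintype.ofFinite _
noncomputable instance : Fintype γ.V := Fintype.ofFinite _

/-- The orbits ("cycles") of a permutation. -/
abbrev Orbits {X : Type} (f : Equiv.Perm X) : Type := Quotient (Equiv.Perm.SameCycle.setoid f)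

noncomputable instance {X : Type} [Finite X] (f : Equiv.Perm X) : Fintype (Orbits f) :=
  Fintype.ofFinite _

open scoped Classical in
/-- The boundary circles at `v` that carry half-edges. -/
noncomputable def circlesAt (v : γ.V) : Finset (Orbits γ.next) :=
  Finset.univ.filter fun q => γ.vert q.out = v

/-- The number of boundary circles of the surface at `v`. -/
noncomputable def boundaryCount (v : γ.V) : ℕ := (γ.circlesAt v).card + γ.holes v

/-- The number of half-edges at `v`. -/
noncomputable def valency (v : γ.V) : ℕ := Nat.card {x : γ.H // γ.vert x = v}

/-- The graph is nonempty and connected. -/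
def IsConnected : Prop :=
  Nonempty γ.V ∧
    ∀ v w, Relation.ReflTransGen (fun v w => ∃ x, γ.vert x = v ∧ γ.vert (γ.inv x) = w) v w

/-- The surface at each vertex has nonempty boundary and is stable: `2 b₁ + valency - 2 > 0`, where
`b₁ = 2 * genus + boundaryCount - 1` is the rank of its first homology. -/
def IsStable : Prop :=
  ∀ v, 1 ≤ γ.boundaryCount v ∧ 2 < 2 * (2 * γ.genus v + γ.boundaryCount v - 1) + γ.valency v

/-- The number of boundary circles of the surface which is obtained by gluing the surfaces at the
vertices along strips corresponding to the edges. -/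
noncomputable def totalBoundary : ℕ :=
  Fintype.card (Orbits (γ.next * γ.inv)) + ∑ v, γ.holes v

/-- Twice the Euler characteristic of the surface which is obtained by gluing the surfaces at the
vertices along strips corresponding to the edges. -/
noncomputable def twiceEuler : ℤ :=
  2 * ∑ v, (2 - 2 * (γ.genus v : ℤ) - γ.boundaryCount v) - Fintype.card γ.H

/-- The graph is a (connected) stable ribbon graph which indexes an orbi-cell for genus `g` and `n`
marked points: gluing strips along its edges yields a surface of genus `g` with `n` boundary
circles. -/
def IsOfType (g n : ℕ) : Prop :=
  γ.IsConnected ∧ γ.IsStable ∧ γ.totalBoundary = n ∧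
    γ.twiceEuler = 2 * (2 - 2 * (g : ℤ) - n)

/-- All edges are black. -/
def AllBlack : Prop := ∀ x, ∃ i, x = γ.black i ∨ x = γ.inv (γ.black i)

/-- Isomorphisms of stable ribbon graphs with black and white edges. The permutation `perm` of the
black edges compares the orientations. -/
structure Iso (γ γ' : BWGraph k) where
  onH : γ.H ≃ γ'.H
  onV : γ.V ≃ γ'.V
  vert_eq : ∀ x, γ'.vert (onH x) = onV (γ.vert x)
  inv_eq : ∀ x, γ'.inv (onH x) = onH (γ.inv x)
  next_eq : ∀ x, γ'.next (onH x) = onH (γ.next x)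
  genus_eq : ∀ v, γ'.genus (onV v) = γ.genus v
  holes_eq : ∀ v, γ'.holes (onV v) = γ.holes v
  perm : Equiv.Perm (Fin k)
  black_eq : ∀ i, onH (γ.black i) = γ'.black (perm i) ∨
    onH (γ.black i) = γ'.inv (γ'.black (perm i))

/-- The graph `e \ γ`: the `i`-th black edge is replaced by a white edge. -/
def whiten (γ : BWGraph (k + 1)) (i : Fin (k + 1)) : BWGraph k :=
  { γ with
    black := fun j => γ.black (i.succAbove j)
    black_injective := γ.black_injective.comp Fin.succAbove_right_injective
    black_ne_inv := fun _ _ => γ.black_ne_inv _ _ }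

section Contract

open scoped Classical

/-- Delete `a` from its cycle, i.e. make it a fixed point and connect its neighbours. -/
noncomputable def bypass {X : Type} (f : Equiv.Perm X) (a : X) : Equiv.Perm X :=
  Equiv.swap a (f a) * f

theorem bypass_self {X : Type} (f : Equiv.Perm X) (a : X) : bypass f a a = a := by
  simp [bypass]

theorem bypass_fixed {X : Type} (f : Equiv.Perm X) (a b : X) (hb : f b = b) :
    bypass f a b = b := by
  by_cases hab : b = a
  · subst hab; exact bypass_self f b
  · have : b ≠ f a := fun h => hab (f.injective (hb.trans h))
    simp [bypass, hb, Equiv.swap_apply_of_ne_of_ne hab this]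

/-- The boundary permutation after a strip has been glued along the half-edges `x` and `y`: having
arrived at `x` one continues after `y`, and conversely; then `x` and `y` are deleted. -/
noncomputable def glued {X : Type} (f : Equiv.Perm X) (x y : X) : Equiv.Perm X :=
  bypass (bypass (f * Equiv.swap x y) x) y

theorem glued_left {X : Type} (f : Equiv.Perm X) (x y : X) : glued f x y x = x :=
  bypass_fixed _ _ _ (bypass_self _ _)

theorem glued_right {X : Type} (f : Equiv.Perm X) (x y : X) : glued f x y y = y :=
  bypass_self _ _

theorem glued_ne_iff {X : Type} (f : Equiv.Perm X) (x y z : X) :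
    (glued f x y z ≠ x ∧ glued f x y z ≠ y) ↔ (z ≠ x ∧ z ≠ y) := by
  have hx : glued f x y z = x ↔ z = x :=
    ⟨fun h => (glued f x y).injective (h.trans (glued_left f x y).symm),
      fun h => h ▸ glued_left f x y⟩
  have hy : glued f x y z = y ↔ z = y :=
    ⟨fun h => (glued f x y).injective (h.trans (glued_right f x y).symm),
      fun h => h ▸ glued_right f x y⟩
  rw [Ne, Ne, hx, hy]

theorem glued_rel {X Y : Type} (f : Equiv.Perm X) (p : X → Y) (hf : ∀ z, p (f z) = p z)
    (x y z : X) (r : Y → Y → Prop) (hr : Equivalence r) (hxy : r (p x) (p y)) :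
    r (p (glued f x y z)) (p z) := by
  have hs : ∀ u v w : X, r (p u) (p v) → r (p (Equiv.swap u v w)) (p w) := by
    intro u v w huv
    by_cases h1 : w = u
    · subst h1; simpa using hr.symm huv
    · by_cases h2 : w = v
      · subst h2; simpa using huv
      · rw [Equiv.swap_apply_of_ne_of_ne h1 h2]; exact hr.refl _
  have hb : ∀ (g : Equiv.Perm X) (a : X), (∀ w, r (p (g w)) (p w)) →
      ∀ w, r (p (bypass g a w)) (p w) := fun g a hg w =>
    hr.trans (hs a (g a) (g w) (hr.symm (hg a))) (hg w)
  exact hb _ _ (hb _ _ fun w => by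
    rw [Equiv.Perm.mul_apply, hf]; exact hs x y w hxy) z

/-- The graph `γ / e` for the `i`-th black edge `e` (which may be a loop): the surfaces at its ends
are glued by a strip along `e`.
If `e` joins two vertices, these are merged and genera and numbers of empty circles add up. If `e` is
a loop with ends on different boundary circles of the surface, then these circles merge and the
genus goes up by one. If `e` is a loop with both ends on the same circle, this circle splits. In all
cases the resulting circles that carry no half-edges any more are counted by `holes`. -/
noncomputable def contract (γ : BWGraph (k + 1)) (i : Fin (k + 1)) : BWGraph k :=
  let x : γ.H := γ.black i
  let y : γ.H := γ.inv x
  let glue : γ.V → γ.V → Prop := fun v w => v = γ.vert x ∧ w = γ.vert y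
  { H := {z : γ.H // z ≠ x ∧ z ≠ y}
    V := Quot glue
    vert := fun z => Quot.mk glue (γ.vert z)
    inv := γ.inv.subtypePerm (p := fun z => z ≠ x ∧ z ≠ y) fun z => by
      have h1 : γ.inv z = x ↔ z = y :=
        ⟨fun h => by rw [← γ.inv_inv z, h], fun h => by rw [h, γ.inv_inv]⟩
      have h2 : γ.inv z = y ↔ z = x := γ.inv.injective.eq_iff
      rw [Ne, Ne, h1, h2, and_comm]
    inv_inv := fun z => Subtype.ext (γ.inv_inv z)
    inv_ne := fun z h => γ.inv_ne z (congrArg Subtype.val h)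
    next := (glued γ.next x y).subtypePerm (p := fun z => z ≠ x ∧ z ≠ y)
      (glued_ne_iff γ.next x y)
    vert_next := fun z =>
      glued_rel γ.next γ.vert γ.vert_next x y z
        (fun v w => (Quot.mk glue v : Quot glue) = Quot.mk glue w)
        ⟨fun _ => rfl, Eq.symm, Eq.trans⟩ (Quot.sound ⟨rfl, rfl⟩)
    genus := fun q =>
      (∑ v ∈ Finset.univ.filter fun v => Quot.mk glue v = q, γ.genus v) +
        if q = Quot.mk glue (γ.vert x) ∧ γ.vert x = γ.vert y ∧ ¬ γ.next.SameCycle x y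
        then 1 else 0
    holes := fun q =>
      (∑ v ∈ Finset.univ.filter fun v => Quot.mk glue v = q, γ.holes v) +
        if q = Quot.mk glue (γ.vert x) then
          (if γ.next x = y then 1 else 0) + (if γ.next y = x then 1 else 0) +
            (if γ.next x = x ∧ γ.next y = y then 1 else 0)
        else 0
    black := fun j => ⟨γ.black (i.succAbove j),
      fun h => Fin.succAbove_ne i j (γ.black_injective h), γ.black_ne_inv _ _⟩
    black_injective := fun _ _ h =>
      Fin.succAbove_right_injective (γ.black_injective (congrArg Subtype.val h))
    black_ne_inv := fun _ _ h => γ.black_ne_inv _ _ (congrArg Subtype.val h) }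

end Contract

/-! ## Orbi-cellular cochains -/

/-- A family `c` of functions on oriented stable ribbon graphs with black and white edges, with `k`
black edges in degree `k`, is a cochain on `𝓛^∞_{g,n}` if it is compatible with isomorphisms (up to
the sign that compares the orientations); it is extended by zero to the graphs of other types.
(Whitening and contracting a black edge do not change the glued surface, hence not the type.) -/
def IsCochainInf (g n : ℕ) (c : ∀ k, BWGraph k → ℝ) : Prop :=
  (∀ k (γ : BWGraph k), ¬ γ.IsOfType g n → c k γ = 0) ∧
  ∀ k (γ γ' : BWGraph k) (φ : Iso γ γ'), c k γ' = ((Equiv.Perm.sign φ.perm : ℤ) : ℝ) * c k γ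

/-- The value of a cochain of `𝓛^∞_{g,n}` on the boundary `∑ₑ (γ / e + e \ γ)` of the cube
`[0, ∞]^{black edges}` of `γ`, where the faces carry the boundary orientation. -/
noncomputable def coboundaryInf (c : ∀ k, BWGraph k → ℝ) (k : ℕ) (γ : BWGraph (k + 1)) : ℝ :=
  ∑ i : Fin (k + 1), (-1) ^ (i : ℕ) * (c k (γ.whiten i) - c k (γ.contract i))

/-- Cocycles on `𝓛^∞_{g,n}`. -/
def IsCocycleInf (g n : ℕ) (c : ∀ k, BWGraph k → ℝ) : Prop :=
  IsCochainInf g n c ∧ ∀ k (γ : BWGraph (k + 1)), γ.IsOfType g n → coboundaryInf c k γ = 0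

/-- Candidates for cochains on the one-point compactification: a function on graphs, and the value
on the `0`-cell at infinity. -/
@[ext]
structure PointCochain where
  onGraph : ∀ k, BWGraph k → ℝ
  atInfinity : ℝ

/-- Cochains on the one-point compactification `𝓛°_{g,n}`: its cells are indexed by stable ribbon
graphs (all edges black; the edgeless graph is the cell of the surfaces all of whose perimeters
vanish) and by the point at infinity. -/
def PointCochain.IsCochain (g n : ℕ) (c : PointCochain) : Prop :=
  (∀ k (γ : BWGraph k), ¬ (γ.IsOfType g n ∧ γ.AllBlack) → c.onGraph k γ = 0) ∧
  ∀ k (γ γ' : BWGraph k) (φ : Iso γ γ'),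
    c.onGraph k γ' = ((Equiv.Perm.sign φ.perm : ℤ) : ℝ) * c.onGraph k γ

/-- The value of a cochain of `𝓛°_{g,n}` on the boundary of the cell of `γ`: the sum of the cells
`γ / e` with the boundary orientation; the end of a `1`-cell at infinite length is the point at
infinity. -/
noncomputable def PointCochain.coboundary (c : PointCochain) (k : ℕ) (γ : BWGraph (k + 1)) : ℝ :=
  (∑ i : Fin (k + 1), (-1) ^ (i : ℕ) * (-c.onGraph k (γ.contract i))) +
    if k = 0 then c.atInfinity else 0

/-- Cocycles on `𝓛°_{g,n}`. -/
def PointCochain.IsCocycle (g n : ℕ) (c : PointCochain) : Prop :=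
  c.IsCochain g n ∧
    ∀ k (γ : BWGraph (k + 1)), γ.IsOfType g n → γ.AllBlack → c.coboundary k γ = 0

open scoped Classical in
/-- The pullback of a cochain along the map `𝓛^∞_{g,n} → 𝓛°_{g,n}` which collapses all orbi-cells
with at least one white edge to the point at infinity. -/
noncomputable def PointCochain.pullback (g n : ℕ) (c : PointCochain) :
    ∀ k, BWGraph k → ℝ := fun k γ =>
  if γ.IsOfType g n then
    if γ.AllBlack then c.onGraph k γ else if k = 0 then c.atInfinity else 0
  else 0

/-! ## The orbi-cellular form and its integrals -/

/-- The half-edges along a cycle of `f`, in cyclic order from a chosen starting point. -/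
noncomputable def cycleWord {X : Type} (f : Equiv.Perm X) (q : Orbits f) : List X :=
  List.iterate f q.out (Function.minimalPeriod f q.out)

/-- The words on the boundary circles of the surface at `v`. -/
noncomputable def circleWords (v : γ.V) : List (List γ.H) :=
  (γ.circlesAt v).toList.map (cycleWord γ.next) ++ List.replicate (γ.holes v) []

/-- The half-edges, ordered vertex by vertex as in the tensors attached to the vertices. -/
noncomputable def vertexOrder : List γ.H :=
  (Finset.univ : Finset γ.V).toList.flatMap fun v => (γ.circleWords v).flatten

open scoped Classical in
/-- One half of each white edge. -/
noncomputable def whiteHalves : List γ.H :=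
  (Finset.univ.filter fun q : Orbits γ.inv =>
    ∀ i, q.out ≠ γ.black i ∧ q.out ≠ γ.inv (γ.black i)).toList.map Quotient.out

/-- The half-edges, ordered edge by edge: black edges first, in the order of the orientation. -/
noncomputable def edgeOrder : List γ.H :=
  ((List.finRange k).map γ.black ++ γ.whiteHalves).flatMap fun x => [x, γ.inv x]

open scoped Classical in
/-- The Koszul sign for reordering tensor factors of parities `p`, indexed by `X`, from the order of
the list `L` to the order of the list `M`. -/
noncomputable def koszulSign {X : Type} [Fintype X] (p : X → ZMod 2) (L M : List X) : ℝ :=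
  ∏ x, ∏ y,
    if L.idxOf x < L.idxOf y ∧ M.idxOf y < M.idxOf x then sgn (p x * p y) else 1

section Amplitude

variable {A : Type*} [NonUnitalRing A] [Module ℝ A] [FiniteDimensional ℝ A] (F : DGFrobenius A)

/-- The map `T = ⨂ᵥ tᵥ` applied to the tensors `P i` on the black edges and `Q` on all white edges,
where `tᵥ` is the value of the open topological field theory on the surface at `v`. -/
noncomputable def amplitude (P : Fin k → A ⊗[ℝ] A) (Q : A ⊗[ℝ] A) : ℝ :=
  letI : DecidableEq γ.H := Classical.decEq _
  ∑ l : γ.H → F.Idx,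
    koszulSign (fun x => (l x).1) γ.edgeOrder γ.vertexOrder *
      (∏ i, F.coef (P i) (l (γ.black i)) (l (γ.inv (γ.black i)))) *
      (γ.whiteHalves.map fun x => F.coef Q (l x) (l (γ.inv x))).prod *
      ∏ v, F.surface (γ.genus v) ((γ.circleWords v).map (List.map l))

/-- `dt_{e₁} ∧ ⋯ ∧ dt_{e_p}` on `ℝ^k`. -/
noncomputable def dtWedge {p : ℕ} (e : Fin p → Fin k) : (Fin k → ℝ) [⋀^Fin p]→ₗ[ℝ] ℝ :=
  (Matrix.detRowAlternating (R := ℝ) (n := Fin p)).compLinearMap (LinearMap.funLeft ℝ ℝ e)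

variable {F}

open scoped Classical in
/-- The component of degree `p` of the differential form `ω_γ` on the orbi-cell of `γ`, with
coordinates the lengths `t` of the black edges: the result of applying `T` to the product of the
forms `α = K_t + (s ⊗ id)[K_t] dt` on the black edges and of `(π ⊗ id)[⟨-,-⟩⁻¹]` on the white edges.
The edges contributing `dt` are `e 0 < ⋯ < e (p - 1)`, and the sign is the Koszul sign for moving the
`dt`'s to the right past the odd tensors `(s ⊗ id)[K_t]`. -/
noncomputable def omega (h : HodgeDecomposition F) (p : ℕ) (t : Fin k → ℝ) :
    (Fin k → ℝ) [⋀^Fin p]→ₗ[ℝ] ℝ :=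
  ∑ e : Fin p ↪o Fin k,
    ((-1) ^ (p * (p - 1) / 2) *
      γ.amplitude F
        (fun i => if i ∈ Set.range e then h.heatKernelDt (t i) else h.heatKernel (t i))
        h.kernelAtInfinity) • dtWedge e

/-- The density of the top degree part of `ω_γ` in the orientation of `γ`. -/
noncomputable def omegaTop (h : HodgeDecomposition F) (t : Fin k → ℝ) : ℝ :=
  γ.omega h k t fun i => Pi.single i 1

open scoped Classical in
/-- The cochain which integrates `ω` over the orbi-cells of `𝓛^∞_{g,n}`. The faces at infinite
length of the cube `[0, ∞]^k` have measure zero, so the integral is taken over `[0, ∞)^k`. -/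
noncomputable def integralCochain (h : HodgeDecomposition F) (g n : ℕ) :
    ∀ k, BWGraph k → ℝ := fun _ γ =>
  if γ.IsOfType g n then ∫ t in {t | ∀ i, 0 ≤ t i}, γ.omegaTop h t else 0

end Amplitude

end BWGraph

end CellTCFT

set_option linter.unusedSectionVars false

namespace CellTCFT

/-! ## Signs -/

/-! Contractibility makes the analysis trivial. For every `a` the element `π a` is closed, hence
exact, and `π` is idempotent and kills exact elements; so `π = 0`, the Laplacian is the identity,
and `K_t` is `e^{-t}` times the inverse inner product. White edges carry the tensor zero. On a graph
with black edges only, the top-degree part of `ω_γ` is `∏ e^{-t_i}` times a constant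
(`omegaTop_eq`): up to the sign `(-1)^{k(k-1)/2}`, the amplitude with the propagator `P = (s ⊗
id)[⟨-,-⟩⁻¹]` on every edge. As `∏ e^{-t_i}` is integrable with integral 1, the cochain is this
signed amplitude on all-black graphs and zero on all others.

It is compatible with isomorphisms because `P` is odd and symmetric: reordering edges costs the sign
of the permutation, and reversing an edge costs nothing (`Iso.amplitude_eq`). Underneath lies the
fact that the surface tensors depend, up to Koszul signs, neither on the starting points of the
words nor on the orders of circles and vertices (`surface_equiv`, `vertexValue_equiv`).

The cocycle property is an algebraic Stokes theorem. Since `π = 0`, the differential of `P` is the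
inverse inner product (`dCoef_propagator`). The vertex tensors are closed (`derivList_surface`), by
the Leibniz rule, the compatibility of `d` with the inner product, and the closedness of the inverse
inner product. Summation by parts over the labels of the half-edges moves `d` from vertices to
edges, so the alternating sum of the amplitudes with one `P` replaced by the inverse inner product
vanishes (`sum_amplitude_eq_zero`). An edge carrying the inverse inner product can be contracted
(`amplitude_contract`); this is the gluing law of the open topological field theory, in three cases:
an edge between two vertices, a loop on one boundary circle, and a loop joining two circles of one
surface (`Gluing`, `sum_vertexValue`, `exists_gluing`). Contraction preserves type
(`IsOfType.contract`), so this sum is the contracted part of the coboundary. Whitened faces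
contribute zero.

The vanishing on graphs with a white edge gives the factorisation through the collapse map, with
value 0 at infinity. Pulling back determines the values on black graphs; the value at infinity is
determined because every allowed type contains a graph whose only edge is a white loop
(`exists_not_allBlack`). -/

theorem sgn_zero : sgn 0 = 1 := by simp [sgn]

theorem sgn_one : sgn 1 = -1 := by simp [sgn, ZMod.val_one]

theorem parity_cases (p : ZMod 2) : p = 0 ∨ p = 1 := by revert p; decide

theorem sgn_add (p q : ZMod 2) : sgn (p + q) = sgn p * sgn q := by
  have h : (1 : ZMod 2) + 1 = 0 := by decide
  rcases parity_cases p with rfl | rfl <;> rcases parity_cases q with rfl | rfl <;>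
    simp [sgn_zero, sgn_one, h]

theorem sgn_mul_self (p : ZMod 2) : sgn p * sgn p = 1 := by
  rcases parity_cases p with rfl | rfl <;> simp [sgn_zero, sgn_one]

theorem parity_add_self (p : ZMod 2) : p + p = 0 := by revert p; decide

theorem parity_mul_self (p : ZMod 2) : p * p = p := by revert p; decide

theorem sgn_eq_one_of_self_eq {p : ZMod 2} {r : ℝ} (hr : r ≠ 0) (h : sgn p * r = r) : p = 0 := by
  rcases parity_cases p with rfl | rfl
  · rfl
  · rw [sgn_one] at h; exact absurd (by linarith) hr

namespace DGFrobenius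

variable {A : Type*} [NonUnitalRing A] [Module ℝ A] [FiniteDimensional ℝ A] (F : DGFrobenius A)

/-! ## Structure constants in the homogeneous basis -/

/-- The matrix of the inner product. -/
noncomputable def gram : Matrix F.Idx F.Idx ℝ := fun i j => F.form (F.basis i) (F.basis j)

/-- The coefficients of the inverse inner product. -/
noncomputable def invGram : Matrix F.Idx F.Idx ℝ := fun i j => F.coef F.invForm i j

/-- The structure constants of the product: `x_a x_b = ∑ mulCoef a b c • x_c`. -/
noncomputable def mulCoef (a b c : F.Idx) : ℝ := F.basis.repr (F.basis a * F.basis b) c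

/-- The matrix of the differential: `d x_a = ∑ dCoef c a • x_c`. -/
noncomputable def dCoef (c a : F.Idx) : ℝ := F.basis.repr (F.d (F.basis a)) c

theorem basis_mem (i : F.Idx) : F.basis i ∈ F.gr i.1 :=
  F.isInternal.collectedBasis_mem _ i

theorem repr_eq_zero {p : ZMod 2} {a : A} (ha : a ∈ F.gr p) {i : F.Idx} (hi : i.1 ≠ p) :
    F.basis.repr a i = 0 :=
  F.isInternal.collectedBasis_repr_of_mem_ne _ (Ne.symm hi) ha

theorem mulCoef_parity {a b c : F.Idx} (h : F.mulCoef a b c ≠ 0) : c.1 = a.1 + b.1 := by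
  by_contra hc
  exact h (F.repr_eq_zero (F.mul_mem (F.basis_mem a) (F.basis_mem b)) hc)

theorem dCoef_parity {c a : F.Idx} (h : F.dCoef c a ≠ 0) : c.1 = a.1 + 1 := by
  by_contra hc
  exact h (F.repr_eq_zero (F.d_mem (F.basis_mem a)) hc)

theorem gram_parity {i j : F.Idx} (h : F.gram i j ≠ 0) : i.1 = j.1 := by
  by_contra hc
  exact h (F.form_even (F.basis_mem i) (F.basis_mem j) hc)

theorem gram_symm (i j : F.Idx) : F.gram i j = sgn i.1 * F.gram j i := by
  by_cases h : i.1 = j.1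
  · have := F.form_symm (F.basis_mem i) (F.basis_mem j)
    rw [← h, parity_mul_self] at this
    exact this
  · have h1 : F.gram i j = 0 := by by_contra hc; exact h (F.gram_parity hc)
    have h2 : F.gram j i = 0 := by by_contra hc; exact h (F.gram_parity hc).symm
    rw [h1, h2, mul_zero]

theorem coef_tmul (a b : A) (i j : F.Idx) :
    F.coef (a ⊗ₜ[ℝ] b) i j = F.basis.repr a i * F.basis.repr b j := by
  simp [coef, Module.Basis.tensorProduct_repr_tmul_apply, mul_comm]

theorem coef_smul (r : ℝ) (P : A ⊗[ℝ] A) (i j : F.Idx) :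
    F.coef (r • P) i j = r * F.coef P i j := by simp [coef]

theorem coef_zero (i j : F.Idx) : F.coef (0 : A ⊗[ℝ] A) i j = 0 := by simp [coef]

theorem coef_sum {κ : Type*} (s : Finset κ) (P : κ → A ⊗[ℝ] A) (i j : F.Idx) :
    F.coef (∑ k ∈ s, P k) i j = ∑ k ∈ s, F.coef (P k) i j := by simp [coef]

theorem eq_sum_repr (a : A) : a = ∑ c, F.basis.repr a c • F.basis c := (F.basis.sum_repr a).symm

theorem map_eq_sum (φ : A →ₗ[ℝ] ℝ) (a : A) : φ a = ∑ c, F.basis.repr a c * φ (F.basis c) := by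
  conv_lhs => rw [F.eq_sum_repr a]
  simp only [map_sum, map_smul, smul_eq_mul]

theorem invGram_eq (i j : F.Idx) :
    F.invGram i j = F.basis.repr (F.form.dualBasis F.nondegenerate F.basis i) j := by
  classical
  simp only [invGram, invForm, coef_sum, coef_tmul, Module.Basis.repr_self]
  rw [Finset.sum_eq_single i]
  · simp
  · intro k _ hk
    rw [Finsupp.single_eq_of_ne (Ne.symm hk), zero_mul]
  · simp

/-- The defining property of the dual basis, written in coordinates. -/
theorem invGram_mul_gram : F.invGram * F.gram = 1 := by
  classical
  ext i k
  rw [Matrix.mul_apply]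
  have h : F.form (F.form.dualBasis F.nondegenerate F.basis i) (F.basis k) =
      if k = i then 1 else 0 :=
    LinearMap.BilinForm.apply_dualBasis_left (B := F.form) F.nondegenerate F.basis i k
  rw [F.eq_sum_repr (F.form.dualBasis F.nondegenerate F.basis i)] at h
  simp only [map_sum, map_smul, LinearMap.sum_apply, LinearMap.smul_apply, smul_eq_mul] at h
  simp only [invGram_eq, gram]
  rw [h, Matrix.one_apply]
  simp only [eq_comm]

theorem gram_mul_invGram : F.gram * F.invGram = 1 :=
  mul_eq_one_comm.mp F.invGram_mul_gram

theorem eq_invGram_of_mul_gram {X : Matrix F.Idx F.Idx ℝ} (h : X * F.gram = 1) :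
    X = F.invGram := by
  calc X = X * (F.gram * F.invGram) := by rw [gram_mul_invGram, mul_one]
    _ = F.invGram := by rw [← mul_assoc, h, one_mul]

/-- The way nondegeneracy is used below: an identity between tensors in `A ⊗ A` is multiplied by the
Gram matrix, which lowers the second index and turns it into an identity between operators on `A`.
-/
theorem eq_of_mul_gram {X Y : Matrix F.Idx F.Idx ℝ} (h : X * F.gram = Y * F.gram) : X = Y := by
  calc X = X * F.gram * F.invGram := by rw [mul_assoc, gram_mul_invGram, mul_one]
    _ = Y := by rw [h, mul_assoc, gram_mul_invGram, mul_one]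

/-- As the inner product is even, twisting the entries of `invGram` by `(-1)^(i + j)` gives another
inverse of the Gram matrix, and inverses are unique. `invGram_symm` argues in the same way with the
twisted transpose. -/
theorem invGram_parity {i j : F.Idx} (h : F.invGram i j ≠ 0) : i.1 = j.1 := by
  let X : Matrix F.Idx F.Idx ℝ := fun i j => sgn (i.1 + j.1) * F.invGram i j
  have hX : X = F.invGram := by
    apply F.eq_invGram_of_mul_gram
    ext i k
    have : (X * F.gram) i k = sgn (i.1 + k.1) * (F.invGram * F.gram) i k := by
      rw [Matrix.mul_apply, Matrix.mul_apply, Finset.mul_sum]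
      refine Finset.sum_congr rfl fun j _ => ?_
      by_cases hj : F.gram j k = 0
      · simp [hj]
      · simp only [X, F.gram_parity hj]; ring
    rw [this, invGram_mul_gram]
    by_cases hik : i = k
    · subst hik; simp [parity_add_self, sgn_zero]
    · simp [Matrix.one_apply_ne hik]
  have := sgn_eq_one_of_self_eq h (congrFun (congrFun hX i) j)
  calc i.1 = i.1 + j.1 + j.1 := by rw [add_assoc, parity_add_self, add_zero]
    _ = j.1 := by rw [this, zero_add]

theorem invGram_symm (i j : F.Idx) : F.invGram i j = sgn i.1 * F.invGram j i := by
  let X : Matrix F.Idx F.Idx ℝ := fun i j => sgn i.1 * F.invGram j i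
  have hX : X = F.invGram := by
    apply F.eq_invGram_of_mul_gram
    ext i k
    have : (X * F.gram) i k = sgn i.1 * sgn k.1 * (F.gram * F.invGram) k i := by
      rw [Matrix.mul_apply, Matrix.mul_apply, Finset.mul_sum]
      refine Finset.sum_congr rfl fun j _ => ?_
      rw [F.gram_symm j k]
      by_cases hj : F.gram k j = 0
      · simp [hj]
      · simp only [X, F.gram_parity hj]; ring
    rw [this, gram_mul_invGram]
    by_cases hik : i = k
    · subst hik; simp [sgn_mul_self]
    · simp [Matrix.one_apply_ne hik, Matrix.one_apply_ne (Ne.symm hik)]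
  exact (congrFun (congrFun hX i) j).symm

/-- The element `y` need not be homogeneous: by evenness only its component of the parity of `a`
contributes, so the sign depends on `a` alone. -/
theorem form_basis_left (a : F.Idx) (y : A) :
    F.form (F.basis a) y = sgn a.1 * F.form y (F.basis a) := by
  rw [F.eq_sum_repr y]
  simp only [map_sum, map_smul, LinearMap.sum_apply, LinearMap.smul_apply, smul_eq_mul,
    Finset.mul_sum]
  refine Finset.sum_congr rfl fun c _ => ?_
  have := F.gram_symm a c
  simp only [gram] at this
  rw [this]; ring

theorem form_mul_left (a b : F.Idx) (y : A) :
    F.form (F.basis a * F.basis b) y = ∑ c, F.mulCoef a b c * F.form (F.basis c) y :=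
  F.map_eq_sum (F.form.flip y) _

theorem form_d_left (a : F.Idx) (y : A) :
    F.form (F.d (F.basis a)) y = ∑ c, F.dCoef c a * F.form (F.basis c) y :=
  F.map_eq_sum (F.form.flip y) _

theorem form_d_right (a : F.Idx) (y : A) :
    F.form y (F.d (F.basis a)) = ∑ c, F.dCoef c a * F.form y (F.basis c) :=
  F.map_eq_sum (F.form y) _

theorem sum_invGram_form (c : F.Idx) (y : A) :
    ∑ i, F.invGram c i * F.form (F.basis i) y = F.basis.repr y c := by
  conv_lhs => rw [F.eq_sum_repr y]
  simp only [map_sum, map_smul, smul_eq_mul, Finset.mul_sum]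
  rw [Finset.sum_comm]
  have : ∀ e, ∑ i, F.invGram c i * (F.basis.repr y e * F.form (F.basis i) (F.basis e)) =
      (F.invGram * F.gram) c e * F.basis.repr y e := by
    intro e
    rw [Matrix.mul_apply, Finset.sum_mul]
    exact Finset.sum_congr rfl fun i _ => by simp only [gram]; ring
  simp [this, invGram_mul_gram, Matrix.one_apply]

/-- A letter slides along the outer side of a strip. -/
theorem sum_invGram_mulCoef_outer (a c j : F.Idx) :
    ∑ i, F.invGram i j * F.mulCoef a i c = ∑ i, F.invGram c i * F.mulCoef i a j := by
  suffices h : (Matrix.of fun c j => ∑ i, F.invGram i j * F.mulCoef a i c : Matrix F.Idx F.Idx ℝ) =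
      Matrix.of fun c j => ∑ i, F.invGram c i * F.mulCoef i a j from congrFun (congrFun h c) j
  apply F.eq_of_mul_gram
  ext c k
  simp only [Matrix.mul_apply, Matrix.of_apply, Finset.sum_mul]
  -- After lowering the index `j` both sides are the structure constant of `x_a x_k`: on the left
  -- the inverse cancels, on the right invariance moves `x_a` to the other side of the inner
  -- product.
  trans F.mulCoef a k c
  · rw [Finset.sum_comm]
    have : ∀ i, ∑ j, F.invGram i j * F.mulCoef a i c * F.gram j k =
        (F.invGram * F.gram) i k * F.mulCoef a i c := by
      intro i
      rw [Matrix.mul_apply, Finset.sum_mul]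
      exact Finset.sum_congr rfl fun j _ => by ring
    simp [this, invGram_mul_gram, Matrix.one_apply]
  · rw [Finset.sum_comm]
    have : ∀ i, ∑ j, F.invGram c i * F.mulCoef i a j * F.gram j k =
        F.invGram c i * F.form (F.basis i) (F.basis a * F.basis k) := by
      intro i
      rw [F.form_mul, form_mul_left, Finset.mul_sum]
      exact Finset.sum_congr rfl fun j _ => by simp only [gram]; ring
    rw [Finset.sum_congr rfl fun i _ => this i, sum_invGram_form]
    rfl

/-- A letter slides along the inner side of a strip. -/
theorem sum_invGram_mulCoef_inner (a c j : F.Idx) :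
    ∑ i, F.invGram i j * F.mulCoef i a c =
      sgn a.1 * ∑ i, F.invGram c i * F.mulCoef a i j := by
  suffices h : (Matrix.of fun c j => ∑ i, F.invGram i j * F.mulCoef i a c : Matrix F.Idx F.Idx ℝ) =
      Matrix.of fun c j => sgn a.1 * ∑ i, F.invGram c i * F.mulCoef a i j from
    congrFun (congrFun h c) j
  apply F.eq_of_mul_gram
  ext c k
  simp only [Matrix.mul_apply, Matrix.of_apply, Finset.sum_mul, Finset.mul_sum]
  trans F.mulCoef k a c
  · rw [Finset.sum_comm]
    have : ∀ i, ∑ j, F.invGram i j * F.mulCoef i a c * F.gram j k =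
        (F.invGram * F.gram) i k * F.mulCoef i a c := by
      intro i
      rw [Matrix.mul_apply, Finset.sum_mul]
      exact Finset.sum_congr rfl fun j _ => by ring
    simp [this, invGram_mul_gram, Matrix.one_apply]
  · rw [Finset.sum_comm]
    have : ∀ i, ∑ j, sgn a.1 * (F.invGram c i * F.mulCoef a i j) * F.gram j k =
        F.invGram c i * F.form (F.basis i) (F.basis k * F.basis a) := by
      intro i
      -- Cyclic invariance of the trilinear form; the sign is that of moving `x_a` to the front,
      -- simplified by evenness.
      have h1 : F.form (F.basis i) (F.basis k * F.basis a) =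
          sgn a.1 * F.form (F.basis a * F.basis i) (F.basis k) := by
        rw [F.form_mul, ← F.form_mul (F.basis a), form_basis_left, ← mul_assoc, sgn_mul_self,
          one_mul]
      rw [h1, form_mul_left, Finset.mul_sum, Finset.mul_sum]
      exact Finset.sum_congr rfl fun j _ => by simp only [gram]; ring
    rw [Finset.sum_congr rfl fun i _ => this i, sum_invGram_form]
    rfl

/-- The inverse inner product is closed. -/
theorem sum_dCoef_invGram (c j : F.Idx) :
    ∑ i, F.dCoef c i * F.invGram i j + sgn c.1 * ∑ i, F.dCoef j i * F.invGram c i = 0 := by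
  suffices h : (Matrix.of fun c j => ∑ i, F.dCoef c i * F.invGram i j : Matrix F.Idx F.Idx ℝ) =
      Matrix.of fun c j => -(sgn c.1 * ∑ i, F.dCoef j i * F.invGram c i) by
    have h2 := congrFun (congrFun h c) j
    simp only [Matrix.of_apply] at h2
    linarith
  apply F.eq_of_mul_gram
  ext c k
  simp only [Matrix.mul_apply, Matrix.of_apply, Finset.sum_mul, Finset.mul_sum, neg_mul]
  -- With the index lowered, both terms become the operator `d`, the second one because `d` is
  -- skew-adjoint for the inner product.
  trans F.dCoef c k
  · rw [Finset.sum_comm]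
    have : ∀ i, ∑ j, F.dCoef c i * F.invGram i j * F.gram j k =
        (F.invGram * F.gram) i k * F.dCoef c i := by
      intro i
      rw [Matrix.mul_apply, Finset.sum_mul]
      exact Finset.sum_congr rfl fun j _ => by ring
    simp [this, invGram_mul_gram, Matrix.one_apply]
  · rw [Finset.sum_neg_distrib, Finset.sum_comm]
    have : ∀ i, ∑ j, sgn c.1 * (F.dCoef j i * F.invGram c i) * F.gram j k =
        -(F.invGram c i * F.form (F.basis i) (F.d (F.basis k))) := by
      intro i
      trans sgn c.1 * F.invGram c i * F.form (F.d (F.basis i)) (F.basis k)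
      · rw [form_d_left, Finset.mul_sum]
        exact Finset.sum_congr rfl fun j _ => by simp only [gram]; ring
      · rw [F.form_d _ (F.basis_mem i)]
        by_cases hi : F.invGram c i = 0
        · simp [hi]
        · rw [F.invGram_parity hi]
          linear_combination (-(F.invGram c i * F.form (F.basis i) (F.d (F.basis k)))) *
            sgn_mul_self i.1
    rw [Finset.sum_congr rfl fun i _ => this i, Finset.sum_neg_distrib, neg_neg, sum_invGram_form]
    rfl

theorem sum_mulCoef_dCoef [IsScalarTower ℝ A A] [SMulCommClass ℝ A A] (a b e : F.Idx) :
    ∑ c, F.mulCoef a b c * F.dCoef e c =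
      ∑ c, F.dCoef c a * F.mulCoef c b e + sgn a.1 * ∑ c, F.dCoef c b * F.mulCoef a c e := by
  have h := congrArg (fun z => F.basis.repr z e) (F.leibniz (F.basis b) (F.basis_mem a))
  simp only [map_add, map_smul, Finsupp.add_apply, Finsupp.smul_apply, smul_eq_mul] at h
  have h1 : F.basis.repr (F.d (F.basis a * F.basis b)) e = ∑ c, F.mulCoef a b c * F.dCoef e c := 
    F.map_eq_sum (F.basis.coord e ∘ₗ F.d) _
  have h2 : F.basis.repr (F.d (F.basis a) * F.basis b) e = ∑ c, F.dCoef c a * F.mulCoef c b e := 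
    F.map_eq_sum (F.basis.coord e ∘ₗ LinearMap.mulRight ℝ (F.basis b)) _
  have h3 : F.basis.repr (F.basis a * F.d (F.basis b)) e = ∑ c, F.dCoef c b * F.mulCoef a c e := 
    F.map_eq_sum (F.basis.coord e ∘ₗ LinearMap.mulLeft ℝ (F.basis a)) _
  rw [← h1, ← h2, ← h3, h]

end DGFrobenius

theorem sum_rotate {κ ι ι' : Type*} [Fintype ι] [Fintype ι'] (s : Finset κ)
    (f : κ → ι → ι' → ℝ) : ∑ k ∈ s, ∑ i, ∑ j, f k i j = ∑ i, ∑ j, ∑ k ∈ s, f k i j := by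
  rw [Finset.sum_comm]
  exact Finset.sum_congr rfl fun i _ => Finset.sum_comm

namespace DGFrobenius

variable {A : Type*} [NonUnitalRing A] [Module ℝ A] [FiniteDimensional ℝ A] (F : DGFrobenius A)

/-! ## The disk tensor -/

theorem parity_nil : F.parity [] = 0 := rfl

theorem parity_cons (a : F.Idx) (w : List F.Idx) : F.parity (a :: w) = a.1 + F.parity w := by
  simp [parity]

theorem parity_append (u v : List F.Idx) : F.parity (u ++ v) = F.parity u + F.parity v := by
  simp [parity]

theorem diskAux_cons (e f : A) {L : List A} (hL : L ≠ []) :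
    F.diskAux e (f :: L) = F.diskAux (e * f) L := by
  cases L with
  | nil => exact absurd rfl hL
  | cons c l => rfl

/-- Associativity if a letter follows the merged pair; invariance of the inner product if the pair
stands at the end. -/
theorem diskAux_merge (e a b : A) (α γ : List A) :
    F.diskAux e (α ++ a :: b :: γ) = F.diskAux e (α ++ (a * b) :: γ) := by
  induction α generalizing e with
  | nil =>
    cases γ with
    | nil => exact (F.form_mul e a b).symm
    | cons c γ => simp only [List.nil_append, diskAux, mul_assoc]
  | cons f α ih =>
    rw [List.cons_append, List.cons_append, diskAux_cons _ _ _ (by simp),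
      diskAux_cons _ _ _ (by simp), ih]

/-- The hypothesis forbids merging a two-letter word: a disk with a single interval has the default
value 0, whereas `⟨a, b⟩` need not vanish. -/
theorem disk_merge (a b : A) (α γ : List A) (h : α ++ γ ≠ []) :
    F.disk (α ++ a :: b :: γ) = F.disk (α ++ (a * b) :: γ) := by
  cases α with
  | nil =>
    cases γ with
    | nil => exact absurd rfl h
    | cons c γ => rfl
  | cons e α => exact F.diskAux_merge e a b α γ

section Linear

variable [IsScalarTower ℝ A A] [SMulCommClass ℝ A A]

theorem exists_diskAux_eq_head (γ : List A) : ∃ φ : A →ₗ[ℝ] ℝ, ∀ z, φ z = F.diskAux z γ := by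
  induction γ with
  | nil => exact ⟨0, fun z => rfl⟩
  | cons b l ih =>
    cases l with
    | nil => exact ⟨F.form.flip b, fun z => rfl⟩
    | cons c l =>
      obtain ⟨φ, hφ⟩ := ih
      exact ⟨φ ∘ₗ LinearMap.mulRight ℝ b, fun z => hφ _⟩

theorem exists_diskAux_eq (e : A) (α γ : List A) :
    ∃ φ : A →ₗ[ℝ] ℝ, ∀ z, φ z = F.diskAux e (α ++ z :: γ) := by
  induction α generalizing e with
  | nil =>
    cases γ with
    | nil => exact ⟨F.form e, fun z => rfl⟩
    | cons c γ =>
      obtain ⟨φ, hφ⟩ := F.exists_diskAux_eq_head (c :: γ)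
      exact ⟨φ ∘ₗ LinearMap.mulLeft ℝ e, fun z => hφ _⟩
  | cons f α ih =>
    obtain ⟨φ, hφ⟩ := ih (e * f)
    exact ⟨φ, fun z => by rw [hφ, List.cons_append, diskAux_cons _ _ _ (by simp)]⟩

/-- Linearity in one slot, packaged as a functional so that `map_eq_sum` can expand the letter in
the basis. -/
theorem exists_disk_eq (α γ : List A) :
    ∃ φ : A →ₗ[ℝ] ℝ, ∀ z, φ z = F.disk (α ++ z :: γ) := by
  cases α with
  | nil => exact F.exists_diskAux_eq_head γ
  | cons e α => exact F.exists_diskAux_eq e α γ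

/-- The disk tensor on words in the homogeneous basis. -/
noncomputable def diskWord (w : List F.Idx) : ℝ := F.disk (w.map F.basis)

theorem diskWord_pair (a b : F.Idx) : F.diskWord [a, b] = F.gram a b := rfl

/-- Drives the inductions on word length: parity, cyclicity, gluing and closedness of the disk are
reduced by merging two neighbours to words of two letters, where they are axioms on the inner
product or properties of its inverse. -/
theorem diskWord_merge (a b : F.Idx) (α γ : List F.Idx) (h : α ++ γ ≠ []) :
    F.diskWord (α ++ a :: b :: γ) = ∑ c, F.mulCoef a b c * F.diskWord (α ++ c :: γ) := by
  obtain ⟨φ, hφ⟩ := F.exists_disk_eq (α.map F.basis) (γ.map F.basis)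
  have h' : α.map F.basis ++ γ.map F.basis ≠ [] := by
    rw [← List.map_append]; simpa using h
  simp only [diskWord, List.map_append, List.map_cons]
  rw [disk_merge _ _ _ _ _ h', ← hφ, F.map_eq_sum φ]
  simp only [hφ, mulCoef]

theorem diskWord_parity {w : List F.Idx} (h : F.diskWord w ≠ 0) : F.parity w = 0 := by
  induction hn : w.length generalizing w with
  | zero =>
    rw [List.length_eq_zero_iff.mp hn, parity_nil]
  | succ n ih =>
    match w, h, hn with
    | [a], h, _ => exact absurd rfl h
    | [a, b], h, _ =>
      rw [parity_cons, parity_cons, parity_nil, F.gram_parity h, add_zero, parity_add_self]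
    | a :: b :: c :: w, h, hn =>
      have := F.diskWord_merge a b [] (c :: w) (by simp)
      simp only [List.nil_append] at this
      rw [this] at h
      obtain ⟨e, -, he⟩ := Finset.exists_ne_zero_of_sum_ne_zero h
      have h1 := ih (right_ne_zero_of_mul he) (by simpa using hn)
      rw [parity_cons, F.mulCoef_parity (left_ne_zero_of_mul he)] at h1
      rw [parity_cons, parity_cons, ← h1, add_assoc]

/-- Two letters of `w` are merged, which does not disturb the moving letter `a`; the base case is
graded symmetry of the inner product. -/
theorem diskWord_cyclic (a : F.Idx) (w : List F.Idx) :
    F.diskWord (a :: w) = sgn (a.1 * F.parity w) * F.diskWord (w ++ [a]) := by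
  induction hn : w.length generalizing w with
  | zero =>
    rw [List.length_eq_zero_iff.mp hn, parity_nil, mul_zero, sgn_zero, one_mul, List.nil_append]
  | succ n ih =>
    match w, hn with
    | [b], _ =>
      simp only [List.cons_append, List.nil_append, diskWord_pair, parity_cons, parity_nil,
        add_zero]
      rw [F.gram_symm a b]
      by_cases h : F.gram b a = 0
      · simp [h]
      · rw [F.gram_parity h, parity_mul_self]
    | b :: c :: w, hn =>
      have h1 := F.diskWord_merge b c [a] w (by simp)
      have h2 := F.diskWord_merge b c [] (w ++ [a]) (by simp)
      simp only [List.nil_append, List.cons_append] at h1 h2 ⊢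
      rw [h1, h2, Finset.mul_sum]
      refine Finset.sum_congr rfl fun e _ => ?_
      rw [ih (e :: w) (by simpa using hn), parity_cons, parity_cons, parity_cons]
      by_cases he : F.mulCoef b c e = 0
      · simp [he]
      · rw [F.mulCoef_parity he, List.cons_append, add_assoc]; ring

/-- Gluing two disks along an interval yields a disk. -/
theorem sum_diskWord_mul_diskWord {α β : List F.Idx} (hα : α ≠ []) (hβ : β ≠ []) :
    ∑ i, ∑ j, F.invGram i j * (F.diskWord (α ++ [i]) * F.diskWord (j :: β)) =
      F.diskWord (α ++ β) := by
  induction hn : α.length + β.length generalizing α β with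
  | zero => exact absurd (List.length_eq_zero_iff.mp (by omega)) hα
  | succ n ih =>
    -- Merging shortens `α` to one letter and then `β`; for two single letters the claim is that
    -- `gram`, `invGram`, `gram` contract to `gram`.
    match α, β, hn with
    | [a], [b], _ =>
      simp only [List.cons_append, List.nil_append, diskWord_pair]
      have : ∀ i, ∑ j, F.invGram i j * (F.gram a i * F.gram j b) =
          (F.invGram * F.gram) i b * F.gram a i := by
        intro i
        rw [Matrix.mul_apply, Finset.sum_mul]
        exact Finset.sum_congr rfl fun j _ => by ring
      simp [this, invGram_mul_gram, Matrix.one_apply]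
    | a :: a' :: α, b :: β, hn =>
      have h1 : ∀ i, F.diskWord (a :: a' :: α ++ [i]) =
          ∑ c, F.mulCoef a a' c * F.diskWord (c :: α ++ [i]) := fun i =>
        F.diskWord_merge a a' [] (α ++ [i]) (by simp)
      have h2 : F.diskWord (a :: a' :: α ++ b :: β) =
          ∑ c, F.mulCoef a a' c * F.diskWord (c :: α ++ b :: β) :=
        F.diskWord_merge a a' [] (α ++ b :: β) (by simp)
      rw [h2]
      simp only [h1, Finset.sum_mul, Finset.mul_sum]
      have : ∀ c : F.Idx, F.mulCoef a a' c * F.diskWord (c :: α ++ b :: β) =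
          ∑ i, ∑ j, F.invGram i j *
            (F.mulCoef a a' c * F.diskWord (c :: α ++ [i]) * F.diskWord (j :: b :: β)) := by
        intro c
        rw [← ih (α := c :: α) (β := b :: β) (by simp) (by simp)
          (by simp only [List.length_cons] at hn ⊢; omega), Finset.mul_sum]
        refine Finset.sum_congr rfl fun i _ => ?_
        rw [Finset.mul_sum]
        exact Finset.sum_congr rfl fun j _ => by ring
      rw [Finset.sum_congr rfl fun c _ => this c]
      exact (sum_rotate _ _).symm
    | [a], b :: b' :: β, hn =>
      have h1 : ∀ j, F.diskWord (j :: b :: b' :: β) =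
          ∑ c, F.mulCoef b b' c * F.diskWord (j :: c :: β) := fun j =>
        F.diskWord_merge b b' [j] β (by simp)
      have h2 : F.diskWord ([a] ++ b :: b' :: β) =
          ∑ c, F.mulCoef b b' c * F.diskWord ([a] ++ c :: β) :=
        F.diskWord_merge b b' [a] β (by simp)
      rw [h2]
      simp only [h1, Finset.mul_sum]
      have : ∀ c : F.Idx, F.mulCoef b b' c * F.diskWord ([a] ++ c :: β) =
          ∑ i, ∑ j, F.invGram i j *
            (F.diskWord ([a] ++ [i]) * (F.mulCoef b b' c * F.diskWord (j :: c :: β))) := by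
        intro c
        rw [← ih (α := [a]) (β := c :: β) (by simp) (by simp)
          (by simp only [List.length_cons] at hn ⊢; omega), Finset.mul_sum]
        refine Finset.sum_congr rfl fun i _ => ?_
        rw [Finset.mul_sum]
        exact Finset.sum_congr rfl fun j _ => by ring
      rw [Finset.sum_congr rfl fun c _ => this c]
      exact (sum_rotate _ _).symm

end Linear

/-! ## Strips -/

/-- Gluing a strip whose ends are placed before and after the word `β`. -/
noncomputable def strip (f : List F.Idx → ℝ) (α β γ : List F.Idx) : ℝ :=
  ∑ i, ∑ j, F.invGram i j * sgn (j.1 * F.parity β) * f (α ++ i :: (β ++ j :: γ))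

theorem strip_sum {κ : Type*} (s : Finset κ) (c : κ → ℝ) (f : κ → List F.Idx → ℝ)
    (α β γ : List F.Idx) :
    F.strip (fun x => ∑ k ∈ s, c k * f k x) α β γ = ∑ k ∈ s, c k * F.strip (f k) α β γ := by
  simp only [strip, Finset.mul_sum]
  rw [sum_rotate]
  refine Finset.sum_congr rfl fun i _ => Finset.sum_congr rfl fun j _ =>
    Finset.sum_congr rfl fun k _ => ?_
  ring

theorem strip_append (f : List F.Idx → ℝ) (α β γ δ : List F.Idx) :
    F.strip (fun x => f (x ++ δ)) α β γ = F.strip f α β (γ ++ δ) := by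
  simp only [strip, List.append_assoc, List.cons_append]

/-- Letters can be moved along the sides of strips. -/
structure Slidable (f : List F.Idx → ℝ) : Prop where
  outer : ∀ α a β γ, F.strip f (α ++ [a]) β γ =
    sgn (a.1 * F.parity β) * F.strip f α β (a :: γ)
  inner : ∀ α a β γ, F.strip f α (a :: β) γ =
    sgn (a.1 * F.parity β) * F.strip f α (β ++ [a]) γ

namespace Slidable

variable {F} {f : List F.Idx → ℝ}

theorem sum {κ : Type*} (s : Finset κ) (c : κ → ℝ) {f : κ → List F.Idx → ℝ}
    (h : ∀ k, F.Slidable (f k)) : F.Slidable fun x => ∑ k ∈ s, c k * f k x where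
  outer α a β γ := by
    rw [strip_sum, strip_sum, Finset.mul_sum]
    exact Finset.sum_congr rfl fun k _ => by rw [(h k).outer]; ring
  inner α a β γ := by
    rw [strip_sum, strip_sum, Finset.mul_sum]
    exact Finset.sum_congr rfl fun k _ => by rw [(h k).inner]; ring

theorem append (h : F.Slidable f) (δ : List F.Idx) : F.Slidable fun x => f (x ++ δ) where
  outer α a β γ := by rw [strip_append, strip_append, h.outer]; rfl
  inner α a β γ := by rw [strip_append, strip_append, h.inner]

theorem outer_append (h : F.Slidable f) (α δ β γ : List F.Idx) :
    F.strip f (α ++ δ) β γ = sgn (F.parity δ * F.parity β) * F.strip f α β (δ ++ γ) := by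
  induction δ generalizing α γ with
  | nil => simp [parity_nil, sgn_zero]
  | cons a δ ih =>
    have h1 : α ++ a :: δ = (α ++ [a]) ++ δ := by simp
    rw [h1, ih, h.outer, parity_cons, add_mul, sgn_add, List.cons_append]
    ring

theorem inner_append (h : F.Slidable f) (α δ β γ : List F.Idx) :
    F.strip f α (δ ++ β) γ = sgn (F.parity δ * F.parity β) * F.strip f α (β ++ δ) γ := by
  induction δ generalizing β with
  | nil => simp [parity_nil, sgn_zero]
  | cons a δ ih =>
    rw [List.cons_append, h.inner, List.append_assoc, ih, parity_cons, parity_append,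
      parity_append, parity_cons, parity_nil, List.append_assoc]
    simp only [List.cons_append, List.nil_append, add_zero, mul_add, add_mul, sgn_add]
    rw [mul_comm a.1 (F.parity δ)]
    linear_combination sgn (a.1 * F.parity β) * sgn (F.parity δ * F.parity β) *
      F.strip f α (β ++ a :: δ) γ * sgn_mul_self (F.parity δ * a.1)

end Slidable

section Linear

variable [IsScalarTower ℝ A A] [SMulCommClass ℝ A A]

/-- The letter is merged into one end of the strip, carried across by `sum_invGram_mulCoef_outer` or
`sum_invGram_mulCoef_inner`, and split off at the other end. -/
theorem slidable_diskWord : F.Slidable F.diskWord where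
  outer α a β γ := by
    have h1 : ∀ i j, F.diskWord (α ++ [a] ++ i :: (β ++ j :: γ)) =
        ∑ c, F.mulCoef a i c * F.diskWord (α ++ c :: (β ++ j :: γ)) := by
      intro i j
      rw [← F.diskWord_merge a i α (β ++ j :: γ) (by simp), List.append_assoc]; rfl
    have h2 : ∀ i j, F.diskWord (α ++ i :: (β ++ j :: a :: γ)) =
        ∑ c, F.mulCoef j a c * F.diskWord (α ++ i :: (β ++ c :: γ)) := by
      intro i j
      have := F.diskWord_merge j a (α ++ i :: β) γ (by simp)
      simpa only [List.append_assoc, List.cons_append] using this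
    simp only [strip, h1, h2]
    trans ∑ c, ∑ j, (∑ i, F.invGram i j * F.mulCoef a i c) *
      (sgn (j.1 * F.parity β) * F.diskWord (α ++ c :: (β ++ j :: γ)))
    · simp only [Finset.mul_sum, Finset.sum_mul]
      refine (Finset.sum_congr rfl fun i _ => Finset.sum_comm).trans ?_
      rw [Finset.sum_comm]
      refine Finset.sum_congr rfl fun c _ => ?_
      rw [Finset.sum_comm]
      exact Finset.sum_congr rfl fun j _ => Finset.sum_congr rfl fun i _ => by ring
    · simp only [sum_invGram_mulCoef_outer, Finset.mul_sum, Finset.sum_mul]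
      refine Finset.sum_congr rfl fun c _ => ?_
      rw [Finset.sum_comm]
      refine Finset.sum_congr rfl fun i _ => Finset.sum_congr rfl fun j _ => ?_
      by_cases h : F.mulCoef i a j = 0
      · simp [h]
      · rw [F.mulCoef_parity h, add_mul, sgn_add]; ring
  inner α a β γ := by
    have h1 : ∀ i j, F.diskWord (α ++ i :: (a :: β ++ j :: γ)) =
        ∑ c, F.mulCoef i a c * F.diskWord (α ++ c :: (β ++ j :: γ)) := fun i j =>
      F.diskWord_merge i a α (β ++ j :: γ) (by simp)
    have h2 : ∀ i j, F.diskWord (α ++ i :: (β ++ [a] ++ j :: γ)) =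
        ∑ c, F.mulCoef a j c * F.diskWord (α ++ i :: (β ++ c :: γ)) := by
      intro i j
      have := F.diskWord_merge a j (α ++ i :: β) γ (by simp)
      simpa only [List.append_assoc, List.cons_append, List.nil_append] using this
    simp only [strip, h1, h2]
    trans ∑ c, ∑ j, (∑ i, F.invGram i j * F.mulCoef i a c) *
      (sgn (j.1 * F.parity (a :: β)) * F.diskWord (α ++ c :: (β ++ j :: γ)))
    · simp only [Finset.mul_sum, Finset.sum_mul]
      refine (Finset.sum_congr rfl fun i _ => Finset.sum_comm).trans ?_
      rw [Finset.sum_comm]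
      refine Finset.sum_congr rfl fun c _ => ?_
      rw [Finset.sum_comm]
      exact Finset.sum_congr rfl fun j _ => Finset.sum_congr rfl fun i _ => by ring
    · simp only [sum_invGram_mulCoef_inner, Finset.mul_sum, Finset.sum_mul]
      refine Finset.sum_congr rfl fun c _ => ?_
      rw [Finset.sum_comm]
      refine Finset.sum_congr rfl fun i _ => Finset.sum_congr rfl fun j _ => ?_
      by_cases h : F.mulCoef a i j = 0
      · simp [h]
      · simp only [F.mulCoef_parity h, parity_cons, parity_append, parity_nil, add_zero, add_mul,
          mul_add, sgn_add, parity_mul_self]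
        rw [mul_comm i.1 a.1]
        linear_combination sgn (a.1 * F.parity β) * sgn (a.1 * i.1) * F.invGram c i *
          F.mulCoef a i j * sgn (i.1 * F.parity β) * F.diskWord (α ++ c :: (β ++ j :: γ)) *
          sgn_mul_self a.1

end Linear

end DGFrobenius

theorem sum_exchange {ι ι' κ κ' : Type*} [Fintype ι] [Fintype ι'] [Fintype κ] [Fintype κ']
    (f : κ → κ' → ι → ι' → ℝ) :
    ∑ k, ∑ l, ∑ i, ∑ j, f k l i j = ∑ i, ∑ j, ∑ k, ∑ l, f k l i j :=
  (Finset.sum_congr rfl fun _ _ => sum_rotate _ _).trans (sum_rotate _ _)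

namespace DGFrobenius

variable {A : Type*} [NonUnitalRing A] [Module ℝ A] [FiniteDimensional ℝ A] (F : DGFrobenius A)

/-! ## Interlaced strips -/

/-- Gluing two strips with interlaced ends, separated by the words `β₁`, `β₂`, `β₃`. -/
noncomputable def interlace (f : List F.Idx → ℝ) (α β₁ β₂ β₃ γ : List F.Idx) : ℝ :=
  ∑ k, ∑ l, F.invGram k l * sgn (l.1 * (F.parity β₂ + F.parity β₃)) *
    F.strip f α (β₁ ++ k :: β₂) (β₃ ++ l :: γ)

/-- The two strips play symmetric roles: either may be glued first. Each sliding rule is applied in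
the form where the strip concerned is the inner sum. -/
theorem interlace_eq (f : List F.Idx → ℝ) (α β₁ β₂ β₃ γ : List F.Idx) :
    F.interlace f α β₁ β₂ β₃ γ = ∑ i, ∑ j, F.invGram i j *
      sgn (j.1 * (F.parity β₁ + F.parity β₂)) * F.strip f (α ++ i :: β₁) (β₂ ++ j :: β₃) γ := by
  simp only [interlace, strip, Finset.mul_sum]
  refine (sum_exchange _).trans ?_
  refine Finset.sum_congr rfl fun i _ => Finset.sum_congr rfl fun j _ => Finset.sum_congr rfl
    fun k _ => Finset.sum_congr rfl fun l _ => ?_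
  by_cases h : F.invGram k l = 0
  · simp [h]
  · simp only [parity_append, parity_cons, F.invGram_parity h, mul_add, sgn_add, List.append_assoc,
      List.cons_append]
    rw [mul_comm j.1 l.1]
    ring

theorem interlace_sum {κ : Type*} (s : Finset κ) (c : κ → ℝ) (f : κ → List F.Idx → ℝ)
    (α β₁ β₂ β₃ γ : List F.Idx) :
    F.interlace (fun x => ∑ k ∈ s, c k * f k x) α β₁ β₂ β₃ γ =
      ∑ k ∈ s, c k * F.interlace (f k) α β₁ β₂ β₃ γ := by
  simp only [interlace, strip_sum, Finset.mul_sum]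
  rw [sum_rotate]
  refine Finset.sum_congr rfl fun i _ => Finset.sum_congr rfl fun j _ =>
    Finset.sum_congr rfl fun k _ => ?_
  ring

theorem interlace_append (f : List F.Idx → ℝ) (α β₁ β₂ β₃ γ δ : List F.Idx) :
    F.interlace (fun x => f (x ++ δ)) α β₁ β₂ β₃ γ = F.interlace f α β₁ β₂ β₃ (γ ++ δ) := by
  simp only [interlace, strip_append, List.append_assoc, List.cons_append]

namespace Slidable

variable {F} {f : List F.Idx → ℝ}

/-- Together with `interlace_third`, `interlace_second` and `interlace_first` this traces the path
of a letter around a handle. Two interlaced strips leave a single boundary circle, along which a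
letter standing before the handle passes through the third, second and first gap and comes out
behind it. -/
theorem interlace_outer (h : F.Slidable f) (α β₁ β₂ β₃ γ : List F.Idx) (a : F.Idx) :
    F.interlace f (α ++ [a]) β₁ β₂ β₃ γ =
      sgn (a.1 * (F.parity β₁ + F.parity β₂)) * F.interlace f α β₁ β₂ (a :: β₃) γ := by
  simp only [interlace, Finset.mul_sum]
  refine Finset.sum_congr rfl fun k _ => Finset.sum_congr rfl fun l _ => ?_
  by_cases hk : F.invGram k l = 0
  · simp [hk]
  · simp only [h.outer, parity_append, parity_cons, F.invGram_parity hk, mul_add, sgn_add,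
      List.cons_append]
    rw [mul_comm a.1 l.1]
    ring

theorem interlace_third (h : F.Slidable f) (α β₁ β₂ β₃ γ : List F.Idx) (a : F.Idx) :
    F.interlace f α β₁ β₂ (β₃ ++ [a]) γ =
      sgn (a.1 * (F.parity β₂ + F.parity β₃)) * F.interlace f α β₁ (a :: β₂) β₃ γ := by
  simp only [interlace_eq, Finset.mul_sum]
  refine Finset.sum_congr rfl fun i _ => Finset.sum_congr rfl fun j _ => ?_
  have h1 : β₂ ++ j :: (β₃ ++ [a]) = (β₂ ++ j :: β₃) ++ [a] := by simp
  rw [List.cons_append, h.inner, h1]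
  simp only [parity_append, parity_cons, mul_add, sgn_add]
  rw [mul_comm a.1 j.1]
  linear_combination -(F.invGram i j * sgn (j.1 * F.parity β₁) * sgn (j.1 * F.parity β₂) *
    F.strip f (α ++ i :: β₁) ((β₂ ++ j :: β₃) ++ [a]) γ) *
      (sgn_mul_self (a.1 * F.parity β₂) * sgn (a.1 * F.parity β₃) * sgn (a.1 * F.parity β₃) *
        sgn (j.1 * a.1) * sgn (j.1 * a.1) + sgn_mul_self (a.1 * F.parity β₃) *
        sgn (j.1 * a.1) * sgn (j.1 * a.1) + sgn_mul_self (j.1 * a.1))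

theorem interlace_second (h : F.Slidable f) (α β₁ β₂ β₃ γ : List F.Idx) (a : F.Idx) :
    F.interlace f α β₁ (β₂ ++ [a]) β₃ γ =
      sgn (a.1 * (F.parity β₁ + F.parity β₂)) * F.interlace f α (a :: β₁) β₂ β₃ γ := by
  simp only [interlace, Finset.mul_sum]
  refine Finset.sum_congr rfl fun k _ => Finset.sum_congr rfl fun l _ => ?_
  by_cases hk : F.invGram k l = 0
  · simp [hk]
  have h1 : β₁ ++ k :: (β₂ ++ [a]) = (β₁ ++ k :: β₂) ++ [a] := by simp
  rw [List.cons_append, h.inner, h1]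
  simp only [parity_append, parity_cons, mul_add, sgn_add, F.invGram_parity hk, parity_nil,
    add_zero]
  rw [mul_comm a.1 l.1]
  linear_combination -(F.invGram k l * sgn (l.1 * F.parity β₂) * sgn (l.1 * F.parity β₃) *
    F.strip f α ((β₁ ++ k :: β₂) ++ [a]) (β₃ ++ l :: γ)) * sgn (l.1 * a.1) *
      (sgn_mul_self (a.1 * F.parity β₁) * sgn (a.1 * F.parity β₂) * sgn (a.1 * F.parity β₂) +
        sgn_mul_self (a.1 * F.parity β₂))

theorem interlace_first (h : F.Slidable f) (α β₁ β₂ β₃ γ : List F.Idx) (a : F.Idx) :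
    F.interlace f α (β₁ ++ [a]) β₂ β₃ γ =
      sgn (a.1 * (F.parity β₂ + F.parity β₃)) * F.interlace f α β₁ β₂ β₃ (a :: γ) := by
  simp only [interlace_eq, Finset.mul_sum]
  refine Finset.sum_congr rfl fun i _ => Finset.sum_congr rfl fun j _ => ?_
  have h1 : α ++ i :: (β₁ ++ [a]) = (α ++ i :: β₁) ++ [a] := by simp
  rw [h1, h.outer]
  simp only [parity_append, parity_cons, mul_add, sgn_add, parity_nil, add_zero]
  rw [mul_comm a.1 j.1]
  linear_combination (F.invGram i j * sgn (j.1 * F.parity β₁) * sgn (j.1 * F.parity β₂) *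
    sgn (a.1 * F.parity β₂) * sgn (a.1 * F.parity β₃) *
    F.strip f (α ++ i :: β₁) (β₂ ++ j :: β₃) (a :: γ)) * sgn_mul_self (j.1 * a.1)

/-- The two interlaced strips of a handle can be passed by a letter. -/
theorem handle_comm (h : F.Slidable f) (α γ : List F.Idx) (a : F.Idx) :
    F.interlace f (α ++ [a]) [] [] [] γ = F.interlace f α [] [] [] (a :: γ) := by
  have h3 := h.interlace_third α [] [] [] γ a
  have h2 := h.interlace_second α [] [] [] γ a
  have h1 := h.interlace_first α [] [] [] γ a
  simp only [parity_nil, List.nil_append, add_zero, mul_zero, sgn_zero, one_mul] at h1 h2 h3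
  rw [h.interlace_outer, h3, h2, h1]
  simp [parity_nil, sgn_zero]

theorem handle_comm_append (h : F.Slidable f) (α δ γ : List F.Idx) :
    F.interlace f (α ++ δ) [] [] [] γ = F.interlace f α [] [] [] (δ ++ γ) := by
  induction δ generalizing α with
  | nil => simp
  | cons a δ ih =>
    rw [List.append_cons, ih, h.handle_comm, List.cons_append]

/-- The word between the last two ends of a handle can be moved out of the handle. -/
theorem interlace_third_eq (h : F.Slidable f) (α β γ : List F.Idx) :
    F.interlace f α [] [] β γ = F.interlace f α [] [] [] (β ++ γ) := by
  induction β using List.reverseRecOn generalizing γ with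
  | nil => simp
  | append_singleton β a ih =>
    have h2 := h.interlace_second α [] [] β γ a
    have h1 := h.interlace_first α [] [] β γ a
    simp only [parity_nil, List.nil_append, add_zero, zero_add, mul_zero, sgn_zero, one_mul]
      at h1 h2
    rw [h.interlace_third, h2, h1, ih, parity_nil, zero_add, ← mul_assoc, sgn_mul_self, one_mul]
    simp

/-- The block appended on the right does not interfere with strips further left. Since `surfaceAux`
only ever appends on the right, slidability passes from the disk to all surfaces; `handle_right`
does the same for handles. -/
theorem strip_right (h : F.Slidable f) (w : List F.Idx) :
    F.Slidable fun u => F.strip f u w [] := by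
  have : ∀ u, F.strip f u w [] = ∑ i, (1 : ℝ) * ∑ j, (F.invGram i j * sgn (j.1 * F.parity w)) *
      f (u ++ (i :: (w ++ j :: []))) := fun u => by simp only [strip, one_mul]
  simp only [this]
  exact Slidable.sum _ _ fun i => Slidable.sum _ _ fun j => h.append _

theorem handle_right (h : F.Slidable f) :
    F.Slidable fun u => F.interlace f u [] [] [] [] := by
  have : ∀ u, F.interlace f u [] [] [] [] = ∑ k, (1 : ℝ) * ∑ l, F.invGram k l *
      ∑ i, (1 : ℝ) * ∑ j, (F.invGram i j * sgn (j.1 * F.parity [k])) *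
      f (u ++ [i, k, j, l]) := fun u => by
    simp [interlace, strip, one_mul, parity_nil, sgn_zero]
  simp only [this]
  exact Slidable.sum _ _ fun i => Slidable.sum _ _ fun j => Slidable.sum _ _ fun i =>
    Slidable.sum _ _ fun j => h.append _

end Slidable

/-! ## The tensors of surfaces -/

theorem surfaceAux_nil (u : List F.Idx) : F.surfaceAux u [] 0 = F.diskWord u := by
  simp only [surfaceAux, diskWord]

theorem surfaceAux_cons (u w : List F.Idx) (ws : List (List F.Idx)) (g : ℕ) :
    F.surfaceAux u (w :: ws) g = F.strip (fun x => F.surfaceAux x ws g) u w [] := by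
  simp only [surfaceAux, strip, invGram, List.append_assoc, List.cons_append, List.nil_append]

theorem surfaceAux_succ (u : List F.Idx) (g : ℕ) :
    F.surfaceAux u [] (g + 1) = F.interlace (fun x => F.surfaceAux x [] g) u [] [] [] [] := by
  rw [interlace_eq]
  simp only [surfaceAux, strip, List.append_assoc, List.cons_append, List.nil_append, parity_nil,
    parity_cons, add_zero, mul_zero, sgn_zero, Finset.mul_sum]
  refine Finset.sum_congr rfl fun i _ => Finset.sum_congr rfl fun j _ => Finset.sum_congr rfl
    fun k _ => Finset.sum_congr rfl fun l _ => ?_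
  -- The definition of `surfaceAux` has `sgn (j * k)` where `interlace_eq` gives `sgn (l * j)`; the
  -- two ends `k`, `l` of a strip have equal parity.
  by_cases h : F.invGram k l = 0
  · have h' : F.coef F.invForm k l = 0 := h
    simp [h, h']
  · rw [F.invGram_parity h, mul_comm l.1]
    simp only [invGram]; ring

section Linear

variable [IsScalarTower ℝ A A] [SMulCommClass ℝ A A]

theorem slidable_surfaceAux (ws : List (List F.Idx)) (g : ℕ) :
    F.Slidable fun u => F.surfaceAux u ws g := by
  induction ws with
  | nil =>
    induction g with
    | zero => simpa only [surfaceAux_nil] using F.slidable_diskWord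
    | succ g ih => simpa only [surfaceAux_succ] using ih.handle_right
  | cons w ws ih => simpa only [surfaceAux_cons] using ih.strip_right w

/-- Each strip inserts two letters of equal parity, so evenness of the disk tensor is inherited. -/
theorem surfaceAux_parity {u : List F.Idx} {ws : List (List F.Idx)} {g : ℕ}
    (h : F.surfaceAux u ws g ≠ 0) : F.parity u + F.parity ws.flatten = 0 := by
  induction ws generalizing u with
  | nil =>
    simp only [List.flatten_nil, parity_nil, add_zero]
    induction g generalizing u with
    | zero => rw [surfaceAux_nil] at h; exact F.diskWord_parity h
    | succ g ih =>
      rw [surfaceAux_succ, interlace_eq] at h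
      obtain ⟨i, -, h⟩ := Finset.exists_ne_zero_of_sum_ne_zero h
      obtain ⟨j, -, h⟩ := Finset.exists_ne_zero_of_sum_ne_zero h
      have h1 := F.invGram_parity (left_ne_zero_of_mul (left_ne_zero_of_mul h))
      obtain ⟨k, -, h⟩ := Finset.exists_ne_zero_of_sum_ne_zero (right_ne_zero_of_mul h)
      obtain ⟨l, -, h⟩ := Finset.exists_ne_zero_of_sum_ne_zero h
      have h2 := F.invGram_parity (left_ne_zero_of_mul (left_ne_zero_of_mul h))
      have h3 := ih (right_ne_zero_of_mul h)
      simp only [parity_append, parity_cons, parity_nil, h1, h2] at h3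
      have key : ∀ p q r : ZMod 2, p + (q + 0) + (r + (0 + (q + 0) + (r + 0))) = 0 → p = 0 := by
        decide
      exact key _ _ _ h3
  | cons w ws ih =>
    rw [surfaceAux_cons] at h
    obtain ⟨i, -, h⟩ := Finset.exists_ne_zero_of_sum_ne_zero h
    obtain ⟨j, -, h⟩ := Finset.exists_ne_zero_of_sum_ne_zero h
    have h1 := F.invGram_parity (left_ne_zero_of_mul (left_ne_zero_of_mul h))
    have h3 := ih (right_ne_zero_of_mul h)
    simp only [parity_append, parity_cons, parity_nil, h1, List.flatten_cons] at h3 ⊢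
    have key : ∀ p q r s : ZMod 2, p + (q + (r + (q + 0))) + s = 0 → p + (r + s) = 0 := by decide
    exact key _ _ _ _ h3

theorem surface_parity {ws : List (List F.Idx)} {g : ℕ} (h : F.surface g ws ≠ 0) :
    F.parity ws.flatten = 0 := by
  cases ws with
  | nil => exact absurd rfl h
  | cons u ws => rw [List.flatten_cons, parity_append]; exact F.surfaceAux_parity h

/-- Adding a handle in the first place. -/
theorem surfaceAux_handle (u : List F.Idx) (ws : List (List F.Idx)) (g : ℕ) :
    F.surfaceAux u ws (g + 1) =
      F.interlace (fun x => F.surfaceAux x ws g) u [] [] [] [] := by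
  induction ws generalizing u with
  | nil => exact F.surfaceAux_succ u g
  | cons w ws ih =>
    simp only [surfaceAux_cons, ih]
    have h1 : ∀ u, F.strip (fun x => F.surfaceAux x ws g) u w [] =
        ∑ i, (1 : ℝ) * ∑ j, (F.invGram i j * sgn (j.1 * F.parity w)) *
          F.surfaceAux (u ++ (i :: (w ++ j :: []))) ws g := fun u => by simp only [strip, one_mul]
    simp only [h1, interlace_sum, F.interlace_append (fun x => F.surfaceAux x ws g)]
    -- The block `i w j` cut off by the circle `w` passes the new handle without sign.
    simp only [strip, (F.slidable_surfaceAux ws g).handle_comm_append, one_mul, List.nil_append,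
      List.append_nil]

/-- The block `i w₁ j` has the parity of `w₁` and slides as a whole along the outer side of the
strip around `w₂`. -/
theorem surfaceAux_swap (u w₁ w₂ : List F.Idx) (ws : List (List F.Idx)) (g : ℕ) :
    F.surfaceAux u (w₁ :: w₂ :: ws) g =
      sgn (F.parity w₁ * F.parity w₂) * F.surfaceAux u (w₂ :: w₁ :: ws) g := by
  have hs := F.slidable_surfaceAux ws g
  simp only [surfaceAux_cons]
  trans ∑ i, ∑ j, F.invGram i j * sgn (j.1 * F.parity w₁) *
      (sgn (F.parity w₁ * F.parity w₂) *
        F.strip (fun x => F.surfaceAux x ws g) u w₂ (i :: (w₁ ++ j :: [])))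
  · rw [strip]
    refine Finset.sum_congr rfl fun i _ => Finset.sum_congr rfl fun j _ => ?_
    by_cases h : F.invGram i j = 0
    · simp [h]
    rw [hs.outer_append]
    simp only [parity_cons, parity_append, parity_nil, add_zero, F.invGram_parity h, add_mul,
      sgn_add, List.append_nil]
    linear_combination F.invGram i j * sgn (j.1 * F.parity w₁) *
      sgn (F.parity w₁ * F.parity w₂) *
      F.strip (fun x => F.surfaceAux x ws g) u w₂ (i :: (w₁ ++ j :: [])) *
      sgn_mul_self (j.1 * F.parity w₂)
  · simp only [strip, Finset.mul_sum]
    refine (sum_exchange _).trans ?_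
    refine Finset.sum_congr rfl fun i _ => Finset.sum_congr rfl fun j _ => Finset.sum_congr rfl
      fun k _ => Finset.sum_congr rfl fun l _ => ?_
    simp only [List.append_assoc, List.cons_append, List.nil_append]
    ring

/-- The letter slides past the handles and strips appended behind `u`, and the disk underneath is
cyclic. -/
theorem surfaceAux_cyclic (u : List F.Idx) (a : F.Idx) (ws : List (List F.Idx)) (g : ℕ) :
    F.surfaceAux (a :: u) ws g =
      sgn (a.1 * F.parity u) * F.surfaceAux (u ++ [a]) ws g := by
  induction ws generalizing u with
  | nil =>
    induction g generalizing u with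
    | zero => rw [surfaceAux_nil, surfaceAux_nil, diskWord_cyclic]
    | succ g ih =>
      rw [surfaceAux_succ, surfaceAux_succ, (F.slidable_surfaceAux [] g).handle_comm]
      simp only [interlace, strip, List.cons_append, ih, Finset.mul_sum]
      refine Finset.sum_congr rfl fun i _ => Finset.sum_congr rfl fun j _ => Finset.sum_congr rfl
        fun k _ => Finset.sum_congr rfl fun l _ => ?_
      by_cases h : F.invGram i j = 0
      · simp [h]
      by_cases h' : F.invGram k l = 0
      · simp [h']
      simp only [parity_append, parity_cons, parity_nil, F.invGram_parity h, F.invGram_parity h',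
        List.append_assoc, List.cons_append, List.nil_append, mul_add, sgn_add, add_zero,
        mul_zero, sgn_zero, mul_one]
      linear_combination F.invGram i j * F.invGram k l * sgn (l.1 * j.1) *
        sgn (a.1 * F.parity u) * F.surfaceAux (u ++ [k, i, l, j, a]) [] g *
        (sgn_mul_self (a.1 * j.1) * sgn (a.1 * l.1) * sgn (a.1 * l.1) +
          sgn_mul_self (a.1 * l.1))
  | cons w ws ih =>
    rw [surfaceAux_cons, surfaceAux_cons, (F.slidable_surfaceAux ws g).outer]
    simp only [strip, List.cons_append, ih, Finset.mul_sum]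
    refine Finset.sum_congr rfl fun i _ => Finset.sum_congr rfl fun j _ => ?_
    by_cases h : F.invGram i j = 0
    · simp [h]
    simp only [parity_append, parity_cons, parity_nil, F.invGram_parity h,
      List.append_assoc, List.cons_append, List.nil_append, mul_add, sgn_add, add_zero]
    linear_combination F.invGram i j * sgn (j.1 * F.parity w) * sgn (a.1 * F.parity w) *
      sgn (a.1 * F.parity u) * F.surfaceAux (u ++ i :: (w ++ [j, a])) ws g *
      sgn_mul_self (a.1 * j.1)

theorem surfaceAux_cyclic_append (u v : List F.Idx) (ws : List (List F.Idx)) (g : ℕ) :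
    F.surfaceAux (u ++ v) ws g =
      sgn (F.parity u * F.parity v) * F.surfaceAux (v ++ u) ws g := by
  induction u generalizing v with
  | nil => simp [parity_nil, sgn_zero]
  | cons a u ih =>
    rw [List.cons_append, surfaceAux_cyclic, List.append_assoc, ih]
    simp only [parity_append, parity_cons, parity_nil, add_zero, mul_add, add_mul, sgn_add,
      List.append_assoc, List.cons_append, List.nil_append]
    rw [mul_comm a.1 (F.parity u)]
    linear_combination sgn (a.1 * F.parity v) * sgn (F.parity u * F.parity v) *
      F.surfaceAux (v ++ a :: u) ws g * sgn_mul_self (F.parity u * a.1)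

/-- The first boundary circle can be exchanged with another one. -/
theorem surfaceAux_exchange (u w : List F.Idx) (ws : List (List F.Idx)) (g : ℕ) :
    F.surfaceAux u (w :: ws) g =
      sgn (F.parity u * F.parity w) * F.surfaceAux w (u :: ws) g := by
  rw [surfaceAux_cons, surfaceAux_cons, strip, strip, Finset.mul_sum, Finset.sum_comm]
  refine Finset.sum_congr rfl fun j _ => ?_
  rw [Finset.mul_sum]
  refine Finset.sum_congr rfl fun i _ => ?_
  -- On the disk, `u i w j` rotates to `w j u i`, in which the strip surrounds `u` instead of `w`;
  -- graded symmetry of the inverse inner product exchanges its ends.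
  have h1 : u ++ i :: (w ++ [j]) = (u ++ [i]) ++ (w ++ [j]) := by simp
  have h2 : w ++ j :: (u ++ [i]) = (w ++ [j]) ++ (u ++ [i]) := by simp
  rw [h1, h2, surfaceAux_cyclic_append, F.invGram_symm i j]
  by_cases h : F.invGram j i = 0
  · simp [h]
  simp only [parity_append, parity_cons, parity_nil, F.invGram_parity h, add_zero, mul_add,
    add_mul, sgn_add, parity_mul_self]
  rw [mul_comm (F.parity u) i.1]
  linear_combination F.invGram j i * sgn (F.parity u * F.parity w) * sgn (i.1 * F.parity u) *
    F.surfaceAux ((w ++ [j]) ++ (u ++ [i])) ws g *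
    (sgn_mul_self (i.1 * F.parity w) * sgn i.1 * sgn i.1 + sgn_mul_self i.1)

/-! ## Gluing surfaces -/

/-- Gluing a strip to two different boundary circles of a surface. -/
theorem sum_surface_glue_circles (u v : List F.Idx) (ws : List (List F.Idx)) (g : ℕ) :
    ∑ i, ∑ j, F.invGram i j * F.surface g ((u ++ [i]) :: (j :: v) :: ws) =
      F.surface (g + 1) ((u ++ v) :: ws) := by
  have hs := F.slidable_surfaceAux ws g
  simp only [surface]
  have := hs.handle_comm_append u v []
  -- With `v` moved between the last two ends of the handle, one strip of the handle is the glued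
  -- one and the other surrounds `j v`, that is, cuts off the second circle.
  rw [surfaceAux_handle, this, ← hs.interlace_third_eq, interlace_eq]
  refine Finset.sum_congr rfl fun i _ => Finset.sum_congr rfl fun j _ => ?_
  rw [surfaceAux_cons]
  simp [parity_nil, sgn_zero]

/-- A strip is a linear combination of insertions of nonempty blocks with the parity of `w`. Nothing
else about the block matters in the gluing inductions, where circles (and, by `exists_handle_eq`,
handles) are replaced by blocks. -/
theorem exists_strip_eq (w : List F.Idx) :
    ∃ (c : F.Idx × F.Idx → ℝ) (δ : F.Idx × F.Idx → List F.Idx),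
      (∀ κ, c κ ≠ 0 → F.parity (δ κ) = F.parity w) ∧ (∀ κ, δ κ ≠ []) ∧
      ∀ f α γ, F.strip f α w γ = ∑ κ, c κ * f (α ++ (δ κ ++ γ)) := by
  refine ⟨fun κ => F.invGram κ.1 κ.2 * sgn (κ.2.1 * F.parity w),
    fun κ => κ.1 :: (w ++ [κ.2]), fun κ h => ?_, fun κ => by simp, fun f α γ => ?_⟩
  · rw [parity_cons, parity_append, parity_cons, F.invGram_parity (left_ne_zero_of_mul h),
      parity_nil]
    have key : ∀ p q : ZMod 2, p + (q + (p + 0)) = q := by decide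
    exact key _ _
  · simp [strip, Fintype.sum_prod_type]

theorem exists_handle_eq :
    ∃ (c : (F.Idx × F.Idx) × F.Idx × F.Idx → ℝ)
      (δ : (F.Idx × F.Idx) × F.Idx × F.Idx → List F.Idx),
      (∀ κ, c κ ≠ 0 → F.parity (δ κ) = 0) ∧ (∀ κ, δ κ ≠ []) ∧
      ∀ f α γ, F.interlace f α [] [] [] γ = ∑ κ, c κ * f (α ++ (δ κ ++ γ)) := by
  refine ⟨fun κ => F.invGram κ.1.1 κ.1.2 * (F.invGram κ.2.1 κ.2.2 * sgn (κ.2.2.1 * κ.1.1.1)),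
    fun κ => [κ.2.1, κ.1.1, κ.2.2, κ.1.2], fun κ h => ?_, fun κ => by simp, fun f α γ => ?_⟩
  · simp only [parity_cons, parity_nil, F.invGram_parity (left_ne_zero_of_mul h),
      F.invGram_parity (left_ne_zero_of_mul (right_ne_zero_of_mul h))]
    have key : ∀ p q : ZMod 2, p + (q + (p + (q + 0))) = 0 := by decide
    exact key _ _
  · simp [interlace, strip, Fintype.sum_prod_type, parity_nil, parity_cons, sgn_zero,
      Finset.mul_sum, mul_assoc]

/-- Circles and handles of the first surface are turned into blocks inserted before the glued
letter, which reduces the claim to two disks. The hypotheses exclude a disk whose only letter is the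
glued one, where the default value 0 breaks the law. -/
theorem sum_surfaceAux_mul_diskWord {α β : List F.Idx} {ws : List (List F.Idx)} {g : ℕ}
    (hα : α ≠ [] ∨ ws ≠ [] ∨ g ≠ 0) (hβ : β ≠ []) :
    ∑ i, ∑ j, F.invGram i j * (sgn (j.1 * F.parity ws.flatten) *
        F.surfaceAux (α ++ [i]) ws g * F.diskWord (j :: β)) =
      sgn (F.parity β * F.parity ws.flatten) * F.surfaceAux (α ++ β) ws g := by
  induction ws generalizing α with
  | nil =>
    simp only [List.flatten_nil, parity_nil, mul_zero, sgn_zero, one_mul]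
    induction g generalizing α with
    | zero =>
      simp only [surfaceAux_nil]
      exact F.sum_diskWord_mul_diskWord (by simpa using hα) hβ
    | succ g ih =>
      have hs := F.slidable_surfaceAux [] g
      obtain ⟨c, δ, -, hδ, H⟩ := F.exists_handle_eq
      simp only [surfaceAux_succ, hs.handle_comm_append, List.append_nil, H, Finset.sum_mul,
        Finset.mul_sum]
      rw [← sum_rotate]
      refine Finset.sum_congr rfl fun κ _ => ?_
      rw [← List.append_assoc, ← ih (α := α ++ δ κ) (by simp [hδ]), Finset.mul_sum]
      refine Finset.sum_congr rfl fun i _ => ?_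
      rw [Finset.mul_sum]
      refine Finset.sum_congr rfl fun j _ => ?_
      rw [List.append_assoc]; ring
  | cons w ws ih =>
    have hs := F.slidable_surfaceAux ws g
    obtain ⟨c, δ, -, hδ, H⟩ := F.exists_strip_eq w
    simp only [surfaceAux_cons, hs.outer_append, List.append_nil, H, Finset.sum_mul,
      Finset.mul_sum]
    rw [← sum_rotate]
    refine Finset.sum_congr rfl fun κ _ => ?_
    trans c κ * (sgn (F.parity β * F.parity ws.flatten) *
      F.surfaceAux ((α ++ δ κ) ++ β) ws g)
    · rw [← ih (α := α ++ δ κ) (by simp [hδ]), Finset.mul_sum]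
      refine Finset.sum_congr rfl fun i _ => ?_
      rw [Finset.mul_sum]
      refine Finset.sum_congr rfl fun j _ => ?_
      by_cases h : F.invGram i j = 0
      · simp [h]
      simp only [List.flatten_cons, parity_append, parity_cons, parity_nil, add_zero, mul_add,
        sgn_add, F.invGram_parity h, List.append_assoc]
      linear_combination F.invGram i j * sgn (j.1 * F.parity ws.flatten) * c κ *
        F.surfaceAux (α ++ (δ κ ++ [i])) ws g * F.diskWord (j :: β) *
        sgn_mul_self (j.1 * F.parity w)
    · rw [List.flatten_cons, parity_append, mul_add, sgn_add, List.append_assoc]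
      linear_combination -(c κ * sgn (F.parity β * F.parity ws.flatten) *
        F.surfaceAux (α ++ (δ κ ++ β)) ws g) * sgn_mul_self (F.parity β * F.parity w)

/-- Gluing two surfaces by a strip. -/
theorem sum_surface_mul_surface {α β : List F.Idx} {ws₁ ws₂ : List (List F.Idx)} {g₁ g₂ : ℕ}
    (hα : α ≠ [] ∨ ws₁ ≠ [] ∨ g₁ ≠ 0) (hβ : β ≠ [] ∨ ws₂ ≠ [] ∨ g₂ ≠ 0) :
    ∑ i, ∑ j, F.invGram i j * (sgn (j.1 * F.parity ws₁.flatten) *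
        F.surface g₁ ((α ++ [i]) :: ws₁) * F.surface g₂ ((j :: β) :: ws₂)) =
      sgn ((F.parity β + F.parity ws₂.flatten) * F.parity ws₁.flatten) *
        F.surface (g₁ + g₂) ((α ++ β) :: (ws₂ ++ ws₁)) := by
  simp only [surface]
  -- Now the circles and handles of the second surface become blocks at the end of `β`, until it is
  -- a disk.
  induction ws₂ generalizing β with
  | nil =>
    simp only [List.flatten_nil, parity_nil, add_zero, List.nil_append]
    induction g₂ generalizing β with
    | zero =>
      simp only [surfaceAux_nil, add_zero]
      exact F.sum_surfaceAux_mul_diskWord hα (by simpa using hβ)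
    | succ g ih =>
      obtain ⟨c, δ, hp, hδ, H⟩ := F.exists_handle_eq
      rw [← add_assoc]
      simp only [surfaceAux_handle, List.append_nil, H, Finset.mul_sum]
      rw [← sum_rotate]
      refine Finset.sum_congr rfl fun κ _ => ?_
      by_cases hc : c κ = 0
      · simp [hc]
      trans c κ * (sgn (F.parity (β ++ δ κ) * F.parity ws₁.flatten) *
        F.surfaceAux (α ++ (β ++ δ κ)) ws₁ (g₁ + g))
      · rw [← ih (β := β ++ δ κ) (by simp [hδ]), Finset.mul_sum]
        refine Finset.sum_congr rfl fun i _ => ?_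
        rw [Finset.mul_sum]
        exact Finset.sum_congr rfl fun j _ => by rw [List.cons_append]; ring
      · rw [parity_append, hp κ hc, add_zero, List.append_assoc]; ring
  | cons w ws ih =>
    obtain ⟨c, δ, hp, hδ, H⟩ := F.exists_strip_eq w
    simp only [surfaceAux_cons, List.cons_append, H, Finset.mul_sum, List.append_nil]
    rw [← sum_rotate]
    refine Finset.sum_congr rfl fun κ _ => ?_
    by_cases hc : c κ = 0
    · simp [hc]
    trans c κ * (sgn ((F.parity (β ++ δ κ) + F.parity ws.flatten) * F.parity ws₁.flatten) *
      F.surfaceAux (α ++ (β ++ δ κ)) (ws ++ ws₁) (g₁ + g₂))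
    · rw [← ih (β := β ++ δ κ) (by simp [hδ]), Finset.mul_sum]
      refine Finset.sum_congr rfl fun i _ => ?_
      rw [Finset.mul_sum]
      exact Finset.sum_congr rfl fun j _ => by ring
    · rw [parity_append, hp κ hc, List.append_assoc, List.flatten_cons, parity_append,
        add_assoc]; ring

end Linear

end DGFrobenius

namespace DGFrobenius

variable {A : Type*} [NonUnitalRing A] [Module ℝ A] [FiniteDimensional ℝ A] (F : DGFrobenius A)

/-! ## The action of the differential on functions of words -/

/-- The sum over the letters of a word of the values after applying the differential to the letter,
with Koszul signs. -/
noncomputable def deriv : (List F.Idx → ℝ) → List F.Idx → ℝ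
  | _, [] => 0
  | f, a :: w => ∑ c, F.dCoef c a * f (c :: w) + sgn a.1 * deriv (fun x => f (a :: x)) w

theorem deriv_append (f : List F.Idx → ℝ) (u v : List F.Idx) :
    F.deriv f (u ++ v) = F.deriv (fun x => f (x ++ v)) u +
      sgn (F.parity u) * F.deriv (fun x => f (u ++ x)) v := by
  induction u generalizing f with
  | nil => simp [deriv, parity_nil, sgn_zero]
  | cons a u ih =>
    simp only [List.cons_append, deriv, ih, parity_cons, sgn_add]
    ring

theorem deriv_sum {κ : Type*} (s : Finset κ) (c : κ → ℝ) (f : κ → List F.Idx → ℝ)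
    (w : List F.Idx) :
    F.deriv (fun x => ∑ k ∈ s, c k * f k x) w = ∑ k ∈ s, c k * F.deriv (f k) w := by
  induction w generalizing f with
  | nil => simp [deriv]
  | cons a w ih =>
    simp only [deriv, ih, mul_add, Finset.sum_add_distrib, Finset.mul_sum]
    congr 1
    · rw [Finset.sum_comm]
      exact Finset.sum_congr rfl fun k _ => Finset.sum_congr rfl fun c _ => by ring
    · exact Finset.sum_congr rfl fun k _ => by ring

theorem deriv_sum_sum (c : F.Idx → F.Idx → ℝ) (f : F.Idx → F.Idx → List F.Idx → ℝ)
    (w : List F.Idx) :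
    F.deriv (fun x => ∑ i, ∑ j, c i j * f i j x) w = ∑ i, ∑ j, c i j * F.deriv (f i j) w := by
  have := F.deriv_sum Finset.univ (fun κ : F.Idx × F.Idx => c κ.1 κ.2) (fun κ => f κ.1 κ.2) w
  simpa only [Fintype.sum_prod_type] using this

theorem deriv_const_mul (c : ℝ) (f : List F.Idx → ℝ) (w : List F.Idx) :
    F.deriv (fun x => c * f x) w = c * F.deriv f w := by
  simpa using F.deriv_sum {()} (fun _ => c) (fun _ => f) w

/-- The differential changes the parity of the word by one, whence the extra factor `sgn q`. -/
theorem deriv_sgn_mul (q : ZMod 2) (f : List F.Idx → ℝ) (w : List F.Idx) :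
    F.deriv (fun x => sgn (q * F.parity x) * f x) w =
      sgn q * sgn (q * F.parity w) * F.deriv f w := by
  induction w generalizing f with
  | nil => simp [deriv]
  | cons a w ih =>
    have h1 : ∀ x, sgn (q * F.parity (a :: x)) * f (a :: x) =
        sgn (q * a.1) * (sgn (q * F.parity x) * f (a :: x)) := by
      intro x; rw [parity_cons, mul_add, sgn_add, mul_assoc]
    simp only [deriv, h1, deriv_const_mul, ih, mul_add, Finset.mul_sum]
    congr 1
    · refine Finset.sum_congr rfl fun c _ => ?_
      by_cases h : F.dCoef c a = 0
      · simp [h]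
      · simp only [parity_cons, F.dCoef_parity h, mul_add, sgn_add, mul_one]; ring
    · simp only [parity_cons, mul_add, sgn_add]; ring

/-- The differential vanishes on the inverse inner product. -/
theorem sum_invGram_dCoef (X : F.Idx → F.Idx → ℝ) :
    ∑ i, ∑ j, F.invGram i j * (∑ c, F.dCoef c i * X c j + sgn i.1 * ∑ c, F.dCoef c j * X i c) =
      0 := by
  trans ∑ c, ∑ j, (∑ i, F.dCoef c i * F.invGram i j + sgn c.1 * ∑ i, F.dCoef j i * F.invGram c i) *
    X c j
  · simp only [mul_add, Finset.sum_add_distrib, add_mul, Finset.mul_sum, Finset.sum_mul]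
    congr 1
    · rw [← sum_rotate, Finset.sum_comm]
      refine (sum_rotate _ _).trans ?_
      exact Finset.sum_congr rfl fun i _ => Finset.sum_congr rfl fun j _ =>
        Finset.sum_congr rfl fun k _ => by ring
    · refine Finset.sum_congr rfl fun c _ => ?_
      rw [Finset.sum_comm]
      exact Finset.sum_congr rfl fun j _ => Finset.sum_congr rfl fun i _ => by ring
  · simp [sum_dCoef_invGram]

/-- The differential of a strip acts on the words along its sides. -/
theorem sum_deriv_eq (f : List F.Idx → ℝ) (u w : List F.Idx) :
    ∑ i, ∑ j, F.invGram i j * sgn (j.1 * F.parity w) * F.deriv f (u ++ i :: (w ++ [j])) =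
      F.deriv (fun x => F.strip f x w []) u +
        sgn (F.parity u) * F.deriv (fun x => F.strip f u x []) w := by
  have h1 : F.deriv (fun x => F.strip f x w []) u = ∑ i, ∑ j,
      F.invGram i j * sgn (j.1 * F.parity w) * F.deriv (fun x => f (x ++ i :: (w ++ [j]))) u := by
    simp only [strip, deriv_sum_sum]
  have h2 : F.deriv (fun x => F.strip f u x []) w = ∑ i, ∑ j,
      F.invGram i j * sgn (j.1 * F.parity w) *
        (sgn i.1 * F.deriv (fun x => f (u ++ i :: (x ++ [j]))) w) := by
    simp only [strip, mul_assoc]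
    refine (F.deriv_sum_sum (fun i j => F.invGram i j)
      (fun i j x => sgn (j.1 * F.parity x) * f (u ++ i :: (x ++ [j]))) w).trans ?_
    simp only [deriv_sgn_mul]
    refine Finset.sum_congr rfl fun i _ => Finset.sum_congr rfl fun j _ => ?_
    by_cases h : F.invGram i j = 0
    · simp [h]
    · rw [F.invGram_parity h]; ring
  -- The terms where the differential hits the two ends of the strip cancel because the inverse
  -- inner product is closed.
  have h3 : ∑ i, ∑ j, F.invGram i j * sgn (j.1 * F.parity w) *
      (∑ c, F.dCoef c i * f (u ++ c :: (w ++ [j])) + sgn i.1 * (sgn (F.parity w) *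
        ∑ c, F.dCoef c j * f (u ++ i :: (w ++ [c])))) = 0 := by
    refine Eq.trans (Finset.sum_congr rfl fun i _ => Finset.sum_congr rfl fun j _ => ?_)
      (F.sum_invGram_dCoef fun c j => sgn (j.1 * F.parity w) * f (u ++ c :: (w ++ [j])))
    simp only [mul_add, Finset.mul_sum]
    congr 1
    · exact Finset.sum_congr rfl fun c _ => by ring
    · refine Finset.sum_congr rfl fun c _ => ?_
      by_cases h : F.dCoef c j = 0
      · simp [h]
      · rw [F.dCoef_parity h, add_mul, sgn_add, one_mul]; ring
  rw [h1, h2, Finset.mul_sum, ← Finset.sum_add_distrib, ← sub_eq_zero, ← Finset.sum_sub_distrib]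
  have h3' := congrArg (fun r => sgn (F.parity u) * r) h3
  simp only [mul_zero, Finset.mul_sum] at h3'
  refine Eq.trans (Finset.sum_congr rfl fun i _ => ?_) h3'
  rw [Finset.mul_sum, ← Finset.sum_add_distrib, ← Finset.sum_sub_distrib]
  refine Finset.sum_congr rfl fun j _ => ?_
  rw [deriv_append]
  simp only [deriv, deriv_append, mul_zero, add_zero]
  simp only [mul_add, Finset.mul_sum]
  ring_nf

section Linear

variable [IsScalarTower ℝ A A] [SMulCommClass ℝ A A]

/-- The first two letters are merged; by the Leibniz rule the differential of the product is the sum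
of the terms on the two letters. For two letters the claim is the compatibility of `d` with the
inner product, and for one letter it holds because the disk then has value 0. -/
theorem deriv_diskWord (w : List F.Idx) : F.deriv F.diskWord w = 0 := by
  induction hn : w.length generalizing w with
  | zero => rw [List.length_eq_zero_iff.mp hn, deriv]
  | succ n ih =>
    match w, hn with
    | [a], _ =>
      simp only [deriv, mul_zero, add_zero]
      exact Finset.sum_eq_zero fun c _ => mul_eq_zero_of_right _ rfl
    | [a, b], _ =>
      simp only [deriv, mul_zero, add_zero, diskWord_pair, gram]
      rw [← form_d_left, ← form_d_right, F.form_d _ (F.basis_mem a)]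
      ring
    | a :: b :: e :: w, hn =>
      have hm : ∀ a b x, x ≠ [] → F.diskWord (a :: b :: x) =
          ∑ c, F.mulCoef a b c * F.diskWord (c :: x) := fun a b x hx =>
        F.diskWord_merge a b [] x (by simpa using hx)
      have h0 : ∑ c, F.mulCoef a b c * F.deriv F.diskWord (c :: e :: w) = 0 :=
        Finset.sum_eq_zero fun c _ => by rw [ih _ (by simpa using hn), mul_zero]
      rw [← h0]
      have hd : F.deriv (fun x => F.diskWord (a :: b :: x)) (e :: w) =
          ∑ c, F.mulCoef a b c * F.deriv (fun x => F.diskWord (c :: x)) (e :: w) := by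
        rw [← deriv_sum]
        simp only [deriv]
        have : ∀ (x : List F.Idx) (c : F.Idx), F.diskWord (a :: b :: c :: x) =
          ∑ c', F.mulCoef a b c' * F.diskWord (c' :: c :: x) := fun x c => hm _ _ _ (by simp)
        simp only [this]
      have h1 : F.deriv F.diskWord (a :: b :: e :: w) =
          ∑ c, F.dCoef c a * F.diskWord (c :: b :: e :: w) + sgn a.1 *
          (∑ c, F.dCoef c b * F.diskWord (a :: c :: e :: w) + sgn b.1 *
            F.deriv (fun x => F.diskWord (a :: b :: x)) (e :: w)) := rfl
      have h2 : ∀ c, F.deriv F.diskWord (c :: e :: w) =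
          ∑ c', F.dCoef c' c * F.diskWord (c' :: e :: w) +
          sgn c.1 * F.deriv (fun x => F.diskWord (c :: x)) (e :: w) := fun c => rfl
      rw [h1, hd]
      simp only [h2, mul_add, Finset.sum_add_distrib]
      rw [← add_assoc]
      congr 1
      · have h3 : ∀ c, F.diskWord (c :: b :: e :: w) = _ := fun c => hm c b (e :: w) (by simp)
        have h4 : ∀ c, F.diskWord (a :: c :: e :: w) = _ := fun c => hm a c (e :: w) (by simp)
        simp only [h3, h4]
        trans ∑ k, (∑ c, F.dCoef c a * F.mulCoef c b k +
          sgn a.1 * ∑ c, F.dCoef c b * F.mulCoef a c k) * F.diskWord (k :: e :: w)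
        · simp only [add_mul, Finset.sum_add_distrib, Finset.sum_mul, Finset.mul_sum]
          congr 1
          · rw [Finset.sum_comm]
            exact Finset.sum_congr rfl fun i _ => Finset.sum_congr rfl fun j _ => by ring
          · rw [Finset.sum_comm]
            exact Finset.sum_congr rfl fun i _ => Finset.sum_congr rfl fun j _ => by ring
        · simp only [← sum_mulCoef_dCoef]
          simp only [Finset.sum_mul, Finset.mul_sum]
          rw [Finset.sum_comm]
          exact Finset.sum_congr rfl fun i _ => Finset.sum_congr rfl fun j _ => by ring
      · rw [Finset.mul_sum, Finset.mul_sum]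
        refine Finset.sum_congr rfl fun c _ => ?_
        by_cases h : F.mulCoef a b c = 0
        · simp [h]
        · rw [F.mulCoef_parity h, sgn_add]; ring

/-- The sum over the letters of a list of words of the values after applying the differential to the
letter, with Koszul signs. -/
noncomputable def derivList : (List (List F.Idx) → ℝ) → List (List F.Idx) → ℝ
  | _, [] => 0
  | f, w :: ws => F.deriv (fun x => f (x :: ws)) w +
      sgn (F.parity w) * derivList (fun x => f (w :: x)) ws

theorem derivList_sum {κ : Type*} (s : Finset κ) (c : κ → ℝ) (f : κ → List (List F.Idx) → ℝ)
    (ws : List (List F.Idx)) :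
    F.derivList (fun x => ∑ k ∈ s, c k * f k x) ws = ∑ k ∈ s, c k * F.derivList (f k) ws := by
  induction ws generalizing f with
  | nil => simp [derivList]
  | cons w ws ih =>
    simp only [derivList, deriv_sum, ih, mul_add, Finset.sum_add_distrib, Finset.mul_sum]
    congr 1
    exact Finset.sum_congr rfl fun k _ => by ring

theorem derivList_sum_sum (c : F.Idx → F.Idx → ℝ) (f : F.Idx → F.Idx → List (List F.Idx) → ℝ)
    (ws : List (List F.Idx)) :
    F.derivList (fun x => ∑ i, ∑ j, c i j * f i j x) ws =
      ∑ i, ∑ j, c i j * F.derivList (f i j) ws := by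
  have := F.derivList_sum Finset.univ (fun κ : F.Idx × F.Idx => c κ.1 κ.2)
    (fun κ => f κ.1 κ.2) ws
  simpa only [Fintype.sum_prod_type] using this

/-- The total differential of the tensor before gluing vanishes by induction, and its terms on the
ends of the glued strips cancel; what remains is the differential on the free letters. -/
theorem deriv_surfaceAux (u : List F.Idx) (ws : List (List F.Idx)) (g : ℕ) :
    F.deriv (fun x => F.surfaceAux x ws g) u +
      sgn (F.parity u) * F.derivList (fun x => F.surfaceAux u x g) ws = 0 := by
  induction ws generalizing u with
  | nil =>
    simp only [derivList, mul_zero, add_zero]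
    induction g generalizing u with
    | zero => simpa only [surfaceAux_nil] using F.deriv_diskWord u
    | succ g ih =>
      -- `X k l` is the handle with one strip glued and the ends `k`, `l` of the other still open.
      -- `key` trades the differential on `u` for that on `k` and `l`, which vanishes when
      -- contracted with the closed inverse inner product.
      let X : F.Idx → F.Idx → ℝ := fun k l =>
        F.strip (fun y => F.surfaceAux (y ++ [l]) [] g) u [k] []
      have key : ∀ k l, F.deriv
          (fun x => F.strip (fun y => F.surfaceAux (y ++ [l]) [] g) x [k] []) u =
          -sgn (F.parity u) * (∑ c, F.dCoef c k * X c l + sgn k.1 * ∑ c, F.dCoef c l * X k c) := by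
        intro k l
        have h := F.sum_deriv_eq (fun y => F.surfaceAux (y ++ [l]) [] g) u [k]
        have h2 : F.deriv (fun x => F.strip (fun y => F.surfaceAux (y ++ [l]) [] g) u x []) [k] =
            ∑ c, F.dCoef c k * X c l := by simp only [deriv, mul_zero, add_zero, X]
        have h3 : ∀ i j, F.invGram i j * sgn (j.1 * F.parity [k]) *
            F.deriv (fun y => F.surfaceAux (y ++ [l]) [] g) (u ++ i :: ([k] ++ [j])) =
            -(sgn (F.parity u) * sgn k.1) * ∑ c, F.dCoef c l *
              (F.invGram i j * sgn (j.1 * F.parity [k]) *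
                F.surfaceAux (u ++ i :: ([k] ++ [j]) ++ [c]) [] g) := by
          intro i j
          by_cases hij : F.invGram i j = 0
          · simp [hij]
          have h4 := ih (u ++ i :: ([k] ++ [j]) ++ [l])
          rw [deriv_append] at h4
          simp only [deriv, mul_zero, add_zero, parity_append, parity_cons, parity_nil, sgn_add,
            F.invGram_parity hij] at h4 ⊢
          have h5 : ∑ c, F.dCoef c l * (F.invGram i j * sgn (j.1 * k.1) *
              F.surfaceAux (u ++ i :: ([k] ++ [j]) ++ [c]) [] g) =
              F.invGram i j * sgn (j.1 * k.1) * ∑ c, F.dCoef c l *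
              F.surfaceAux (u ++ i :: ([k] ++ [j]) ++ [c]) [] g := by
            rw [Finset.mul_sum]
            exact Finset.sum_congr rfl fun c _ => by ring
          rw [h5]
          linear_combination F.invGram i j * sgn (j.1 * k.1) * h4 - F.invGram i j *
            sgn (j.1 * k.1) * sgn (F.parity u) * sgn k.1 * (∑ c, F.dCoef c l *
              F.surfaceAux (u ++ i :: ([k] ++ [j]) ++ [c]) [] g) * sgn_mul_self j.1
        have h4 : ∑ i, ∑ j, F.invGram i j * sgn (j.1 * F.parity [k]) *
            F.deriv (fun y => F.surfaceAux (y ++ [l]) [] g) (u ++ i :: ([k] ++ [j])) =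
            -(sgn (F.parity u) * sgn k.1) * ∑ c, F.dCoef c l * X k c := by
          simp only [h3, X, strip, Finset.mul_sum]
          exact (sum_rotate _ _).symm
        rw [h4, h2] at h
        linear_combination -h
      have h : ∀ x, F.surfaceAux x [] (g + 1) = ∑ k, ∑ l, F.invGram k l *
          F.strip (fun y => F.surfaceAux (y ++ [l]) [] g) x [k] [] := by
        intro x
        simp only [surfaceAux_succ, interlace, parity_nil, add_zero, mul_zero, sgn_zero, mul_one,
          List.nil_append, F.strip_append (fun x => F.surfaceAux x [] g)]
      simp only [h]
      refine (F.deriv_sum_sum (fun k l => F.invGram k l)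
        (fun k l x => F.strip (fun y => F.surfaceAux (y ++ [l]) [] g) x [k] []) u).trans ?_
      simp only [key]
      have h0 := congrArg (fun r => -sgn (F.parity u) * r) (F.sum_invGram_dCoef X)
      simp only [mul_zero, Finset.mul_sum _ _ (-sgn (F.parity u))] at h0
      refine Eq.trans (Finset.sum_congr rfl fun i _ => Finset.sum_congr rfl fun j _ => ?_) h0
      ring
  | cons w ws ih =>
    simp only [derivList, surfaceAux_cons]
    have h := F.sum_deriv_eq (fun x => F.surfaceAux x ws g) u w
    rw [mul_add, ← add_assoc, ← h]
    have h2 : F.derivList (fun y => F.strip (fun x => F.surfaceAux x y g) u w []) ws =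
        ∑ i, ∑ j, (F.invGram i j * sgn (j.1 * F.parity w)) *
          F.derivList (fun y => F.surfaceAux (u ++ i :: (w ++ [j])) y g) ws := by
      simp only [strip, derivList_sum_sum]
    rw [h2, Finset.mul_sum, Finset.mul_sum, ← Finset.sum_add_distrib]
    refine Finset.sum_eq_zero fun i _ => ?_
    rw [Finset.mul_sum, Finset.mul_sum, ← Finset.sum_add_distrib]
    refine Finset.sum_eq_zero fun j _ => ?_
    by_cases hij : F.invGram i j = 0
    · simp [hij]
    have h3 := ih (u ++ i :: (w ++ [j]))
    simp only [parity_append, parity_cons, parity_nil, add_zero, sgn_add, F.invGram_parity hij]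
      at h3
    linear_combination F.invGram i j * sgn (j.1 * F.parity w) * h3 -
      F.invGram i j * sgn (j.1 * F.parity w) * sgn (F.parity u) * sgn (F.parity w) *
        F.derivList (fun y => F.surfaceAux (u ++ i :: (w ++ [j])) y g) ws * sgn_mul_self j.1

/-- The tensors of surfaces are closed. -/
theorem derivList_surface (ws : List (List F.Idx)) (g : ℕ) : F.derivList (F.surface g) ws = 0 := by
  cases ws with
  | nil => rfl
  | cons u ws => exact F.deriv_surfaceAux u ws g

end Linear

end DGFrobenius

namespace BWGraph

/-! ## Koszul signs -/

section Koszul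

variable {X : Type} [Fintype X] (p : X → ZMod 2)

/-- The total parity of a list of tensor factors. -/
def totalParity {X : Type} (p : X → ZMod 2) (L : List X) : ZMod 2 := (L.map p).sum

theorem totalParity_nil : totalParity p [] = 0 := rfl

theorem totalParity_cons (x : X) (L : List X) :
    totalParity p (x :: L) = p x + totalParity p L := by simp [totalParity]

theorem totalParity_append (L M : List X) :
    totalParity p (L ++ M) = totalParity p L + totalParity p M := by simp [totalParity]

theorem totalParity_perm {L M : List X} (h : L.Perm M) : totalParity p L = totalParity p M :=
  (h.map p).sum_eq

theorem koszulSign_mul_self (L M : List X) : koszulSign p L M * koszulSign p L M = 1 := by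
  rw [koszulSign, ← Finset.prod_mul_distrib]
  refine Finset.prod_eq_one fun x _ => ?_
  rw [← Finset.prod_mul_distrib]
  refine Finset.prod_eq_one fun y _ => ?_
  split_ifs
  · exact sgn_mul_self _
  · exact one_mul _

open scoped Classical in
-- `idxOf` of an absent element is the length of the list, so elements outside the lists contribute
-- no inversion to `koszulSign`.
theorem idxOf_not_lt {X : Type} {L : List X} {u v : X} (h : u ∉ L) :
    ¬ L.idxOf u < L.idxOf v := by
  rw [List.idxOf_of_notMem h]
  exact not_lt.mpr List.idxOf_le_length

open scoped Classical in
-- For each pair of elements, whether it is inverted from `L` to `N` is the sum modulo 2 of its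
-- inversions from `L` to `M` and from `M` to `N`.
theorem koszulSign_trans {L M N : List X} (hM : L.Perm M) (hN : L.Perm N) :
    koszulSign p L M * koszulSign p M N = koszulSign p L N := by
  suffices h : koszulSign p L M * koszulSign p M N * koszulSign p L N = 1 by
    calc _ = koszulSign p L M * koszulSign p M N *
          (koszulSign p L N * koszulSign p L N) := by rw [koszulSign_mul_self, mul_one]
      _ = _ := by rw [← mul_assoc, h, one_mul]
  simp only [koszulSign, ← Finset.prod_mul_distrib]
  rw [← Fintype.prod_prod_type']
  -- An inversion shows up in only one of the factors `(x, y)` and `(y, x)`, so these are cancelled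
  -- together; the diagonal factors are 1.
  refine Finset.prod_involution (fun z _ => (z.2, z.1)) ?_ ?_ (fun _ _ => Finset.mem_univ _)
    (fun _ _ => rfl)
  · rintro ⟨x, y⟩ -
    dsimp only
    by_cases hxy : x = y
    · subst hxy; simp
    by_cases hx : x ∈ L
    · by_cases hy : y ∈ L
      · have tri : ∀ {L : List X}, x ∈ L → y ∈ L →
            (L.idxOf x < L.idxOf y ∧ ¬ L.idxOf y < L.idxOf x) ∨
            (L.idxOf y < L.idxOf x ∧ ¬ L.idxOf x < L.idxOf y) := fun {L} h1 h2 => by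
          have : L.idxOf x ≠ L.idxOf y := fun h => hxy ((List.idxOf_inj h1).mp h)
          omega
        rw [mul_comm (p y) (p x)]
        have hs := sgn_mul_self (p x * p y)
        rcases tri hx hy with ⟨a, a'⟩ | ⟨a, a'⟩ <;>
        rcases tri (hM.mem_iff.mp hx) (hM.mem_iff.mp hy) with ⟨b, b'⟩ | ⟨b, b'⟩ <;>
        rcases tri (hN.mem_iff.mp hx) (hN.mem_iff.mp hy) with ⟨c, c'⟩ | ⟨c, c'⟩ <;>
        simp [a, a', b, b', c, c', hs]
      · have h1 := fun v => idxOf_not_lt (v := v) hy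
        have h2 := fun v => idxOf_not_lt (v := v) (fun h => hy (hM.mem_iff.mpr h))
        have h3 := fun v => idxOf_not_lt (v := v) (fun h => hy (hN.mem_iff.mpr h))
        simp [h1, h2, h3]
    · have h1 := fun v => idxOf_not_lt (v := v) hx
      have h2 := fun v => idxOf_not_lt (v := v) (fun h => hx (hM.mem_iff.mpr h))
      have h3 := fun v => idxOf_not_lt (v := v) (fun h => hx (hN.mem_iff.mpr h))
      simp [h1, h2, h3]
  · rintro ⟨x, y⟩ - h h'
    obtain rfl : y = x := congrArg Prod.fst h'
    simp at h

open scoped Classical in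
-- The inverted pairs containing `x` are those with the elements of `M₁`. From this recursion the
-- sign rules for appending, exchanging and renaming are derived, without returning to positions in
-- lists.
theorem koszulSign_cons {x : X} {L M₁ M₂ : List X} (hL : (x :: L).Nodup)
    (h : (x :: L).Perm (M₁ ++ x :: M₂)) :
    koszulSign p (x :: L) (M₁ ++ x :: M₂) =
      sgn (p x * totalParity p M₁) * koszulSign p L (M₁ ++ M₂) := by
  have hxL : x ∉ L := (List.nodup_cons.mp hL).1
  have hM : (M₁ ++ x :: M₂).Nodup := h.nodup_iff.mp hL
  have hM' := List.nodup_append.mp hM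
  have hx1 : x ∉ M₁ := fun h => hM'.2.2 x h x (by simp) rfl
  have hx2 : x ∉ M₂ := (List.nodup_cons.mp hM'.2.1).1
  have hA : ∏ v, (if v ∈ M₁ then sgn (p x * p v) else 1) = sgn (p x * totalParity p M₁) := by
    rw [← Finset.prod_filter]
    have hn : M₁.Nodup := hM'.1
    clear h hM hM' hx1
    induction M₁ with
    | nil => simp [totalParity_nil, sgn_zero]
    | cons a M ih =>
      have ha := List.nodup_cons.mp hn
      have : Finset.univ.filter (fun v => v ∈ a :: M) =
          insert a (Finset.univ.filter fun v => v ∈ M) := by ext; simp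
      rw [this, Finset.prod_insert (by simp [ha.1]), ih ha.2, totalParity_cons, mul_add, sgn_add]
  have hM1 : ∀ v ∈ M₁, (M₁ ++ x :: M₂).idxOf v = M₁.idxOf v := fun v hv =>
    List.idxOf_append_of_mem hv
  have hN1 : ∀ v ∈ M₁, (M₁ ++ M₂).idxOf v = M₁.idxOf v := fun v hv =>
    List.idxOf_append_of_mem hv
  have hM2 : ∀ v, v ∉ M₁ → v ≠ x →
      (M₁ ++ x :: M₂).idxOf v = M₁.length + (M₂.idxOf v + 1) := fun v hv hvx => by
    rw [List.idxOf_append_of_notMem hv, List.idxOf_cons_ne _ (Ne.symm hvx)]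
  have hN2 : ∀ v, v ∉ M₁ → (M₁ ++ M₂).idxOf v = M₁.length + M₂.idxOf v := fun v hv => by
    rw [List.idxOf_append_of_notMem hv]
  have hMx : (M₁ ++ x :: M₂).idxOf x = M₁.length := by
    rw [List.idxOf_append_of_notMem hx1, List.idxOf_cons_self, add_zero]
  have hlt : ∀ v ∈ M₁, M₁.idxOf v < M₁.length := fun v hv => List.idxOf_lt_length_iff.mpr hv
  have hprod : ∀ A : ℝ, A = ∏ u : X, if u = x then A else 1 := fun A => by simp
  rw [hprod (sgn (p x * totalParity p M₁)), koszulSign, koszulSign, ← Finset.prod_mul_distrib]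
  refine Finset.prod_congr rfl fun u _ => ?_
  rw [← hA]
  by_cases hu : u = x
  · subst hu
    rw [if_pos rfl]
    have : ∏ y, (if L.idxOf u < L.idxOf y ∧ (M₁ ++ M₂).idxOf y < (M₁ ++ M₂).idxOf u
        then sgn (p u * p y) else 1) = 1 :=
      Finset.prod_eq_one fun y _ => if_neg fun h => idxOf_not_lt hxL h.1
    rw [this, mul_one]
    refine Finset.prod_congr rfl fun v _ => ?_
    by_cases hv : v ∈ M₁
    · have hvu : u ≠ v := fun h => hx1 (h ▸ hv)
      rw [if_pos hv, if_pos]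
      rw [List.idxOf_cons_self, List.idxOf_cons_ne _ hvu, hMx, hM1 v hv]
      exact ⟨by omega, hlt v hv⟩
    · rw [if_neg hv, if_neg]
      rintro ⟨h1, h2⟩
      by_cases hvu : v = u
      · subst hvu; omega
      · rw [hMx, hM2 v hv hvu] at h2; omega
  · rw [if_neg hu, one_mul]
    refine Finset.prod_congr rfl fun v _ => ?_
    by_cases hv : v = x
    · subst hv
      rw [if_neg, if_neg]
      · rintro ⟨-, h⟩
        exact idxOf_not_lt (by simp [hx1, hx2]) h
      · rw [List.idxOf_cons_self]; rintro ⟨h, -⟩; omega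
    · congr 1
      rw [List.idxOf_cons_ne _ (Ne.symm hu), List.idxOf_cons_ne _ (Ne.symm hv)]
      have : (M₁ ++ x :: M₂).idxOf v < (M₁ ++ x :: M₂).idxOf u ↔
          (M₁ ++ M₂).idxOf v < (M₁ ++ M₂).idxOf u := by
        by_cases h1 : u ∈ M₁ <;> by_cases h2 : v ∈ M₁
        · rw [hM1 _ h1, hN1 _ h1, hM1 _ h2, hN1 _ h2]
        · have := hlt _ h1
          rw [hM1 _ h1, hN1 _ h1, hM2 _ h2 hv, hN2 _ h2]; omega
        · have := hlt _ h2
          rw [hM2 _ h1 hu, hN2 _ h1, hM1 _ h2, hN1 _ h2]; omega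
        · rw [hM2 _ h1 hu, hN2 _ h1, hM2 _ h2 hv, hN2 _ h2]; omega
      rw [this]
      simp

theorem koszulSign_nil : koszulSign p ([] : List X) [] = 1 := by simp [koszulSign]

theorem koszulSign_cons_cons {x : X} {L M : List X} (hL : (x :: L).Nodup) (h : L.Perm M) :
    koszulSign p (x :: L) (x :: M) = koszulSign p L M := by
  have := koszulSign_cons p (M₁ := []) (M₂ := M) hL (h.cons x)
  simpa [totalParity_nil, sgn_zero] using this

theorem koszulSign_self {L : List X} (hL : L.Nodup) : koszulSign p L L = 1 := by
  induction L with
  | nil => exact koszulSign_nil p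
  | cons x L ih =>
    rw [koszulSign_cons_cons p hL (List.Perm.refl L), ih (List.nodup_cons.mp hL).2]

theorem koszulSign_comm {L M : List X} (hL : L.Nodup) (h : L.Perm M) :
    koszulSign p L M = koszulSign p M L := by
  have h1 := koszulSign_trans p h (List.Perm.refl L)
  rw [koszulSign_self p hL] at h1
  calc koszulSign p L M = koszulSign p L M * (koszulSign p M L * koszulSign p M L) := by
        rw [koszulSign_mul_self, mul_one]
    _ = koszulSign p M L := by rw [← mul_assoc, h1, one_mul]

theorem koszulSign_append {L L' M M' : List X} (hL : (L ++ L').Nodup) (h : L.Perm M)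
    (h' : L'.Perm M') :
    koszulSign p (L ++ L') (M ++ M') = koszulSign p L M * koszulSign p L' M' := by
  induction L generalizing M with
  | nil => rw [List.nil_perm.mp h, koszulSign_nil, one_mul]; rfl
  | cons x L ih =>
    have hx : x ∈ M := h.mem_iff.mp (by simp)
    obtain ⟨M₁, M₂, rfl⟩ := List.append_of_mem hx
    have h1 : L.Perm (M₁ ++ M₂) := (h.trans List.perm_middle).cons_inv
    have hn : (x :: L).Nodup := (List.nodup_append.mp hL).1
    rw [koszulSign_cons p hn h, List.cons_append, List.append_assoc, List.cons_append,
      koszulSign_cons p (by simpa using hL), ← List.append_assoc,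
      ih (List.nodup_cons.mp hL).2 h1, mul_assoc]
    have := h.append h'
    simpa only [List.append_assoc, List.cons_append] using this

theorem koszulSign_swap {L M : List X} (h : (L ++ M).Nodup) :
    koszulSign p (L ++ M) (M ++ L) = sgn (totalParity p L * totalParity p M) := by
  induction L with
  | nil => simpa [totalParity_nil, sgn_zero] using koszulSign_self p h
  | cons x L ih =>
    rw [List.cons_append, koszulSign_cons p (by simpa using h)
      (by simpa using List.perm_append_comm (l₁ := x :: L) (l₂ := M)),
      ih (List.nodup_cons.mp h).2, totalParity_cons, add_mul, sgn_add]

/-- Exchanging two neighbouring blocks. -/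
theorem koszulSign_exchange {L M N K : List X} (h : (K ++ (L ++ (M ++ N))).Nodup) :
    koszulSign p (K ++ (L ++ (M ++ N))) (K ++ (M ++ (L ++ N))) =
      sgn (totalParity p L * totalParity p M) := by
  have h1 := (List.nodup_append.mp h).2.1
  have h2 : ((L ++ M) ++ N).Nodup := by simpa using h1
  have h3 : (L ++ (M ++ N)).Perm (M ++ (L ++ N)) := by
    simpa using (List.perm_append_comm (l₁ := L) (l₂ := M)).append_right N
  rw [koszulSign_append p h (List.Perm.refl K) h3, koszulSign_self p (List.nodup_append.mp h).1,
    one_mul, ← List.append_assoc, ← List.append_assoc M,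
    koszulSign_append p h2 List.perm_append_comm (List.Perm.refl N),
    koszulSign_swap p (List.nodup_append.mp h2).1, koszulSign_self p (List.nodup_append.mp h2).2.1,
    mul_one]

/-- Only the lists matter and not the ambient index type; needed because a contracted graph has
another type of half-edges. -/
theorem koszulSign_map {Y : Type} [Fintype Y] (q : Y → ZMod 2) (f : Y → X)
    (hf : Function.Injective f) (hp : ∀ y, p (f y) = q y) {L M : List Y} (hL : L.Nodup)
    (h : L.Perm M) : koszulSign p (L.map f) (M.map f) = koszulSign q L M := by
  induction L generalizing M with
  | nil => rw [List.nil_perm.mp h, List.map_nil, koszulSign_nil, koszulSign_nil]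
  | cons x L ih =>
    have hx : x ∈ M := h.mem_iff.mp (by simp)
    obtain ⟨M₁, M₂, rfl⟩ := List.append_of_mem hx
    have h1 : L.Perm (M₁ ++ M₂) := (h.trans List.perm_middle).cons_inv
    have h2 := h.map f
    rw [List.map_append, List.map_cons, List.map_cons] at h2 ⊢
    have h3 : totalParity p (M₁.map f) = totalParity q M₁ := by
      simp only [totalParity, List.map_map]
      congr 2; funext y; exact hp y
    rw [koszulSign_cons p (by simpa using hL.map hf) h2, koszulSign_cons q hL h, hp, h3,
      ← List.map_append, ih (List.nodup_cons.mp hL).2 h1]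

/-- The dependence of the Koszul sign on the parity of one factor. -/
theorem koszulSign_flip {q : X → ZMod 2} {x : X} (hx : q x = p x + 1)
    (hq : ∀ y, y ≠ x → q y = p y) {L₁ L₂ M₁ M₂ : List X} (hL : (L₁ ++ x :: L₂).Nodup)
    (h : (L₁ ++ x :: L₂).Perm (M₁ ++ x :: M₂)) :
    koszulSign p (L₁ ++ x :: L₂) (M₁ ++ x :: M₂) * sgn (totalParity p M₁) =
      koszulSign q (L₁ ++ x :: L₂) (M₁ ++ x :: M₂) * sgn (totalParity p L₁) := by
  have hM : (M₁ ++ x :: M₂).Nodup := h.nodup_iff.mp hL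
  -- Bringing `x` to the front of both lists isolates the dependence on the parity of `x`.
  have key : ∀ r : X → ZMod 2, koszulSign r (L₁ ++ x :: L₂) (M₁ ++ x :: M₂) =
      sgn (r x * totalParity r L₁) * sgn (r x * totalParity r M₁) *
        koszulSign r (L₁ ++ L₂) (M₁ ++ M₂) := by
    intro r
    have hL' : (x :: (L₁ ++ L₂)).Nodup := List.perm_middle.nodup_iff.mp hL
    rw [← koszulSign_trans r (M := x :: (L₁ ++ L₂)) List.perm_middle h,
      koszulSign_cons r hL' (List.perm_middle.symm.trans h),
      koszulSign_comm r hL List.perm_middle,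
      koszulSign_cons r hL' List.perm_middle.symm,
      koszulSign_self r (List.nodup_cons.mp hL').2]
    ring
  have hcongr : ∀ L : List X, x ∉ L → totalParity q L = totalParity p L := fun L hL => by
    unfold totalParity
    rw [List.map_congr_left fun y hy => hq y fun h => hL (h ▸ hy)]
  have hxL : x ∉ L₁ ∧ x ∉ L₂ := by
    have := (List.nodup_cons.mp (List.perm_middle.nodup_iff.mp hL)).1
    simpa using this
  have hxM : x ∉ M₁ ∧ x ∉ M₂ := by
    have := (List.nodup_cons.mp (List.perm_middle.nodup_iff.mp hM)).1
    simpa using this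
  have hK : koszulSign q (L₁ ++ L₂) (M₁ ++ M₂) = koszulSign p (L₁ ++ L₂) (M₁ ++ M₂) := by
    classical
    unfold koszulSign
    refine Finset.prod_congr rfl fun u _ => Finset.prod_congr rfl fun v _ => ?_
    by_cases hc : (L₁ ++ L₂).idxOf u < (L₁ ++ L₂).idxOf v ∧
        (M₁ ++ M₂).idxOf v < (M₁ ++ M₂).idxOf u
    · have hu : u ≠ x := fun h => idxOf_not_lt (by simp [h, hxL]) hc.1
      have hv : v ≠ x := fun h => idxOf_not_lt (by simp [h, hxM]) hc.2
      rw [hq u hu, hq v hv]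
    · rw [if_neg, if_neg] <;> exact hc
  rw [key p, key q, hK, hx, hcongr _ hxL.1, hcongr _ hxM.1]
  simp only [add_mul, one_mul, sgn_add]
  linear_combination (-(sgn (p x * totalParity p L₁) * sgn (p x * totalParity p M₁) *
    koszulSign p (L₁ ++ L₂) (M₁ ++ M₂) * sgn (totalParity p M₁))) *
      sgn_mul_self (totalParity p L₁)

end Koszul

end BWGraph

namespace BWGraph

/-! ## Independence of the choices in the tensors of surfaces -/

section Equiv

variable {X : Type}

/-- Lists of cyclic words which agree up to rotation of the words and up to their order. -/
def WordsEquiv (ws ws' : List (List X)) : Prop :=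
  ∃ ws'', List.Forall₂ List.IsRotated ws ws'' ∧ ws''.Perm ws'

theorem flatten_perm_of_forall₂ {ws ws' : List (List X)}
    (h : List.Forall₂ List.IsRotated ws ws') : ws.flatten.Perm ws'.flatten := by
  induction h with
  | nil => exact List.Perm.refl _
  | cons h _ ih => exact h.perm.append ih

theorem WordsEquiv.flatten_perm {ws ws' : List (List X)} (h : WordsEquiv ws ws') :
    ws.flatten.Perm ws'.flatten := by
  obtain ⟨ws'', h1, h2⟩ := h
  exact (flatten_perm_of_forall₂ h1).trans h2.flatten

theorem WordsEquiv.length_eq {ws ws' : List (List X)} (h : WordsEquiv ws ws') :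
    ws.length = ws'.length := by
  obtain ⟨ws'', h1, h2⟩ := h
  exact h1.length_eq.trans h2.length_eq

theorem exists_append_of_isRotated {w w' : List X} (h : w.IsRotated w') :
    ∃ a b, w = a ++ b ∧ w' = b ++ a := by
  obtain ⟨n, rfl⟩ := h
  exact ⟨w.take (n % w.length), w.drop (n % w.length), (List.take_append_drop _ _).symm,
    List.rotate_eq_drop_append_take_mod⟩

/-- A list of vertices, each with the genus of its surface and the words on the boundary circles. -/
abbrev VertexData (X : Type) : Type := List (ℕ × List (List X))

/-- All half-edges, vertex by vertex. -/
def halfEdges (D : VertexData X) : List X := D.flatMap fun e => e.2.flatten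

theorem halfEdges_cons (e : ℕ × List (List X)) (D : VertexData X) :
    halfEdges (e :: D) = e.2.flatten ++ halfEdges D := rfl

/-- Vertex data which agree up to the order of the vertices and of the circles at each vertex and up
to rotation of the words. -/
def DataEquiv (D D' : VertexData X) : Prop :=
  ∃ D'', List.Forall₂ (fun e e' => e.1 = e'.1 ∧ WordsEquiv e.2 e'.2) D D'' ∧ D''.Perm D'

theorem halfEdges_perm_of_forall₂ {D D' : VertexData X}
    (h : List.Forall₂ (fun e e' => e.1 = e'.1 ∧ WordsEquiv e.2 e'.2) D D') :
    (halfEdges D).Perm (halfEdges D') := by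
  induction h with
  | nil => exact List.Perm.refl _
  | cons h _ ih => exact h.2.flatten_perm.append ih

theorem halfEdges_perm {D D' : VertexData X} (h : D.Perm D') :
    (halfEdges D).Perm (halfEdges D') := h.flatMap_right _

/-! ### Invariance of the surface and vertex tensors up to Koszul signs. -/

section Tensor

variable [Fintype X]
variable {A : Type*} [NonUnitalRing A] [Module ℝ A] [FiniteDimensional ℝ A] {F : DGFrobenius A}

/-- The parities of the labels of the half-edges. -/
def labelParity (l : X → F.Idx) (x : X) : ZMod 2 := (l x).1

theorem parity_map (l : X → F.Idx) (w : List X) :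
    F.parity (w.map l) = totalParity (labelParity l) w := by
  simp only [DGFrobenius.parity, totalParity, List.map_map]; rfl

theorem parity_flatten_map (l : X → F.Idx) (ws : List (List X)) :
    F.parity (ws.map (List.map l)).flatten = totalParity (labelParity l) ws.flatten := by
  rw [← List.map_flatten, parity_map]

variable [IsScalarTower ℝ A A] [SMulCommClass ℝ A A]

/-- The word of a circle other than the first lies inside a strip, so rotating it is sliding along
the inner side. The first circle is treated by cyclicity in `surfaceAux_head_rotated`. -/
theorem surfaceAux_rotated (l : X → F.Idx) {w w' : List X} (h : w.IsRotated w') (hw : w.Nodup)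
    (u : List F.Idx) (ws : List (List F.Idx)) (g : ℕ) :
    F.surfaceAux u (w.map l :: ws) g =
      koszulSign (labelParity l) w w' * F.surfaceAux u (w'.map l :: ws) g := by
  obtain ⟨a, b, rfl, rfl⟩ := exists_append_of_isRotated h
  rw [koszulSign_swap _ hw, List.map_append, List.map_append, F.surfaceAux_cons,
    F.surfaceAux_cons, (F.slidable_surfaceAux ws g).inner_append, parity_map, parity_map]

theorem surfaceAux_head_rotated (l : X → F.Idx) {w w' : List X} (h : w.IsRotated w')
    (hw : w.Nodup) (ws : List (List F.Idx)) (g : ℕ) :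
    F.surfaceAux (w.map l) ws g =
      koszulSign (labelParity l) w w' * F.surfaceAux (w'.map l) ws g := by
  obtain ⟨a, b, rfl, rfl⟩ := exists_append_of_isRotated h
  rw [koszulSign_swap _ hw, List.map_append, List.map_append, F.surfaceAux_cyclic_append,
    parity_map, parity_map]

theorem strip_congr_mul (c : ℝ) {f f' : List F.Idx → ℝ} (h : ∀ x, f x = c * f' x)
    (α β γ : List F.Idx) : F.strip f α β γ = c * F.strip f' α β γ := by
  simp only [DGFrobenius.strip, h, Finset.mul_sum]
  exact Finset.sum_congr rfl fun i _ => Finset.sum_congr rfl fun j _ => by ring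

theorem surfaceAux_forall₂ (l : X → F.Idx) {ws ws' : List (List X)}
    (h : List.Forall₂ List.IsRotated ws ws') (hn : ws.flatten.Nodup) (u : List F.Idx) (g : ℕ) :
    F.surfaceAux u (ws.map (List.map l)) g =
      koszulSign (labelParity l) ws.flatten ws'.flatten *
        F.surfaceAux u (ws'.map (List.map l)) g := by
  induction h generalizing u with
  | nil => rw [List.flatten_nil, koszulSign_nil, one_mul]
  | @cons w w' ws ws' hw hws ih =>
    have hn' := List.nodup_append.mp hn
    rw [List.flatten_cons, List.flatten_cons, koszulSign_append _ hn hw.perm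
      (flatten_perm_of_forall₂ hws), List.map_cons, List.map_cons,
      surfaceAux_rotated l hw hn'.1, F.surfaceAux_cons, F.surfaceAux_cons,
      strip_congr_mul _ (fun x => ih hn'.2.1 x), mul_assoc]

theorem surfaceAux_perm (l : X → F.Idx) {ws ws' : List (List X)} (h : ws.Perm ws')
    (hn : ws.flatten.Nodup) (u : List F.Idx) (g : ℕ) :
    F.surfaceAux u (ws.map (List.map l)) g =
      koszulSign (labelParity l) ws.flatten ws'.flatten *
        F.surfaceAux u (ws'.map (List.map l)) g := by
  induction h generalizing u with
  | nil => rw [List.flatten_nil, koszulSign_nil, one_mul]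
  | @cons w ws ws' hws ih =>
    have hn' := List.nodup_append.mp hn
    rw [List.flatten_cons, List.flatten_cons, koszulSign_append _ hn (List.Perm.refl _)
      hws.flatten, List.map_cons, List.map_cons, F.surfaceAux_cons, F.surfaceAux_cons,
      strip_congr_mul _ (fun x => ih hn'.2.1 x), koszulSign_self _ hn'.1, one_mul]
  | swap w w' ws =>
    have := koszulSign_exchange (labelParity l) (K := []) (L := w') (M := w) (N := ws.flatten) hn
    simp only [List.nil_append] at this
    simp only [List.map_cons, List.flatten_cons, this]
    rw [F.surfaceAux_swap, parity_map, parity_map]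
  | trans h₁ h₂ ih₁ ih₂ =>
    rw [ih₁ hn, ih₂ (h₁.flatten.nodup_iff.mp hn), ← koszulSign_trans _ h₁.flatten (h₁.trans h₂).flatten,
      mul_assoc]

theorem surface_forall₂ (l : X → F.Idx) {ws ws' : List (List X)}
    (h : List.Forall₂ List.IsRotated ws ws') (hn : ws.flatten.Nodup) (g : ℕ) :
    F.surface g (ws.map (List.map l)) =
      koszulSign (labelParity l) ws.flatten ws'.flatten *
        F.surface g (ws'.map (List.map l)) := by
  cases h with
  | nil => rw [List.flatten_nil, koszulSign_nil, one_mul]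
  | @cons w w' ws ws' hw hws =>
    have hn' := List.nodup_append.mp hn
    rw [List.flatten_cons, List.flatten_cons, koszulSign_append _ hn hw.perm
      (flatten_perm_of_forall₂ hws), List.map_cons, List.map_cons]
    simp only [DGFrobenius.surface]
    rw [surfaceAux_head_rotated l hw hn'.1, surfaceAux_forall₂ l hws hn'.2.1, mul_assoc]

theorem surface_perm (l : X → F.Idx) {ws ws' : List (List X)} (h : ws.Perm ws')
    (hn : ws.flatten.Nodup) (g : ℕ) :
    F.surface g (ws.map (List.map l)) =
      koszulSign (labelParity l) ws.flatten ws'.flatten *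
        F.surface g (ws'.map (List.map l)) := by
  induction h with
  | nil => rw [List.flatten_nil, koszulSign_nil, one_mul]
  | @cons w ws ws' hws ih =>
    have hn' := List.nodup_append.mp hn
    rw [List.flatten_cons, List.flatten_cons, koszulSign_append _ hn (List.Perm.refl _)
      hws.flatten, List.map_cons, List.map_cons, koszulSign_self _ hn'.1, one_mul]
    exact surfaceAux_perm l hws hn'.2.1 _ g
  | swap w w' ws =>
    have := koszulSign_exchange (labelParity l) (K := []) (L := w') (M := w) (N := ws.flatten) hn
    simp only [List.nil_append] at this
    simp only [List.map_cons, List.flatten_cons, this, DGFrobenius.surface]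
    rw [F.surfaceAux_exchange, parity_map, parity_map]
  | trans h₁ h₂ ih₁ ih₂ =>
    rw [ih₁ hn, ih₂ (h₁.flatten.nodup_iff.mp hn), ← koszulSign_trans _ h₁.flatten (h₁.trans h₂).flatten,
      mul_assoc]

theorem surface_equiv (l : X → F.Idx) {ws ws' : List (List X)} (h : WordsEquiv ws ws')
    (hn : ws.flatten.Nodup) (g : ℕ) :
    F.surface g (ws.map (List.map l)) =
      koszulSign (labelParity l) ws.flatten ws'.flatten *
        F.surface g (ws'.map (List.map l)) := by
  obtain ⟨ws'', h1, h2⟩ := h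
  have h3 := flatten_perm_of_forall₂ h1
  rw [surface_forall₂ l h1 hn, surface_perm l h2 (h3.nodup_iff.mp hn),
    ← koszulSign_trans _ h3 (h3.trans h2.flatten), mul_assoc]

/-- The product of the tensors of the vertices. -/
noncomputable def vertexValue (l : X → F.Idx) (D : VertexData X) : ℝ :=
  (D.map fun e => F.surface e.1 (e.2.map (List.map l))).prod

theorem vertexValue_cons (l : X → F.Idx) (e : ℕ × List (List X)) (D : VertexData X) :
    vertexValue l (e :: D) = F.surface e.1 (e.2.map (List.map l)) * vertexValue l D := by
  simp [vertexValue]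

theorem totalParity_of_surface_ne_zero (l : X → F.Idx) {g : ℕ} {ws : List (List X)}
    (h : F.surface g (ws.map (List.map l)) ≠ 0) :
    totalParity (labelParity l) ws.flatten = 0 := by
  rw [← parity_flatten_map]; exact F.surface_parity h

/-- At each vertex this is `surface_equiv`. Exchanging two vertices gives no sign when the product
is nonzero, because nonvanishing surface tensors have even total parity. -/
theorem vertexValue_equiv (l : X → F.Idx) {D D' : VertexData X} (h : DataEquiv D D')
    (hn : (halfEdges D).Nodup) :
    vertexValue l D =
      koszulSign (labelParity l) (halfEdges D) (halfEdges D') * vertexValue l D' := by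
  obtain ⟨D'', h1, h2⟩ := h
  have h3 := halfEdges_perm_of_forall₂ h1
  have e1 : vertexValue l D =
      koszulSign (labelParity l) (halfEdges D) (halfEdges D'') * vertexValue l D'' := by
    clear h2
    induction h1 with
    | nil => rw [halfEdges, List.flatMap_nil, koszulSign_nil, one_mul]
    | @cons e e' D D' he hD ih =>
      rw [halfEdges_cons] at hn
      have hn' := List.nodup_append.mp hn
      rw [halfEdges_cons, halfEdges_cons, koszulSign_append _ hn he.2.flatten_perm
        (halfEdges_perm_of_forall₂ hD), vertexValue_cons, vertexValue_cons,
        surface_equiv l he.2 hn'.1, ih hn'.2.1 (halfEdges_perm_of_forall₂ hD), he.1]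
      ring
  have e2 : vertexValue l D'' =
      koszulSign (labelParity l) (halfEdges D'') (halfEdges D') * vertexValue l D' := by
    have hn'' := h3.nodup_iff.mp hn
    clear h1 e1 h3 hn
    induction h2 with
    | nil => rw [halfEdges, List.flatMap_nil, koszulSign_nil, one_mul]
    | @cons e D D' hD ih =>
      rw [halfEdges_cons] at hn''
      have hn' := List.nodup_append.mp hn''
      rw [halfEdges_cons, halfEdges_cons, koszulSign_append _ hn'' (List.Perm.refl _)
        (BWGraph.halfEdges_perm hD), vertexValue_cons, vertexValue_cons, ih hn'.2.1,
        koszulSign_self _ hn'.1]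
      ring
    | swap e e' D =>
      have := koszulSign_exchange (labelParity l) (K := []) (L := e'.2.flatten) (M := e.2.flatten)
        (N := halfEdges D) hn''
      simp only [List.nil_append] at this
      simp only [halfEdges_cons, vertexValue_cons, this]
      by_cases he : F.surface e.1 (e.2.map (List.map l)) = 0
      · simp [he]
      · rw [totalParity_of_surface_ne_zero l he, mul_zero, sgn_zero]; ring
    | trans h₁ h₂ ih₁ ih₂ =>
      have p1 := BWGraph.halfEdges_perm h₁
      rw [ih₁ hn'', ih₂ (p1.nodup_iff.mp hn''),
        ← koszulSign_trans _ p1 (p1.trans (BWGraph.halfEdges_perm h₂)), mul_assoc]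
  rw [e1, e2, ← koszulSign_trans _ h3 (h3.trans (BWGraph.halfEdges_perm h2)), mul_assoc]

end Tensor

/-! ## Cyclic words of a permutation -/

/-- The word runs along a cycle of `f` (or is empty). -/
def IsCyc (f : X → X) : List X → Prop
  | [] => True
  | x :: u => List.IsChain (fun a b => f a = b) (x :: (u ++ [x]))

theorem isCyc_rotate_one {f : X → X} {x : X} {u : List X} (h : IsCyc f (x :: u)) :
    IsCyc f (u ++ [x]) := by
  cases u with
  | nil => exact h
  | cons y u =>
    have h1 : List.IsChain (fun a b => f a = b) (x :: y :: (u ++ [x])) := h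
    rw [List.isChain_cons_cons] at h1
    change List.IsChain (fun a b => f a = b) (y :: (u ++ [x] ++ [y]))
    rw [← List.cons_append, List.isChain_append]
    refine ⟨h1.2, List.isChain_singleton _, ?_⟩
    intro a ha b hb
    rw [← List.cons_append, List.getLast?_concat] at ha
    simp only [Option.mem_def, Option.some.injEq, List.head?_cons] at ha hb
    rw [← ha, ← hb, h1.1]

theorem isCyc_rotate {f : X → X} (a b : List X) (h : IsCyc f (a ++ b)) : IsCyc f (b ++ a) := by
  induction a generalizing b with
  | nil => simpa using h
  | cons x a ih =>
    have h1 : IsCyc f (x :: (a ++ b)) := h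
    have := isCyc_rotate_one h1
    rw [List.append_assoc] at this
    simpa using ih _ this

theorem IsCyc.of_isRotated {f : X → X} {w w' : List X} (h : IsCyc f w) (hr : w.IsRotated w') :
    IsCyc f w' := by
  obtain ⟨a, b, rfl, rfl⟩ := exists_append_of_isRotated hr
  exact isCyc_rotate a b h

theorem isRotated_cons_of_mem {x : X} {w : List X} (h : x ∈ w) :
    ∃ u, w.IsRotated (x :: u) := by
  obtain ⟨a, b, rfl⟩ := List.append_of_mem h
  exact ⟨b ++ a, by simpa using List.isRotated_append (l := a) (l' := x :: b)⟩

theorem chain_unique {f : X → X} {x : X} {a : X} {u u' : List X} (hx : x ∉ u) (hx' : x ∉ u')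
    (h : List.IsChain (fun a b => f a = b) (a :: (u ++ [x])))
    (h' : List.IsChain (fun a b => f a = b) (a :: (u' ++ [x]))) : u = u' := by
  induction u generalizing a u' with
  | nil =>
    cases u' with
    | nil => rfl
    | cons b u' =>
      rw [List.nil_append, List.isChain_cons_cons] at h
      rw [List.cons_append, List.isChain_cons_cons] at h'
      exact absurd (by rw [← h.1, h'.1]; simp) hx'
  | cons c u ih =>
    rw [List.cons_append, List.isChain_cons_cons] at h
    cases u' with
    | nil =>
      rw [List.nil_append, List.isChain_cons_cons] at h'
      exact absurd (by rw [← h'.1, h.1]; simp) hx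
    | cons b u' =>
      rw [List.cons_append, List.isChain_cons_cons] at h'
      have : c = b := h.1.symm.trans h'.1
      subst this
      rw [ih (fun h => hx (by simp [h])) (fun h => hx' (by simp [h])) h.2 h'.2]

/-- Once both words are rotated to start at `x`, each is the orbit of `x` up to its first return. -/
theorem IsCyc.isRotated {f : X → X} {w w' : List X} (h : IsCyc f w) (h' : IsCyc f w')
    (hw : w.Nodup) (hw' : w'.Nodup) {x : X} (hx : x ∈ w) (hx' : x ∈ w') : w.IsRotated w' := by
  obtain ⟨u, hu⟩ := isRotated_cons_of_mem hx
  obtain ⟨u', hu'⟩ := isRotated_cons_of_mem hx'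
  have h1 := h.of_isRotated hu
  have h2 := h'.of_isRotated hu'
  have n1 := List.nodup_cons.mp (hu.nodup_iff.mp hw)
  have n2 := List.nodup_cons.mp (hu'.nodup_iff.mp hw')
  rw [chain_unique n1.1 n2.1 h1 h2] at hu
  exact hu.trans hu'.symm

/-- A family of disjoint cycles of a permutation is determined by its support and the number of
empty words. -/
theorem wordsEquiv_of_isCyc {f : X → X} {ws ws' : List (List X)} (hn : ws.flatten.Nodup)
    (hn' : ws'.flatten.Nodup) (hm : ∀ x, x ∈ ws.flatten ↔ x ∈ ws'.flatten)
    (hc : ∀ w ∈ ws, IsCyc f w) (hc' : ∀ w ∈ ws', IsCyc f w)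
    (h0 : ws.countP List.isEmpty = ws'.countP List.isEmpty) : WordsEquiv ws ws' := by
  induction ws generalizing ws' with
  | nil =>
    have : ws' = [] := by
      cases ws' with
      | nil => rfl
      | cons w ws' =>
        cases w with
        | nil => simp at h0
        | cons x w => exact absurd ((hm x).mpr (by simp)) (by simp)
    subst this
    exact ⟨[], List.Forall₂.nil, List.Perm.refl _⟩
  | cons w ws ih =>
    have key : ∃ w' ∈ ws', w.IsRotated w' := by
      cases w with
      | nil =>
        have : 0 < ws'.countP List.isEmpty := by rw [← h0]; simp
        obtain ⟨w', hw', he⟩ := List.countP_pos_iff.mp this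
        rw [List.isEmpty_iff] at he
        exact ⟨w', hw', he ▸ List.IsRotated.refl _⟩
      | cons x w =>
        obtain ⟨w', hw', hx⟩ := List.mem_flatten.mp ((hm x).mp (by simp))
        refine ⟨w', hw', (hc _ (by simp)).isRotated (hc' _ hw') (List.nodup_append.mp hn).1 ?_
          (by simp) hx⟩
        exact (List.nodup_flatten.mp hn').1 _ hw'
    obtain ⟨w', hw', hr⟩ := key
    obtain ⟨s, t, rfl⟩ := List.append_of_mem hw'
    have hp : (s ++ w' :: t).Perm (w' :: (s ++ t)) := List.perm_middle
    have hn2 : (w' ++ (s ++ t).flatten).Nodup := hp.flatten.nodup_iff.mp hn'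
    have hd := List.nodup_append.mp hn
    have hd' := List.nodup_append.mp hn2
    obtain ⟨ws'', h1, h2⟩ := ih (ws' := s ++ t) hd.2.1 hd'.2.1
      (fun x => by
        have e1 : x ∈ w ∨ x ∈ ws.flatten ↔ x ∈ w' ∨ x ∈ (s ++ t).flatten := by
          have := (hm x).trans hp.flatten.mem_iff
          simpa using this
        have e2 : x ∈ w ↔ x ∈ w' := hr.mem_iff
        constructor
        · intro h
          have : x ∉ w := fun hx => hd.2.2 x hx x h rfl
          tauto
        · intro h
          have : x ∉ w' := fun hx => hd'.2.2 x hx x h rfl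
          tauto)
      (fun v hv => hc v (by simp [hv])) (fun v hv => hc' v (hp.mem_iff.mpr (by simp [hv])))
      (by
        rw [hp.countP_eq, List.countP_cons, List.countP_cons] at h0
        have : w = [] ↔ w' = [] := by
          constructor
          · rintro rfl; exact List.isRotated_nil_iff'.mp hr |>.symm
          · rintro rfl; exact List.isRotated_nil_iff.mp hr
        by_cases hw : w = []
        · simpa [hw, this.mp hw] using h0
        · simpa [hw, mt this.mpr hw, List.isEmpty_iff] using h0)
    exact ⟨w' :: ws'', List.Forall₂.cons hr h1, (h2.cons w').trans hp.symm⟩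

end Equiv

end BWGraph

namespace BWGraph

/-! ## Decompositions into cycles -/

section Cycles

variable {X : Type}

theorem isChain_iterate (f : X → X) (a : X) (n : ℕ) :
    List.IsChain (fun a b => f a = b) (List.iterate f a n) := by
  induction n generalizing a with
  | zero => exact List.isChain_nil
  | succ n ih =>
    cases n with
    | zero => exact List.isChain_singleton _
    | succ n => exact List.isChain_cons_cons.mpr ⟨rfl, ih (f a)⟩

variable [Finite X]

theorem minimalPeriod_pos (f : Equiv.Perm X) (x : X) : 0 < Function.minimalPeriod f x := by
  refine Function.IsPeriodicPt.minimalPeriod_pos (orderOf_pos f) ?_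
  rw [Function.IsPeriodicPt, Function.IsFixedPt, ← Equiv.Perm.coe_pow, pow_orderOf_eq_one]
  rfl

theorem cycleWord_ne_nil (f : Equiv.Perm X) (q : Orbits f) : cycleWord f q ≠ [] := by
  rw [cycleWord, Ne, List.iterate_eq_nil]
  exact (minimalPeriod_pos f _).ne'

theorem cycleWord_nodup (f : Equiv.Perm X) (q : Orbits f) : (cycleWord f q).Nodup := by
  rw [cycleWord, List.nodup_iff_injective_getElem]
  intro i j h
  have hi : (i : ℕ) < Function.minimalPeriod f q.out := by simpa using i.2
  have hj : (j : ℕ) < Function.minimalPeriod f q.out := by simpa using j.2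
  simp only [List.getElem_iterate] at h
  exact Fin.ext (Function.iterate_injOn_Iio_minimalPeriod hi hj h)

theorem mem_cycleWord (f : Equiv.Perm X) (q : Orbits f) (x : X) :
    x ∈ cycleWord f q ↔ Quotient.mk (Equiv.Perm.SameCycle.setoid f) x = q := by
  have h0 : Quotient.mk (Equiv.Perm.SameCycle.setoid f) x = q ↔ f.SameCycle q.out x := by
    conv_lhs => rw [← q.out_eq]
    rw [eq_comm, Quotient.eq]; rfl
  rw [h0, cycleWord, List.mem_iterate]
  constructor
  · rintro ⟨m, -, rfl⟩
    exact ⟨m, by simp [Equiv.Perm.iterate_eq_pow]⟩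
  · intro h
    obtain ⟨m, rfl⟩ := h.exists_nat_pow_eq
    refine ⟨m % Function.minimalPeriod f q.out, Nat.mod_lt _ (minimalPeriod_pos f _), ?_⟩
    rw [Function.iterate_mod_minimalPeriod_eq, Equiv.Perm.iterate_eq_pow]

theorem isCyc_cycleWord (f : Equiv.Perm X) (q : Orbits f) : IsCyc f (cycleWord f q) := by
  have h : f^[Function.minimalPeriod f q.out] q.out = q.out := Function.iterate_minimalPeriod
  have hpos := minimalPeriod_pos f q.out
  rw [cycleWord]
  generalize Function.minimalPeriod f q.out = n at h hpos
  obtain ⟨m, rfl⟩ := Nat.exists_eq_succ_of_ne_zero hpos.ne'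
  change List.IsChain _ (q.out :: (List.iterate f (f q.out) m ++ [q.out]))
  have h2 : q.out :: (List.iterate f (f q.out) m ++ [q.out]) = List.iterate f q.out (m + 2) := by
    have h3 : f^[m] (f q.out) = q.out := h
    rw [List.iterate, List.iterate_add, h3]; rfl
  rw [h2]
  exact isChain_iterate _ _ _

/-- The decomposition of a permutation into nonempty cycles. -/
structure IsCycleDecomposition (f : X → X) (ws : List (List X)) : Prop where
  nodup : ws.flatten.Nodup
  mem : ∀ x, x ∈ ws.flatten
  cyc : ∀ w ∈ ws, IsCyc f w
  ne_nil : ∀ w ∈ ws, w ≠ []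

theorem pairwise_disjoint_cycleWord (f : Equiv.Perm X) {L : List (Orbits f)} (h : L.Nodup) :
    (L.map (cycleWord f)).Pairwise List.Disjoint := by
  rw [List.pairwise_map]
  refine h.imp ?_
  intro q q' hq x hx hx'
  exact hq (((mem_cycleWord f q x).mp hx).symm.trans ((mem_cycleWord f q' x).mp hx'))

theorem isCycleDecomposition_cycleWord (f : Equiv.Perm X) :
    IsCycleDecomposition f ((Finset.univ : Finset (Orbits f)).toList.map (cycleWord f)) where
  nodup := by
    rw [List.nodup_flatten]
    refine ⟨?_, pairwise_disjoint_cycleWord f (Finset.nodup_toList _)⟩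
    simp only [List.mem_map]
    rintro _ ⟨q, -, rfl⟩
    exact cycleWord_nodup f q
  mem x := by
    simp only [List.mem_flatten, List.mem_map, Finset.mem_toList, Finset.mem_univ, true_and]
    exact ⟨_, ⟨_, rfl⟩, (mem_cycleWord f _ x).mpr rfl⟩
  cyc := by
    simp only [List.mem_map]
    rintro _ ⟨q, -, rfl⟩
    exact isCyc_cycleWord f q
  ne_nil := by
    simp only [List.mem_map]
    rintro _ ⟨q, -, rfl⟩
    exact cycleWord_ne_nil f q

theorem countP_isEmpty_eq_zero {ws : List (List X)} (h : ∀ w ∈ ws, w ≠ []) :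
    ws.countP List.isEmpty = 0 :=
  List.countP_eq_zero.mpr fun w hw => by simpa [List.isEmpty_iff] using h w hw

theorem IsCycleDecomposition.card_orbits {f : Equiv.Perm X} {ws : List (List X)}
    (h : IsCycleDecomposition f ws) : Fintype.card (Orbits f) = ws.length := by
  have h' := isCycleDecomposition_cycleWord f
  have := (wordsEquiv_of_isCyc h.nodup h'.nodup (fun x => iff_of_true (h.mem x) (h'.mem x))
    h.cyc h'.cyc (by
      rw [countP_isEmpty_eq_zero h.ne_nil, countP_isEmpty_eq_zero h'.ne_nil])).length_eq
  rw [this]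
  simp

end Cycles

/-! ## Presentations of a graph by vertex data -/

variable {k : ℕ} (γ : BWGraph k)

/-- The words on the boundary circles of the surface at `v`, in any order. -/
structure VertexWords (v : γ.V) (ws : List (List γ.H)) : Prop where
  nodup : ws.flatten.Nodup
  mem : ∀ x, x ∈ ws.flatten ↔ γ.vert x = v
  cyc : ∀ w ∈ ws, IsCyc γ.next w
  holes : ws.countP List.isEmpty = γ.holes v

theorem vert_eq_of_sameCycle {x y : γ.H} (h : γ.next.SameCycle x y) : γ.vert x = γ.vert y := by
  obtain ⟨n, rfl⟩ := h.exists_nat_pow_eq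
  induction n with
  | zero => rfl
  | succ n ih =>
    rw [pow_succ', Equiv.Perm.mul_apply, γ.vert_next]
    exact ih ⟨n, by simp⟩

theorem sameCycle_out {X : Type} (f : Equiv.Perm X) (x : X) :
    f.SameCycle (Quotient.mk (Equiv.Perm.SameCycle.setoid f) x).out x :=
  Quotient.exact (s := Equiv.Perm.SameCycle.setoid f) (Quotient.out_eq _)

theorem vert_out (x : γ.H) :
    γ.vert (Quotient.mk (Equiv.Perm.SameCycle.setoid γ.next) x).out = γ.vert x :=
  γ.vert_eq_of_sameCycle (sameCycle_out _ _)

theorem vertexWords_circleWords (v : γ.V) : γ.VertexWords v (γ.circleWords v) where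
  nodup := by
    rw [circleWords, List.flatten_append]
    have : (List.replicate (γ.holes v) ([] : List γ.H)).flatten = [] := by simp
    rw [this, List.append_nil, List.nodup_flatten]
    refine ⟨?_, pairwise_disjoint_cycleWord _ (Finset.nodup_toList _)⟩
    simp only [List.mem_map]
    rintro _ ⟨q, -, rfl⟩
    exact cycleWord_nodup _ q
  mem x := by
    rw [circleWords, List.flatten_append]
    have : (List.replicate (γ.holes v) ([] : List γ.H)).flatten = [] := by simp
    rw [this, List.append_nil]
    simp only [List.mem_flatten, List.mem_map, Finset.mem_toList, circlesAt, Finset.mem_filter,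
      Finset.mem_univ, true_and]
    constructor
    · rintro ⟨_, ⟨q, hq, rfl⟩, hx⟩
      rw [mem_cycleWord] at hx
      rw [← γ.vert_out, hx, hq]
    · intro h
      exact ⟨_, ⟨_, by rw [γ.vert_out, h], rfl⟩, (mem_cycleWord _ _ x).mpr rfl⟩
  cyc := by
    intro w hw
    rw [circleWords, List.mem_append] at hw
    rcases hw with hw | hw
    · obtain ⟨q, -, rfl⟩ := List.mem_map.mp hw
      exact isCyc_cycleWord _ q
    · rw [(List.mem_replicate.mp hw).2]; trivial
  holes := by
    rw [circleWords, List.countP_append, countP_isEmpty_eq_zero]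
    · simp [List.countP_replicate]
    · simp only [List.mem_map]
      rintro _ ⟨q, -, rfl⟩
      exact cycleWord_ne_nil _ q

variable {γ}

theorem VertexWords.wordsEquiv {v : γ.V} {ws ws' : List (List γ.H)} (h : γ.VertexWords v ws)
    (h' : γ.VertexWords v ws') : WordsEquiv ws ws' :=
  wordsEquiv_of_isCyc h.nodup h'.nodup (fun x => (h.mem x).trans (h'.mem x).symm) h.cyc h'.cyc
    (h.holes.trans h'.holes.symm)

theorem VertexWords.length_eq {v : γ.V} {ws : List (List γ.H)} (h : γ.VertexWords v ws) :
    ws.length = γ.boundaryCount v := by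
  rw [(h.wordsEquiv (γ.vertexWords_circleWords v)).length_eq, circleWords, boundaryCount]
  simp

theorem card_subtype_eq_length {X : Type} {L : List X} (h : L.Nodup) {q : X → Prop}
    (hq : ∀ x, x ∈ L ↔ q x) : Nat.card {x // q x} = L.length := by
  classical
  rw [← Nat.card_congr (Equiv.subtypeEquivRight hq), ← Nat.card_congr (h.getEquiv L)]
  simp

theorem VertexWords.flatten_length_eq {v : γ.V} {ws : List (List γ.H)}
    (h : γ.VertexWords v ws) : ws.flatten.length = γ.valency v :=
  (card_subtype_eq_length h.nodup h.mem).symm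

/-- The genus and the words at a vertex. -/
def IsVertexData (γ : BWGraph k) (v : γ.V) (e : ℕ × List (List γ.H)) : Prop :=
  e.1 = γ.genus v ∧ γ.VertexWords v e.2

/-- The vertex data describe the surfaces at the vertices of the graph. -/
def Presents (γ : BWGraph k) (D : VertexData γ.H) : Prop :=
  ∃ vs : List γ.V, vs.Nodup ∧ (∀ v, v ∈ vs) ∧ List.Forall₂ γ.IsVertexData vs D

/-- Presentations differ only in orders and starting points. So the choices hidden in the definition
of the amplitude can be replaced by ones adapted to a given edge or transported along an
isomorphism. -/
theorem Presents.dataEquiv {D D' : VertexData γ.H} (h : γ.Presents D) (h' : γ.Presents D') :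
    DataEquiv D D' := by
  obtain ⟨vs, hn, hm, h⟩ := h
  obtain ⟨vs', hn', hm', h'⟩ := h'
  have hp : vs.Perm vs' := (List.perm_ext_iff_of_nodup hn hn').mpr fun v =>
    iff_of_true (hm v) (hm' v)
  obtain ⟨D'', h1, h2⟩ := List.perm_comp_forall₂ hp h'
  refine ⟨D'', ?_, h2⟩
  clear hp h2 h' hn hm
  induction h generalizing D'' with
  | nil => cases h1; exact List.Forall₂.nil
  | cons he _ ih =>
    cases h1 with
    | cons he' h1 =>
      exact List.Forall₂.cons ⟨he.1.trans he'.1.symm, he.2.wordsEquiv he'.2⟩ (ih _ h1)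

variable (γ) in
/-- The presentation chosen in the definition of the amplitude. -/
noncomputable def standardData : VertexData γ.H :=
  (Finset.univ : Finset γ.V).toList.map fun v => (γ.genus v, γ.circleWords v)

variable (γ) in
theorem presents_standardData : γ.Presents γ.standardData := by
  refine ⟨(Finset.univ : Finset γ.V).toList, Finset.nodup_toList _, by simp, ?_⟩
  rw [standardData, List.forall₂_map_right_iff, List.forall₂_same]
  exact fun v _ => ⟨rfl, γ.vertexWords_circleWords v⟩

variable (γ) in
theorem halfEdges_standardData : halfEdges γ.standardData = γ.vertexOrder := by
  rw [halfEdges, standardData, vertexOrder, List.flatMap_map]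

theorem Presents.mem_halfEdges {D : VertexData γ.H} (h : γ.Presents D) (x : γ.H) :
    x ∈ halfEdges D := by
  obtain ⟨vs, -, hm, h⟩ := h
  have hx := hm (γ.vert x)
  clear hm
  induction h with
  | nil => simp at hx
  | cons he _ ih =>
    rw [halfEdges_cons, List.mem_append]
    rcases List.mem_cons.mp hx with h | h
    · exact Or.inl ((he.2.mem x).mpr h)
    · exact Or.inr (ih h)

theorem nodup_halfEdges_of_forall₂ {vs : List γ.V} (hn : vs.Nodup) {D : VertexData γ.H}
    (h : List.Forall₂ γ.IsVertexData vs D) :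
    (halfEdges D).Nodup ∧ ∀ x ∈ halfEdges D, γ.vert x ∈ vs := by
  induction h with
  | nil => simp [halfEdges]
  | @cons v e vs D he _ ih =>
    obtain ⟨ih1, ih2⟩ := ih (List.nodup_cons.mp hn).2
    rw [halfEdges_cons]
    refine ⟨List.nodup_append.mpr ⟨he.2.nodup, ih1, ?_⟩, ?_⟩
    · rintro x hx y hy rfl
      exact (List.nodup_cons.mp hn).1 ((he.2.mem x).mp hx ▸ ih2 x hy)
    · intro x hx
      rcases List.mem_append.mp hx with hx | hx
      · exact List.mem_cons.mpr (Or.inl ((he.2.mem x).mp hx))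
      · exact List.mem_cons_of_mem _ (ih2 x hx)

theorem Presents.nodup_halfEdges {D : VertexData γ.H} (h : γ.Presents D) :
    (halfEdges D).Nodup := by
  obtain ⟨vs, hn, -, h⟩ := h
  exact (nodup_halfEdges_of_forall₂ hn h).1

theorem Presents.halfEdges_length {D : VertexData γ.H} (h : γ.Presents D) :
    (halfEdges D).length = Fintype.card γ.H := by
  rw [← card_subtype_eq_length (q := fun _ => True) h.nodup_halfEdges
    (fun x => iff_of_true (h.mem_halfEdges x) trivial), ← Nat.card_eq_fintype_card]
  exact Nat.card_congr (Equiv.Set.univ _)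

theorem sum_eq_of_forall₂ {M : Type*} [AddCommMonoid M] {f : γ.V → M}
    {φ : ℕ × List (List γ.H) → M} {vs : List γ.V} {D : VertexData γ.H}
    (h : List.Forall₂ γ.IsVertexData vs D)
    (hf : ∀ v e, γ.IsVertexData v e → φ e = f v) : (D.map φ).sum = (vs.map f).sum := by
  induction h with
  | nil => rfl
  | cons he _ ih => rw [List.map_cons, List.map_cons, List.sum_cons, List.sum_cons, ih, hf _ _ he]

theorem Presents.sum_eq {M : Type*} [AddCommMonoid M] {f : γ.V → M}
    {φ : ℕ × List (List γ.H) → M} {D : VertexData γ.H} (h : γ.Presents D)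
    (hf : ∀ v e, γ.IsVertexData v e → φ e = f v) : ∑ v, f v = (D.map φ).sum := by
  classical
  obtain ⟨vs, hn, hm, h⟩ := h
  rw [sum_eq_of_forall₂ h hf, ← List.sum_toFinset _ hn]
  exact Finset.sum_congr (by ext; simp [hm]) fun _ _ => rfl

/-- The surface at a vertex has nonempty boundary and is stable. -/
def IsStableEntry {X : Type} (e : ℕ × List (List X)) : Prop :=
  1 ≤ e.2.length ∧ 2 < 2 * (2 * e.1 + e.2.length - 1) + e.2.flatten.length

/-- The number of circles without half-edges. -/
def holesCount {X : Type} (D : VertexData X) : ℕ := (D.map fun e => e.2.countP List.isEmpty).sum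

/-- The sum of the Euler characteristics of the surfaces at the vertices. -/
def eulerSum {X : Type} (D : VertexData X) : ℤ :=
  (D.map fun e => 2 - 2 * (e.1 : ℤ) - e.2.length).sum

theorem Presents.sum_holes {D : VertexData γ.H} (h : γ.Presents D) :
    ∑ v, γ.holes v = holesCount D := h.sum_eq fun _ _ he => he.2.holes

theorem Presents.twiceEuler_eq {D : VertexData γ.H} (h : γ.Presents D) :
    γ.twiceEuler = 2 * eulerSum D - (halfEdges D).length := by
  rw [twiceEuler, h.halfEdges_length, eulerSum, ← h.sum_eq]
  intro v e he
  rw [he.1, he.2.length_eq]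

theorem Presents.isStable_iff {D : VertexData γ.H} (h : γ.Presents D) :
    γ.IsStable ↔ ∀ e ∈ D, IsStableEntry e := by
  obtain ⟨vs, -, hm, h⟩ := h
  have : γ.IsStable ↔ ∀ v ∈ vs, 1 ≤ γ.boundaryCount v ∧
      2 < 2 * (2 * γ.genus v + γ.boundaryCount v - 1) + γ.valency v :=
    ⟨fun h v _ => h v, fun h v => h v (hm v)⟩
  rw [this]
  clear this hm
  induction h with
  | nil => simp
  | cons he _ ih =>
    rw [List.forall_mem_cons, List.forall_mem_cons]
    refine and_congr ?_ ih
    rw [IsStableEntry, he.1, he.2.length_eq, he.2.flatten_length_eq]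

/-! ## Amplitudes and presentations -/

variable (γ) in
/-- The half-edges of the black edges, edge by edge. -/
def blackOrder : List γ.H := (List.finRange k).flatMap fun i => [γ.black i, γ.inv (γ.black i)]

variable (γ) in
theorem nodup_blackOrder : γ.blackOrder.Nodup := by
  rw [blackOrder, List.nodup_flatMap]
  refine ⟨fun i _ => by simpa using (γ.inv_ne _).symm, ?_⟩
  refine (List.nodup_finRange k).imp ?_
  intro i j hij x hx hy
  simp only [List.mem_cons, List.not_mem_nil, or_false] at hx hy
  rcases hx with rfl | rfl
  · rcases hy with h | h
    · exact hij (γ.black_injective h)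
    · exact γ.black_ne_inv _ _ h
  · rcases hy with h | h
    · exact γ.black_ne_inv _ _ h.symm
    · exact hij (γ.black_injective (γ.inv.injective h))

theorem AllBlack.mem_blackOrder (h : γ.AllBlack) (x : γ.H) : x ∈ γ.blackOrder := by
  obtain ⟨i, hi⟩ := h x
  rw [blackOrder, List.mem_flatMap]
  exact ⟨i, List.mem_finRange i, by simpa using hi⟩

open scoped Classical in
theorem AllBlack.whiteHalves_eq (h : γ.AllBlack) : γ.whiteHalves = [] := by
  rw [whiteHalves, List.map_eq_nil_iff, Finset.toList_eq_nil, Finset.filter_eq_empty_iff]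
  intro q _ hq
  obtain ⟨i, hi⟩ := h q.out
  rcases hi with hi | hi
  · exact (hq i).1 hi
  · exact (hq i).2 hi

open scoped Classical in
theorem whiteHalves_ne_nil (h : ¬ γ.AllBlack) : γ.whiteHalves ≠ [] := by
  simp only [AllBlack, not_forall, not_exists, not_or] at h
  obtain ⟨x, hx⟩ := h
  rw [whiteHalves, Ne, List.map_eq_nil_iff, Finset.toList_eq_nil, ← Ne,
    ← Finset.nonempty_iff_ne_empty]
  refine ⟨Quotient.mk (Equiv.Perm.SameCycle.setoid γ.inv) x, ?_⟩
  rw [Finset.mem_filter]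
  refine ⟨Finset.mem_univ _, fun i => ?_⟩
  set z := (Quotient.mk (Equiv.Perm.SameCycle.setoid γ.inv) x).out with hz
  -- The chosen representative of the edge may be either half; as `inv` is an involution it is `x`
  -- or `inv x`, and neither is black.
  have hs : γ.inv.SameCycle z x := sameCycle_out _ _
  have : x = z ∨ x = γ.inv z := by
    obtain ⟨n, hn⟩ := hs.exists_nat_pow_eq
    have h2 : γ.inv ^ 2 = 1 := by
      ext y; rw [pow_two, Equiv.Perm.mul_apply, γ.inv_inv, Equiv.Perm.one_apply]
    rcases Nat.even_or_odd' n with ⟨m, rfl | rfl⟩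
    · left; rw [← hn, pow_mul, h2, one_pow, Equiv.Perm.one_apply]
    · right; rw [← hn, pow_add, pow_mul, h2, one_pow, one_mul, pow_one]
  rcases this with h | h
  · rw [← h]; exact hx i
  · constructor
    · intro h'
      exact (hx i).2 (by rw [h, h'])
    · intro h'
      exact (hx i).1 (by rw [h, h', γ.inv_inv])

section Amplitude

variable {A : Type*} [NonUnitalRing A] [Module ℝ A] [FiniteDimensional ℝ A] {F : DGFrobenius A}

theorem amplitude_eq_zero (h : ¬ γ.AllBlack) (P : Fin k → A ⊗[ℝ] A) : γ.amplitude F P 0 = 0 := by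
  rw [amplitude]
  refine Finset.sum_eq_zero fun l _ => ?_
  obtain ⟨x, hx⟩ := List.exists_mem_of_ne_nil _ (whiteHalves_ne_nil h)
  have : (γ.whiteHalves.map fun x => F.coef 0 (l x) (l (γ.inv x))).prod = 0 :=
    List.prod_eq_zero (List.mem_map.mpr ⟨x, hx, F.coef_zero _ _⟩)
  rw [this, mul_zero, zero_mul]

variable [IsScalarTower ℝ A A] [SMulCommClass ℝ A A]

open scoped Classical in
/-- The amplitude of a graph with black edges can be computed from any presentation. -/
theorem AllBlack.amplitude_eq (h : γ.AllBlack) {D : VertexData γ.H} (hD : γ.Presents D)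
    (P : Fin k → A ⊗[ℝ] A) (Q : A ⊗[ℝ] A) :
    γ.amplitude F P Q = ∑ l : γ.H → F.Idx,
      koszulSign (labelParity l) γ.blackOrder (halfEdges D) *
        (∏ i, F.coef (P i) (l (γ.black i)) (l (γ.inv (γ.black i)))) * vertexValue l D := by
  rw [amplitude]
  have hE : γ.edgeOrder = γ.blackOrder := by
    rw [edgeOrder, h.whiteHalves_eq, List.append_nil, List.flatMap_map, blackOrder]
  have hp0 : γ.blackOrder.Perm γ.vertexOrder := by
    rw [← halfEdges_standardData]
    exact (List.perm_ext_iff_of_nodup γ.nodup_blackOrder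
      γ.presents_standardData.nodup_halfEdges).mpr fun x =>
        iff_of_true (h.mem_blackOrder x) (γ.presents_standardData.mem_halfEdges x)
  have hp : γ.blackOrder.Perm (halfEdges D) :=
    (List.perm_ext_iff_of_nodup γ.nodup_blackOrder hD.nodup_halfEdges).mpr fun x =>
        iff_of_true (h.mem_blackOrder x) (hD.mem_halfEdges x)
  refine Finset.sum_congr (by congr) fun l _ => ?_
  have hv : ∏ v, F.surface (γ.genus v) ((γ.circleWords v).map (List.map l)) =
      vertexValue l γ.standardData := by
    rw [vertexValue, standardData, List.map_map, ← Finset.prod_map_toList]; rfl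
  rw [hv, vertexValue_equiv l (γ.presents_standardData.dataEquiv hD)
    γ.presents_standardData.nodup_halfEdges, hE, h.whiteHalves_eq, List.map_nil, List.prod_nil,
    mul_one, halfEdges_standardData, ← koszulSign_trans (labelParity l) hp0 hp]
  have : (fun x => (l x).1) = labelParity l := rfl
  rw [this]
  ring

end Amplitude

end BWGraph

/-! ## The propagator -/

namespace HodgeDecomposition

variable {A : Type*} [NonUnitalRing A] [Module ℝ A] [FiniteDimensional ℝ A] {F : DGFrobenius A}
  (h : HodgeDecomposition F)

/-- The tensor `(s ⊗ id)[⟨-,-⟩⁻¹]`. -/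
noncomputable def propagator : A ⊗[ℝ] A := h.s.rTensor A F.invForm

theorem coef_rTensor (φ : A →ₗ[ℝ] A) (i j : F.Idx) :
    F.coef (φ.rTensor A F.invForm) i j =
      ∑ c, F.basis.repr (φ (F.basis c)) i * F.invGram c j := by
  simp only [DGFrobenius.invForm, map_sum, LinearMap.rTensor_tmul, F.coef_sum, F.coef_tmul,
    F.invGram_eq]

/-- The matrix of `s`. -/
noncomputable def sCoef (i c : F.Idx) : ℝ := F.basis.repr (h.s (F.basis c)) i

theorem sCoef_parity {i c : F.Idx} (hs : h.sCoef i c ≠ 0) : i.1 = c.1 + 1 := by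
  by_contra hc
  exact hs (F.repr_eq_zero (h.s_mem (F.basis_mem c)) hc)

theorem coef_propagator (i j : F.Idx) :
    F.coef h.propagator i j = ∑ c, h.sCoef i c * F.invGram c j := coef_rTensor h.s i j

/-- The operator `s` is odd and the inverse inner product even, so an edge carrying the propagator
is an odd block. -/
theorem coef_propagator_parity {i j : F.Idx} (hij : F.coef h.propagator i j ≠ 0) :
    i.1 + j.1 = 1 := by
  rw [coef_propagator] at hij
  obtain ⟨c, -, hc⟩ := Finset.exists_ne_zero_of_sum_ne_zero hij
  rw [h.sCoef_parity (left_ne_zero_of_mul hc), F.invGram_parity (right_ne_zero_of_mul hc)]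
  have key : ∀ p : ZMod 2, p + 1 + p = 1 := by decide
  exact key _

/-- The sign in the adjointness of `s` cancels the sign in the graded symmetry of the inverse inner
product; hence the choice of a first half of an edge is irrelevant. -/
theorem coef_propagator_symm (i j : F.Idx) :
    F.coef h.propagator i j = F.coef h.propagator j i := by
  suffices hT : (Matrix.of fun i j => F.coef h.propagator i j : Matrix F.Idx F.Idx ℝ) =
      Matrix.of fun i j => F.coef h.propagator j i from congrFun (congrFun hT i) j
  apply F.eq_of_mul_gram
  ext i k
  simp only [Matrix.mul_apply, Matrix.of_apply, coef_propagator, Finset.sum_mul]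
  trans h.sCoef i k
  · rw [Finset.sum_comm]
    have : ∀ c, ∑ j, h.sCoef i c * F.invGram c j * F.gram j k =
        (F.invGram * F.gram) c k * h.sCoef i c := by
      intro c
      rw [Matrix.mul_apply, Finset.sum_mul]
      exact Finset.sum_congr rfl fun j _ => by ring
    simp [this, F.invGram_mul_gram, Matrix.one_apply]
  · rw [Finset.sum_comm]
    have : ∀ c, ∑ j, h.sCoef j c * F.invGram c i * F.gram j k =
        F.invGram i c * F.form (F.basis c) (h.s (F.basis k)) := by
      intro c
      have h1 : ∑ j, h.sCoef j c * F.gram j k = F.form (h.s (F.basis c)) (F.basis k) :=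
        (F.map_eq_sum (F.form.flip (F.basis k)) _).symm
      have h2 : ∑ j, h.sCoef j c * F.invGram c i * F.gram j k =
          F.invGram c i * ∑ j, h.sCoef j c * F.gram j k := by
        rw [Finset.mul_sum]
        exact Finset.sum_congr rfl fun j _ => by ring
      rw [h2, h1, h.form_s _ (F.basis_mem c), F.invGram_symm i c]
      by_cases hc : F.invGram c i = 0
      · simp [hc]
      · rw [F.invGram_parity hc]; ring
    rw [Finset.sum_congr rfl fun c _ => this c, F.sum_invGram_form]
    rfl

/-- The differential of the propagator is the inverse inner product if the algebra is contractible. -/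
theorem dCoef_propagator (hπ : h.π = 0) (i j : F.Idx) :
    ∑ c, F.dCoef i c * F.coef h.propagator c j +
      sgn i.1 * ∑ c, F.dCoef j c * F.coef h.propagator i c = F.invGram i j := by
  have h1 : ∑ c, F.dCoef i c * F.coef h.propagator c j =
      ∑ e, F.basis.repr (F.d (h.s (F.basis e))) i * F.invGram e j := by
    simp only [coef_propagator, Finset.mul_sum]
    rw [Finset.sum_comm]
    refine Finset.sum_congr rfl fun e _ => ?_
    have : F.basis.repr (F.d (h.s (F.basis e))) i = ∑ c, h.sCoef c e * F.dCoef i c :=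
      F.map_eq_sum (F.basis.coord i ∘ₗ F.d) _
    rw [this, Finset.sum_mul]
    exact Finset.sum_congr rfl fun c _ => by ring
  -- Closedness of the inverse inner product moves `d` from the second factor to the first; passing
  -- the odd operator `s` compensates the sign, leaving `s d`. With the `d s` of `h1` this is the
  -- homotopy formula, where `π = 0`.
  have h2 : sgn i.1 * ∑ c, F.dCoef j c * F.coef h.propagator i c =
      ∑ e, F.basis.repr (h.s (F.d (F.basis e))) i * F.invGram e j := by
    trans ∑ e, h.sCoef i e * ∑ c, F.dCoef e c * F.invGram c j
    · simp only [coef_propagator, Finset.mul_sum]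
      rw [Finset.sum_comm]
      refine Finset.sum_congr rfl fun e _ => ?_
      by_cases he : h.sCoef i e = 0
      · simp [he]
      have h3 := F.sum_dCoef_invGram e j
      have h4 : ∑ c, h.sCoef i e * (F.dCoef e c * F.invGram c j) =
          h.sCoef i e * ∑ c, F.dCoef e c * F.invGram c j := by rw [Finset.mul_sum]
      have h5 : ∑ c, sgn i.1 * (F.dCoef j c * (h.sCoef i e * F.invGram e c)) =
          sgn i.1 * h.sCoef i e * ∑ c, F.dCoef j c * F.invGram e c := by
        rw [Finset.mul_sum]
        exact Finset.sum_congr rfl fun c _ => by ring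
      rw [h4, h5, h.sCoef_parity he, sgn_add, sgn_one]
      linear_combination -(h.sCoef i e) * h3
    · simp only [Finset.mul_sum]
      rw [Finset.sum_comm]
      refine Finset.sum_congr rfl fun e _ => ?_
      have : F.basis.repr (h.s (F.d (F.basis e))) i = ∑ c, F.dCoef c e * h.sCoef i c :=
        F.map_eq_sum (F.basis.coord i ∘ₗ h.s) _
      rw [this, Finset.sum_mul]
      exact Finset.sum_congr rfl fun c _ => by ring
  rw [h1, h2, ← Finset.sum_add_distrib]
  have h3 : ∀ e, F.basis.repr (F.d (h.s (F.basis e))) i * F.invGram e j +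
      F.basis.repr (h.s (F.d (F.basis e))) i * F.invGram e j =
      F.basis.repr (F.basis e) i * F.invGram e j := by
    intro e
    have := congrArg (fun z => F.basis.repr z i) (h.homotopy (F.basis e))
    simp only [hπ, LinearMap.zero_apply, sub_zero, map_add, Finsupp.add_apply] at this
    rw [← add_mul, this]
  rw [Finset.sum_congr rfl fun e _ => h3 e]
  classical
  simp [Finsupp.single_apply]

end HodgeDecomposition

namespace BWGraph

/-! ## Koszul signs of blocks -/

section Koszul

variable {X : Type} [Fintype X] (p : X → ZMod 2)

theorem koszulSign_block {B L M₁ M₂ : List X} (hL : (B ++ L).Nodup) (h : L.Perm (M₁ ++ M₂)) :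
    koszulSign p (B ++ L) (M₁ ++ (B ++ M₂)) =
      sgn (totalParity p B * totalParity p M₁) * koszulSign p L (M₁ ++ M₂) := by
  have h1 : (B ++ L).Perm (B ++ (M₁ ++ M₂)) := h.append_left B
  have h2 : (B ++ (M₁ ++ M₂)).Perm (M₁ ++ (B ++ M₂)) := by
    simpa using (List.perm_append_comm (l₁ := B) (l₂ := M₁)).append_right M₂
  have h3 := koszulSign_exchange p (K := []) (L := B) (M := M₁) (N := M₂)
    (h1.nodup_iff.mp hL)
  simp only [List.nil_append] at h3
  rw [← koszulSign_trans p h1 (h1.trans h2), h3,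
    koszulSign_append p hL (List.Perm.refl B) h, koszulSign_self p (List.nodup_append.mp hL).1]
  ring

/-- A block of total parity 1 moves past other such blocks like a single odd factor. -/
theorem koszulSign_odd_blocks {ι : Type} [Fintype ι] (b : ι → List X) {I J : List ι}
    (hn : (I.flatMap b).Nodup) (hI : I.Nodup) (hIJ : I.Perm J)
    (hb : ∀ i ∈ I, totalParity p (b i) = 1) :
    koszulSign p (I.flatMap b) (J.flatMap b) = koszulSign (fun _ => 1) I J := by
  induction I generalizing J with
  | nil => rw [List.nil_perm.mp hIJ, List.flatMap_nil, koszulSign_nil, koszulSign_nil]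
  | cons i I ih =>
    have hi : i ∈ J := hIJ.mem_iff.mp (by simp)
    obtain ⟨J₁, J₂, rfl⟩ := List.append_of_mem hi
    have h1 : I.Perm (J₁ ++ J₂) := (hIJ.trans List.perm_middle).cons_inv
    rw [List.flatMap_cons] at hn
    rw [koszulSign_cons _ hI hIJ, List.flatMap_cons, List.flatMap_append, List.flatMap_cons,
      koszulSign_block p hn (by rw [← List.flatMap_append]; exact h1.flatMap_right b),
      ← List.flatMap_append, ih (List.nodup_append.mp hn).2.1 (List.nodup_cons.mp hI).2 h1
        (fun j hj => hb j (by simp [hj])), hb i (by simp)]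
    have h2 : ∀ j ∈ J₁, totalParity p (b j) = 1 := fun j hj => hb j (by
      rw [List.mem_cons, h1.mem_iff]; simp [hj])
    congr 3
    clear hIJ hi h1
    induction J₁ with
    | nil => rfl
    | cons j J₁ ih' =>
      rw [List.flatMap_cons, totalParity_append, totalParity_cons, h2 j (by simp),
        ih' (fun j' hj' => h2 j' (by simp [hj']))]

theorem koszulSign_flatMap_eq_one {ι : Type} (b b' : ι → List X) {I : List ι}
    (hn : (I.flatMap b).Nodup) (hp : ∀ i ∈ I, (b i).Perm (b' i))
    (hb : ∀ i ∈ I, koszulSign p (b i) (b' i) = 1) :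
    koszulSign p (I.flatMap b) (I.flatMap b') = 1 := by
  induction I with
  | nil => exact koszulSign_nil p
  | cons i I ih =>
    rw [List.flatMap_cons] at hn
    have h1 : (I.flatMap b).Perm (I.flatMap b') := by
      clear ih hn hb
      induction I with
      | nil => exact List.Perm.refl _
      | cons j I ih' =>
        rw [List.flatMap_cons, List.flatMap_cons]
        exact (hp j (by simp)).append (ih' fun i' hi' => hp i' (by
          rcases List.mem_cons.mp hi' with h | h <;> simp [h]))
    rw [List.flatMap_cons, List.flatMap_cons, koszulSign_append p hn (hp i (by simp)) h1,
      hb i (by simp), one_mul, ih (List.nodup_append.mp hn).2.1 (fun j hj => hp j (by simp [hj]))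
      (fun j hj => hb j (by simp [hj]))]

/-- For odd factors the Koszul sign counts inversions. The position of `i` in the permuted list is
`σ.symm i`, so the inversions found are those of the inverse, which has the same sign. -/
theorem koszulSign_perm {k : ℕ} (σ : Equiv.Perm (Fin k)) :
    koszulSign (fun _ => 1) (List.finRange k) ((List.finRange k).map σ) =
      ((Equiv.Perm.sign σ : ℤ) : ℝ) := by
  have h1 : ∀ (_ : DecidableEq (Fin k)) (i : Fin k), (List.finRange k).idxOf i = (i : ℕ) :=
      fun _ i => by
    have := (List.nodup_finRange k).idxOf_getElem (i : ℕ) (by simp)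
    simpa using this
  have h2 : ∀ (_ : DecidableEq (Fin k)) (i : Fin k),
      ((List.finRange k).map σ).idxOf i = (σ.symm i : ℕ) := fun _ i => by
    have := ((List.nodup_finRange k).map σ.injective).idxOf_getElem (σ.symm i : ℕ) (by simp)
    simpa using this
  rw [← Equiv.Perm.sign_symm σ, Equiv.Perm.sign_eq_prod_prod_Ioi, koszulSign]
  push_cast
  refine Finset.prod_congr rfl fun x _ => ?_
  rw [← Finset.prod_filter_mul_prod_filter_not Finset.univ (fun y => x < y)]
  have h3 : Finset.univ.filter (fun y => x < y) = Finset.Ioi x := by ext; simp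
  rw [h3, Finset.prod_eq_one (s := Finset.univ.filter fun y => ¬ x < y), mul_one]
  · refine Finset.prod_congr rfl fun y hy => ?_
    have hxy : x < y := Finset.mem_Ioi.mp hy
    have hne : σ.symm x ≠ σ.symm y := fun h => hxy.ne (σ.symm.injective h)
    simp only [h1, h2, Fin.val_fin_lt, hxy, true_and, mul_one, sgn_one]
    rcases lt_or_gt_of_ne hne with h | h
    · rw [if_neg h.not_gt, if_pos h]; simp
    · rw [if_pos h, if_neg h.not_gt]; simp
  · intro y hy
    rw [if_neg]
    simp only [h1, h2, Fin.val_fin_lt]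
    exact fun h => (Finset.mem_filter.mp hy).2 h.1

end Koszul

/-! ## Isomorphisms -/

theorem IsCyc.map {X Y : Type} {f : X → X} {f' : Y → Y} {φ : X → Y}
    (h : ∀ x, f' (φ x) = φ (f x)) {w : List X} (hw : IsCyc f w) : IsCyc f' (w.map φ) := by
  cases w with
  | nil => trivial
  | cons x u =>
    change List.IsChain _ (φ x :: (u.map φ ++ [φ x]))
    have h1 : φ x :: (u.map φ ++ [φ x]) = (x :: (u ++ [x])).map φ := by simp
    rw [h1, List.isChain_map]
    exact List.IsChain.imp (fun a b hab => by rw [h, hab]) hw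

/-- Renaming the half-edges. -/
def mapData {X Y : Type} (φ : X → Y) (D : VertexData X) : VertexData Y :=
  D.map fun e => (e.1, e.2.map (List.map φ))

theorem halfEdges_mapData {X Y : Type} (φ : X → Y) (D : VertexData X) :
    halfEdges (mapData φ D) = (halfEdges D).map φ := by
  simp [halfEdges, mapData, List.flatMap_map, List.map_flatMap, List.map_flatten]

theorem countP_isEmpty_map {X Y : Type} (φ : X → Y) (ws : List (List X)) :
    (ws.map (List.map φ)).countP List.isEmpty = ws.countP List.isEmpty := by
  rw [List.countP_map]
  congr 1
  funext w
  simp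

theorem holesCount_mapData {X Y : Type} (φ : X → Y) (D : VertexData X) :
    holesCount (mapData φ D) = holesCount D := by
  rw [holesCount, holesCount, mapData, List.map_map]
  congr 2
  funext e
  exact countP_isEmpty_map φ e.2

theorem eulerSum_mapData {X Y : Type} (φ : X → Y) (D : VertexData X) :
    eulerSum (mapData φ D) = eulerSum D := by
  rw [eulerSum, eulerSum, mapData, List.map_map]
  congr 2
  funext e
  simp

theorem isStableEntry_mapData {X Y : Type} (φ : X → Y) (D : VertexData X) :
    (∀ e ∈ mapData φ D, IsStableEntry e) ↔ ∀ e ∈ D, IsStableEntry e := by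
  simp only [mapData, List.forall_mem_map, IsStableEntry, ← List.map_flatten, List.length_map]

theorem vertexValue_mapData {A : Type*} [NonUnitalRing A] [Module ℝ A] [FiniteDimensional ℝ A]
    {F : DGFrobenius A} {X Y : Type} (φ : X → Y) (l : Y → F.Idx) (D : VertexData X) :
    vertexValue l (mapData φ D) = vertexValue (l ∘ φ) D := by
  simp only [vertexValue, mapData, List.map_map]
  congr 2
  funext e
  simp

namespace Iso

variable {k : ℕ} {γ γ' : BWGraph k} (φ : Iso γ γ')

theorem presents {D : VertexData γ.H} (h : γ.Presents D) : γ'.Presents (mapData φ.onH D) := by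
  obtain ⟨vs, hn, hm, h⟩ := h
  refine ⟨vs.map φ.onV, hn.map φ.onV.injective,
    fun v => List.mem_map.mpr ⟨φ.onV.symm v, hm _, by simp⟩, ?_⟩
  rw [mapData, List.forall₂_map_left_iff, List.forall₂_map_right_iff]
  refine h.imp fun v e he => ⟨?_, ?_, ?_, ?_, ?_⟩
  · rw [φ.genus_eq]; exact he.1
  · change ((e.2.map (List.map φ.onH)).flatten).Nodup
    rw [← List.map_flatten]
    exact he.2.nodup.map φ.onH.injective
  · intro x
    change x ∈ ((e.2.map (List.map φ.onH)).flatten) ↔ _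
    rw [← List.map_flatten, List.mem_map]
    constructor
    · rintro ⟨y, hy, rfl⟩
      rw [φ.vert_eq, (he.2.mem y).mp hy]
    · intro hx
      refine ⟨φ.onH.symm x, (he.2.mem _).mpr (φ.onV.injective ?_), by simp⟩
      rw [← φ.vert_eq, ← hx]; simp
  · simp only [List.forall_mem_map]
    exact fun w hw => (he.2.cyc w hw).map φ.next_eq
  · rw [φ.holes_eq, ← he.2.holes]
    exact countP_isEmpty_map _ _

theorem isCycleDecomposition_map {X Y : Type} {f : X → X} {f' : Y → Y} {φ : X ≃ Y}
    (h : ∀ x, f' (φ x) = φ (f x)) {ws : List (List X)} (hw : IsCycleDecomposition f ws) :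
    IsCycleDecomposition f' (ws.map (List.map φ)) where
  nodup := by rw [← List.map_flatten]; exact hw.nodup.map φ.injective
  mem y := by
    rw [← List.map_flatten, List.mem_map]
    exact ⟨φ.symm y, hw.mem _, by simp⟩
  cyc := by
    simp only [List.forall_mem_map]
    exact fun w hm => (hw.cyc w hm).map h
  ne_nil := by
    simp only [List.forall_mem_map]
    exact fun w hm => by simpa using hw.ne_nil w hm

theorem isOfType (φ : Iso γ γ') {g n : ℕ} (h : γ.IsOfType g n) : γ'.IsOfType g n := by
  obtain ⟨⟨⟨v₀⟩, hc⟩, hs, hb, he⟩ := h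
  have hD := γ.presents_standardData
  have hD' := φ.presents hD
  refine ⟨⟨⟨φ.onV v₀⟩, ?_⟩, ?_, ?_, ?_⟩
  · intro v w
    have := hc (φ.onV.symm v) (φ.onV.symm w)
    have h2 := Relation.ReflTransGen.lift (p := fun v w =>
      ∃ x, γ'.vert x = v ∧ γ'.vert (γ'.inv x) = w) φ.onV (fun a b => by
        rintro ⟨x, rfl, rfl⟩
        exact ⟨φ.onH x, φ.vert_eq x, by rw [φ.inv_eq, φ.vert_eq]⟩) _ _ this
    simpa [Function.onFun] using h2
  · rw [hD'.isStable_iff, isStableEntry_mapData, ← hD.isStable_iff]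
    exact hs
  · rw [← hb, totalBoundary, totalBoundary, hD.sum_holes, hD'.sum_holes, holesCount_mapData]
    have h1 := isCycleDecomposition_cycleWord (γ.next * γ.inv)
    have h2 : IsCycleDecomposition (γ'.next * γ'.inv) _ := isCycleDecomposition_map (φ := φ.onH)
      (f' := ⇑(γ'.next * γ'.inv))
      (fun x => by
        rw [Equiv.Perm.mul_apply, Equiv.Perm.mul_apply, φ.inv_eq, φ.next_eq]) h1
    rw [h1.card_orbits, h2.card_orbits, List.length_map]
  · rw [← he, hD.twiceEuler_eq, hD'.twiceEuler_eq, eulerSum_mapData, halfEdges_mapData,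
      List.length_map]

/-- The inverse isomorphism. -/
def symm : Iso γ' γ where
  onH := φ.onH.symm
  onV := φ.onV.symm
  vert_eq x := by
    apply φ.onV.injective
    rw [← φ.vert_eq]; simp
  inv_eq x := by
    apply φ.onH.injective
    rw [← φ.inv_eq]; simp
  next_eq x := by
    apply φ.onH.injective
    rw [← φ.next_eq]; simp
  genus_eq v := by rw [← φ.genus_eq]; simp
  holes_eq v := by rw [← φ.holes_eq]; simp
  perm := φ.perm.symm
  black_eq i := by
    rcases φ.black_eq (φ.perm.symm i) with h | h
    · left
      apply φ.onH.injective
      rw [h]; simp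
    · right
      apply φ.onH.injective
      rw [← φ.inv_eq, h, γ'.inv_inv]; simp

theorem isOfType_iff (φ : Iso γ γ') {g n : ℕ} : γ.IsOfType g n ↔ γ'.IsOfType g n :=
  ⟨φ.isOfType, φ.symm.isOfType⟩

theorem allBlack (φ : Iso γ γ') (h : γ.AllBlack) : γ'.AllBlack := by
  intro x
  obtain ⟨i, hi⟩ := h (φ.onH.symm x)
  refine ⟨φ.perm i, ?_⟩
  have hx : x = φ.onH (φ.onH.symm x) := by simp
  rcases hi with hi | hi
  · rw [hi] at hx
    rw [hx]
    exact φ.black_eq i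
  · rw [hi, ← φ.inv_eq] at hx
    rw [hx]
    rcases φ.black_eq i with h | h
    · right; rw [h]
    · left; rw [h, γ'.inv_inv]

theorem allBlack_iff (φ : Iso γ γ') : γ.AllBlack ↔ γ'.AllBlack := ⟨φ.allBlack, φ.symm.allBlack⟩

variable {A : Type*} [NonUnitalRing A] [Module ℝ A] [FiniteDimensional ℝ A] {F : DGFrobenius A}
  [IsScalarTower ℝ A A] [SMulCommClass ℝ A A]

/-- The sign comes from the order of the edges alone: they are odd blocks, so it is the sign of the
permutation, while reversing an edge neither changes the coefficient of the propagator nor costs a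
Koszul sign. Graphs with a white edge give zero on both sides. -/
theorem amplitude_eq (h : HodgeDecomposition F) :
    γ'.amplitude F (fun _ => h.propagator) 0 =
      ((Equiv.Perm.sign φ.perm : ℤ) : ℝ) * γ.amplitude F (fun _ => h.propagator) 0 := by
  classical
  by_cases hγ : γ.AllBlack
  swap
  · rw [amplitude_eq_zero hγ, amplitude_eq_zero (mt φ.allBlack_iff.mpr hγ), mul_zero]
  have hγ' := φ.allBlack hγ
  have hD := γ.presents_standardData
  have hD' := φ.presents hD
  rw [hγ.amplitude_eq hD, hγ'.amplitude_eq hD', Finset.mul_sum]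
  refine Fintype.sum_equiv (φ.onH.arrowCongr (Equiv.refl _)).symm _ _ fun l => ?_
  have hl : (φ.onH.arrowCongr (Equiv.refl F.Idx)).symm l = l ∘ φ.onH := rfl
  rw [hl, vertexValue_mapData]
  have hprod : ∏ i, F.coef h.propagator (l (γ'.black i)) (l (γ'.inv (γ'.black i))) =
      ∏ i, F.coef h.propagator ((l ∘ φ.onH) (γ.black i)) ((l ∘ φ.onH) (γ.inv (γ.black i))) := by
    rw [← Equiv.prod_comp φ.perm]
    refine Finset.prod_congr rfl fun i _ => ?_
    simp only [Function.comp_apply, ← φ.inv_eq]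
    rcases φ.black_eq i with hb | hb
    · rw [hb]
    · rw [hb, γ'.inv_inv, h.coef_propagator_symm]
  rw [hprod]
  by_cases h0 : ∏ i, F.coef h.propagator ((l ∘ φ.onH) (γ.black i))
      ((l ∘ φ.onH) (γ.inv (γ.black i))) = 0
  · rw [h0]; ring
  have hodd : ∀ i, labelParity l (φ.onH (γ.black i)) +
      labelParity l (φ.onH (γ.inv (γ.black i))) = 1 := fun i =>
    h.coef_propagator_parity (Finset.prod_ne_zero_iff.mp h0 i (Finset.mem_univ _))
  have hE : γ'.blackOrder.Perm (γ.blackOrder.map φ.onH) :=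
    (List.perm_ext_iff_of_nodup γ'.nodup_blackOrder
      (γ.nodup_blackOrder.map φ.onH.injective)).mpr fun x =>
      iff_of_true (hγ'.mem_blackOrder x)
        (List.mem_map.mpr ⟨φ.onH.symm x, hγ.mem_blackOrder _, by simp⟩)
  have hED : γ.blackOrder.Perm (halfEdges γ.standardData) :=
    (List.perm_ext_iff_of_nodup γ.nodup_blackOrder hD.nodup_halfEdges).mpr fun x =>
      iff_of_true (hγ.mem_blackOrder x) (hD.mem_halfEdges x)
  have hsign : koszulSign (labelParity l) γ'.blackOrder (halfEdges (mapData φ.onH γ.standardData)) =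
      ((Equiv.Perm.sign φ.perm : ℤ) : ℝ) *
        koszulSign (labelParity (l ∘ φ.onH)) γ.blackOrder (halfEdges γ.standardData) := by
    rw [halfEdges_mapData, ← koszulSign_trans _ hE (hE.trans (hED.map _)),
      koszulSign_map (labelParity l) (labelParity (l ∘ φ.onH)) φ.onH φ.onH.injective
        (fun _ => rfl) γ.nodup_blackOrder hED]
    congr 1
    let b' : Fin k → List γ'.H := fun i => [γ'.black i, γ'.inv (γ'.black i)]
    let b : Fin k → List γ'.H := fun i => [φ.onH (γ.black i), φ.onH (γ.inv (γ.black i))]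
    have e1 : γ'.blackOrder = (List.finRange k).flatMap b' := rfl
    have e2 : γ.blackOrder.map φ.onH = (List.finRange k).flatMap b := by
      rw [blackOrder, List.map_flatMap]; rfl
    have hpair : ∀ i, b i = b' (φ.perm i) ∨ b i = (b' (φ.perm i)).reverse := by
      intro i
      simp only [b, b', ← φ.inv_eq]
      rcases φ.black_eq i with hb | hb
      · left; rw [hb]
      · right; rw [hb, γ'.inv_inv]; rfl
    have hperm : ∀ i, (b' (φ.perm i)).Perm (b i) := fun i => by
      rcases hpair i with hb | hb <;> rw [hb]
      exact (List.reverse_perm _).symm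
    have hpb : ∀ i, totalParity (labelParity l) (b i) = 1 := fun i => by
      rw [← hodd i]; simp [b, totalParity]
    have hpb' : ∀ i, totalParity (labelParity l) (b' i) = 1 := fun i => by
      have := totalParity_perm (labelParity l) (hperm (φ.perm.symm i))
      rw [Equiv.apply_symm_apply] at this
      rw [this, hpb]
    have e3 : ((List.finRange k).map φ.perm).flatMap b' =
        (List.finRange k).flatMap fun i => b' (φ.perm i) := by rw [List.flatMap_map]
    have p1 : (List.finRange k).Perm ((List.finRange k).map φ.perm) :=
      (List.perm_ext_iff_of_nodup (List.nodup_finRange k)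
        ((List.nodup_finRange k).map φ.perm.injective)).mpr fun x =>
        iff_of_true (List.mem_finRange x)
          (List.mem_map.mpr ⟨φ.perm.symm x, List.mem_finRange _, by simp⟩)
    have p2 := p1.flatMap_right b'
    have n1 : ((List.finRange k).flatMap b').Nodup := γ'.nodup_blackOrder
    rw [← koszulSign_perm, ← koszulSign_odd_blocks (labelParity l) b' n1 (List.nodup_finRange k) p1
      (fun i _ => hpb' i), e1, e2, ← koszulSign_trans _ p2 (e2 ▸ e1 ▸ hE), e3,
      koszulSign_flatMap_eq_one (labelParity l) (fun i => b' (φ.perm i)) b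
        (e3 ▸ p2.nodup_iff.mp n1) (fun i _ => hperm i), mul_one]
    intro i _
    have hni : (b' (φ.perm i)).Nodup := by simpa [b'] using (γ'.inv_ne _).symm
    rcases hpair i with hb | hb
    · rw [hb, koszulSign_self _ hni]
    · have hsw := koszulSign_swap (labelParity l) (L := [γ'.black (φ.perm i)])
        (M := [γ'.inv (γ'.black (φ.perm i))]) hni
      have hb2 : b i = [γ'.inv (γ'.black (φ.perm i))] ++ [γ'.black (φ.perm i)] := hb
      rw [hb2]
      refine hsw.trans ?_
      have h1 := hpb' (φ.perm i)
      simp only [b', totalParity, List.map_cons, List.map_nil, List.sum_cons, List.sum_nil,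
        add_zero] at h1 ⊢
      -- Exactly one half of the edge carries an odd label, so its two halves commute.
      have key : ∀ p q : ZMod 2, p + q = 1 → p * q = 0 := by decide
      rw [key _ _ h1, sgn_zero]
  rw [hsign]
  ring

end Iso

end BWGraph

namespace BWGraph

/-! ## Cycles after gluing a strip -/

section Cycles

variable {X : Type}

theorem isChain_congr {f f' : X → X} {w : List X} (h : List.IsChain (fun a b => f a = b) w)
    (hf : ∀ z ∈ w, f z ∈ w → f' z = f z) : List.IsChain (fun a b => f' a = b) w := by
  induction w with
  | nil => exact List.isChain_nil
  | cons a w ih =>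
    cases w with
    | nil => exact List.isChain_singleton _
    | cons b w =>
      rw [List.isChain_cons_cons] at h ⊢
      exact ⟨by rw [hf a (by simp) (by rw [h.1]; simp), h.1],
        ih h.2 fun z hz hz' => hf z (List.mem_cons_of_mem _ hz) (List.mem_cons_of_mem _ hz')⟩

theorem IsCyc.congr {f f' : X → X} {w : List X} (h : IsCyc f w)
    (hf : ∀ z ∈ w, f z ∈ w → f' z = f z) : IsCyc f' w := by
  cases w with
  | nil => trivial
  | cons x u =>
    have hm : ∀ z, z ∈ x :: (u ++ [x]) ↔ z ∈ x :: u := fun z => by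
      simp only [List.mem_cons, List.mem_append, List.not_mem_nil, or_false]; tauto
    exact isChain_congr h fun z hz hz' => hf z ((hm z).mp hz) ((hm _).mp hz')

theorem isChain_replace_head {f f' : X → X} {a a' e : X} {v : List X}
    (h : List.IsChain (fun a b => f a = b) (a :: (v ++ [e]))) (ha : f' a' = f a)
    (hf : ∀ z ∈ v, f' z = f z) : List.IsChain (fun a b => f' a = b) (a' :: (v ++ [e])) := by
  induction v generalizing a a' with
  | nil =>
    rw [List.nil_append, List.isChain_cons_cons] at h ⊢
    exact ⟨ha.trans h.1, List.isChain_singleton _⟩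
  | cons b v ih =>
    rw [List.cons_append, List.isChain_cons_cons] at h ⊢
    exact ⟨ha.trans h.1, ih h.2 (hf b (by simp)) fun z hz => hf z (List.mem_cons_of_mem _ hz)⟩

theorem isChain_append_cons {f : X → X} {a b c : X} {u v : List X} :
    List.IsChain (fun a b => f a = b) (a :: (v ++ b :: (u ++ [c]))) ↔
      List.IsChain (fun a b => f a = b) (a :: (v ++ [b])) ∧
        List.IsChain (fun a b => f a = b) (b :: (u ++ [c])) :=
  List.isChain_split (l₁ := a :: v)

theorem isCyc_bypass {f : Equiv.Perm X} {x : X} {u : List X} (h : IsCyc f (x :: u))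
    (hx : x ∉ u) : IsCyc (bypass f x) u := by
  classical
  cases u with
  | nil => trivial
  | cons c u =>
    have h1 : List.IsChain (fun a b => f a = b) (x :: c :: (u ++ [x])) := h
    rw [List.isChain_cons_cons] at h1
    obtain ⟨hc, h1⟩ := h1
    have hfx : ∀ z, z ≠ x → f z ≠ x → bypass f x z = f z := fun z hz hz' => by
      rw [bypass, Equiv.Perm.mul_apply]
      refine Equiv.swap_apply_of_ne_of_ne hz' (fun h => hz (f.injective h))
    have hfx' : ∀ z, f z = x → bypass f x z = f x := fun z hz => by
      simp [bypass, hz]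
    change List.IsChain _ (c :: (u ++ [c]))
    have key : ∀ d, d ≠ x → List.IsChain (fun a b => f a = b) (d :: (u ++ [x])) →
        List.IsChain (fun a b => bypass f x a = b) (d :: (u ++ [c])) := by
      have hxu : x ∉ u := fun h => hx (by simp [h])
      clear h1 h hx
      induction u with
      | nil =>
        intro d _ h
        rw [List.nil_append, List.isChain_cons_cons] at h ⊢
        exact ⟨(hfx' d h.1).trans hc, List.isChain_singleton _⟩
      | cons e u ih =>
        intro d hd h
        rw [List.cons_append, List.isChain_cons_cons] at h ⊢
        have hex : e ≠ x := fun h => hxu (by simp [h])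
        exact ⟨(hfx d hd (by rw [h.1]; exact hex)).trans h.1,
          ih (fun h => hxu (by simp [h])) e hex h.2⟩
    exact key c (fun h => hx (by simp [h])) h1

theorem isCyc_bypass_of_notMem {f : Equiv.Perm X} {x : X} {w : List X} (h : IsCyc f w)
    (hx : x ∉ w) : IsCyc (bypass f x) w := by
  classical
  refine h.congr fun z hz hz' => ?_
  have h1 : f z ≠ x := fun h => hx (h ▸ hz')
  have h2 : f z ≠ f x := fun h => hx (f.injective h ▸ hz)
  rw [bypass, Equiv.Perm.mul_apply]
  exact Equiv.swap_apply_of_ne_of_ne h1 h2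

section Swap

open scoped Classical

variable {f : Equiv.Perm X} {x y : X} {u v : List X}

theorem mul_swap_apply_of_notMem {w : List X} (hx : x ∉ w) (hy : y ∉ w) :
    ∀ z ∈ w, (f * Equiv.swap x y) z = f z := fun z hz => by
  have h1 : z ≠ x := fun h => hx (h ▸ hz)
  have h2 : z ≠ y := fun h => hy (h ▸ hz)
  rw [Equiv.Perm.mul_apply, Equiv.swap_apply_of_ne_of_ne h1 h2]

/-- Multiplying by a transposition joins the cycles of its two points if they differ and splits the
cycle if they agree (`isCyc_mul_swap_split`): the combinatorial form of gluing a strip. -/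
theorem isCyc_mul_swap_join (hx : IsCyc f (x :: u)) (hy : IsCyc f (y :: v))
    (hn : (x :: (v ++ y :: u)).Nodup) : IsCyc (f * Equiv.swap x y) (x :: (v ++ y :: u)) := by
  simp only [List.nodup_cons, List.nodup_append, List.mem_append, List.mem_cons, not_or] at hn
  obtain ⟨⟨hxv, hxy, hxu⟩, -, ⟨hyu, -⟩, hd⟩ := hn
  have hyv : y ∉ v := fun h => hd y h y (by simp) rfl
  change List.IsChain _ (x :: (v ++ y :: u ++ [x]))
  rw [List.append_assoc, List.cons_append, isChain_append_cons]
  exact ⟨isChain_replace_head hy (by simp) (mul_swap_apply_of_notMem hxv hyv),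
    isChain_replace_head hx (by simp) (mul_swap_apply_of_notMem hxu hyu)⟩

theorem isCyc_mul_swap_split (h : IsCyc f (x :: (v ++ y :: u)))
    (hn : (x :: (v ++ y :: u)).Nodup) :
    IsCyc (f * Equiv.swap x y) (x :: u) ∧ IsCyc (f * Equiv.swap x y) (y :: v) := by
  simp only [List.nodup_cons, List.nodup_append, List.mem_append, List.mem_cons, not_or] at hn
  obtain ⟨⟨hxv, hxy, hxu⟩, -, ⟨hyu, -⟩, hd⟩ := hn
  have hyv : y ∉ v := fun h => hd y h y (by simp) rfl
  change List.IsChain _ (x :: (v ++ y :: u ++ [x])) at h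
  rw [List.append_assoc, List.cons_append, isChain_append_cons] at h
  exact ⟨isChain_replace_head h.2 (by simp) (mul_swap_apply_of_notMem hxu hyu),
    isChain_replace_head h.1 (by simp) (mul_swap_apply_of_notMem hxv hyv)⟩

end Swap

variable {f : Equiv.Perm X} {x y : X} {u v : List X}

theorem isCyc_bypass_bypass_same (h : IsCyc f (x :: (v ++ y :: u)))
    (hn : (x :: (v ++ y :: u)).Nodup) : IsCyc (bypass (bypass f x) y) (u ++ v) := by
  obtain ⟨h1, h2⟩ := List.nodup_cons.mp hn
  have h3 : IsCyc (bypass f x) (y :: (u ++ v)) := isCyc_rotate v (y :: u) (isCyc_bypass h h1)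
  have h4 : (y :: (u ++ v)).Nodup := (List.perm_append_comm (l₁ := v) (l₂ := y :: u)).nodup_iff.mp h2
  exact isCyc_bypass h3 (List.nodup_cons.mp h4).1

theorem isCyc_bypass_bypass_ne (hx : IsCyc f (x :: u)) (hy : IsCyc f (y :: v))
    (hn : (x :: (v ++ y :: u)).Nodup) :
    IsCyc (bypass (bypass f x) y) u ∧ IsCyc (bypass (bypass f x) y) v := by
  simp only [List.nodup_cons, List.nodup_append, List.mem_append, List.mem_cons, not_or] at hn
  obtain ⟨⟨hxv, hxy, hxu⟩, -, ⟨hyu, -⟩, hd⟩ := hn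
  have hyv : y ∉ v := fun h => hd y h y (by simp) rfl
  exact ⟨isCyc_bypass_of_notMem (isCyc_bypass hx hxu) hyu,
    isCyc_bypass (isCyc_bypass_of_notMem hy (by simpa using ⟨hxy, hxv⟩)) hyv⟩

theorem isCyc_bypass_bypass_of_notMem {w : List X} (h : IsCyc f w) (hx : x ∉ w) (hy : y ∉ w) :
    IsCyc (bypass (bypass f x) y) w :=
  isCyc_bypass_of_notMem (isCyc_bypass_of_notMem h hx) hy

theorem isCyc_glued_join (hx : IsCyc f (x :: u)) (hy : IsCyc f (y :: v))
    (hn : (x :: (v ++ y :: u)).Nodup) : IsCyc (glued f x y) (u ++ v) :=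
  isCyc_bypass_bypass_same (isCyc_mul_swap_join hx hy hn) hn

theorem isCyc_glued_split (h : IsCyc f (x :: (v ++ y :: u))) (hn : (x :: (v ++ y :: u)).Nodup) :
    IsCyc (glued f x y) u ∧ IsCyc (glued f x y) v :=
  isCyc_bypass_bypass_ne (isCyc_mul_swap_split h hn).1 (isCyc_mul_swap_split h hn).2 hn

theorem isCyc_glued_of_notMem {w : List X} (h : IsCyc f w) (hx : x ∉ w) (hy : y ∉ w) :
    IsCyc (glued f x y) w := by
  classical
  refine isCyc_bypass_bypass_of_notMem (h.congr fun z hz _ => ?_) hx hy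
  exact mul_swap_apply_of_notMem hx hy z hz

theorem IsCyc.of_map {Y : Type} {f : X → X} {f' : Y → Y} {φ : X → Y} (hφ : Function.Injective φ)
    (h : ∀ x, f' (φ x) = φ (f x)) {w : List X} (hw : IsCyc f' (w.map φ)) : IsCyc f w := by
  cases w with
  | nil => trivial
  | cons x u =>
    change List.IsChain _ (φ x :: (u.map φ ++ [φ x])) at hw
    have h1 : φ x :: (u.map φ ++ [φ x]) = (x :: (u ++ [x])).map φ := by simp
    rw [h1, List.isChain_map] at hw
    exact List.IsChain.imp (fun a b hab => hφ (by rw [← h, hab])) hw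

theorem IsCyc.apply_mem {f : X → X} {w : List X} (h : IsCyc f w) {z : X} (hz : z ∈ w) :
    f z ∈ w := by
  obtain ⟨u, hu⟩ := isRotated_cons_of_mem hz
  have h1 : List.IsChain _ (z :: (u ++ [z])) := h.of_isRotated hu
  rw [hu.mem_iff]
  cases u with
  | nil =>
    rw [List.nil_append, List.isChain_cons_cons] at h1
    simp [h1.1]
  | cons c u =>
    rw [List.cons_append, List.isChain_cons_cons] at h1
    simp [h1.1]

theorem IsCyc.apply_head {f : X → X} {a b : X} {w : List X} (h : IsCyc f (a :: b :: w)) :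
    f a = b := by
  have h1 : List.IsChain _ (a :: b :: (w ++ [a])) := h
  exact (List.isChain_cons_cons.mp h1).1

theorem IsCyc.apply_singleton {f : X → X} {a : X} (h : IsCyc f [a]) : f a = a := by
  have h1 : List.IsChain _ [a, a] := h
  exact (List.isChain_cons_cons.mp h1).1

theorem IsCyc.apply_eq_self_iff {f : X → X} {a : X} {w : List X} (h : IsCyc f (a :: w))
    (hn : (a :: w).Nodup) : f a = a ↔ w = [] := by
  cases w with
  | nil => simpa using h.apply_singleton
  | cons b w =>
    rw [h.apply_head]
    simp only [List.nodup_cons, List.mem_cons, not_or] at hn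
    simpa using fun h => hn.1.1 h.symm

theorem IsCyc.apply_eq_iff {f : X → X} {a b : X} {v u : List X} (h : IsCyc f (a :: (v ++ b :: u)))
    (hn : (a :: (v ++ b :: u)).Nodup) : f a = b ↔ v = [] := by
  cases v with
  | nil => simpa using h.apply_head
  | cons c v =>
    rw [IsCyc.apply_head (w := v ++ b :: u) h]
    rw [List.nodup_cons, List.cons_append, List.nodup_cons] at hn
    simpa using fun h => hn.2.1 (by simp [h])

end Cycles

end BWGraph

namespace BWGraph

/-! ## Presentations of a contracted graph -/

/-! ### Normal forms of the words at a vertex -/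

section Words

variable {k : ℕ} {γ : BWGraph k}

theorem VertexWords.perm {v : γ.V} {ws ws' : List (List γ.H)} (h : γ.VertexWords v ws)
    (hp : ws.Perm ws') : γ.VertexWords v ws' where
  nodup := hp.flatten.nodup_iff.mp h.nodup
  mem x := (hp.flatten.mem_iff.symm).trans (h.mem x)
  cyc w hw := h.cyc w (hp.mem_iff.mpr hw)
  holes := (hp.countP_eq _).symm.trans h.holes

theorem VertexWords.rotate {v : γ.V} {w w' : List γ.H} {ws : List (List γ.H)}
    (h : γ.VertexWords v (w :: ws)) (hr : w.IsRotated w') : γ.VertexWords v (w' :: ws) where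
  nodup := (hr.perm.append_right ws.flatten).nodup_iff.mp h.nodup
  mem x := ((hr.perm.append_right ws.flatten).mem_iff.symm).trans (h.mem x)
  cyc := by
    have := h.cyc
    rw [List.forall_mem_cons] at this ⊢
    exact ⟨this.1.of_isRotated hr, this.2⟩
  holes := by
    rw [← h.holes, List.countP_cons, List.countP_cons]
    have : w'.isEmpty = w.isEmpty := by
      rw [Bool.eq_iff_iff, List.isEmpty_iff, List.isEmpty_iff]
      constructor
      · rintro rfl; exact List.isRotated_nil_iff.mp hr
      · rintro rfl; exact List.isRotated_nil_iff.mp hr.symm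
    rw [this]

theorem exists_perm_cons_of_mem_flatten {X : Type} {x : X} {ws : List (List X)}
    (h : x ∈ ws.flatten) : ∃ w ws', ws.Perm (w :: ws') ∧ x ∈ w := by
  obtain ⟨w, hw, hx⟩ := List.mem_flatten.mp h
  obtain ⟨a, b, rfl⟩ := List.append_of_mem hw
  exact ⟨w, a ++ b, List.perm_middle, hx⟩

theorem VertexWords.exists_cons {v : γ.V} {ws : List (List γ.H)} (h : γ.VertexWords v ws)
    {x : γ.H} (hx : γ.vert x = v) :
    ∃ u ws', γ.VertexWords v ((x :: u) :: ws') := by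
  obtain ⟨w, ws', hp, hw⟩ := exists_perm_cons_of_mem_flatten ((h.mem x).mpr hx)
  obtain ⟨u, hu⟩ := isRotated_cons_of_mem hw
  exact ⟨u, ws', (h.perm hp).rotate hu⟩

theorem VertexWords.rotate_cons {v : γ.V} {x : γ.H} {u : List γ.H} {ws : List (List γ.H)}
    (h : γ.VertexWords v ((x :: u) :: ws)) : γ.VertexWords v ((u ++ [x]) :: ws) :=
  h.rotate (List.isRotated_append (l := [x]) (l' := u))

end Words

/-- The effect on vertex data of gluing a strip to the half-edges `x` and `y`. -/
inductive Gluing {X Y : Type} (ι : Y → X) (x y : X) : VertexData X → VertexData Y → Prop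
  | merge {g₁ g₂ : ℕ} {u v : List Y} {ws₁ ws₂ : List (List Y)} {R : VertexData Y}
      (h₁ : u ≠ [] ∨ ws₁ ≠ [] ∨ g₁ ≠ 0) (h₂ : v ≠ [] ∨ ws₂ ≠ [] ∨ g₂ ≠ 0) :
      Gluing ι x y
        ((g₁, (u.map ι ++ [x]) :: ws₁.map (List.map ι)) ::
          (g₂, (y :: v.map ι) :: ws₂.map (List.map ι)) :: mapData ι R)
        ((g₁ + g₂, (u ++ v) :: (ws₂ ++ ws₁)) :: R)
  | split {g : ℕ} {u v : List Y} {ws : List (List Y)} {R : VertexData Y} :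
      Gluing ι x y
        ((g, (u.map ι ++ x :: (v.map ι ++ [y])) :: ws.map (List.map ι)) :: mapData ι R)
        ((g, u :: v :: ws) :: R)
  | handle {g : ℕ} {u v : List Y} {ws : List (List Y)} {R : VertexData Y} :
      Gluing ι x y
        ((g, (u.map ι ++ [x]) :: (y :: v.map ι) :: ws.map (List.map ι)) :: mapData ι R)
        ((g + 1, (u ++ v) :: ws) :: R)

namespace Gluing

variable {X Y : Type} {ι : Y → X} {x y : X} {D : VertexData X} {D' : VertexData Y}

theorem eulerSum_eq (h : Gluing ι x y D D') : eulerSum D' = eulerSum D - 1 := by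
  cases h <;> simp [eulerSum, mapData, Function.comp_def] <;> ring

theorem length_eq (h : Gluing ι x y D D') : (halfEdges D).length = (halfEdges D').length + 2 := by
  cases h <;> simp only [halfEdges_cons, halfEdges_mapData, List.flatten_cons,
    List.flatten_append, ← List.map_flatten, List.length_append, List.length_map,
    List.length_cons, List.length_nil] <;> omega

/-- The quantity `2 b₁ + valency - 2` is additive when two vertices merge and unchanged in the two
loop cases. -/
theorem isStableEntry (h : Gluing ι x y D D') (hD : ∀ e ∈ D, IsStableEntry e) :
    ∀ e ∈ D', IsStableEntry e := by
  cases h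
  all_goals
    simp only [List.forall_mem_cons, isStableEntry_mapData] at hD ⊢
    simp only [IsStableEntry, List.length_cons, List.length_append, List.length_map,
      List.flatten_cons, List.flatten_append, ← List.map_flatten, List.length_nil] at hD ⊢
  · exact ⟨by omega, hD.2.2⟩
  · exact ⟨by omega, hD.2⟩
  · exact ⟨by omega, hD.2⟩

variable [Fintype X] [Fintype Y]
variable {A : Type*} [NonUnitalRing A] [Module ℝ A] [FiniteDimensional ℝ A] {F : DGFrobenius A}
  [IsScalarTower ℝ A A] [SMulCommClass ℝ A A]

/-- The behaviour of the tensors of the vertices under gluing. -/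
theorem sum_vertexValue (h : Gluing ι x y D D') :
    ∃ M₁ M₂ M₃ : List Y,
      halfEdges D = M₁.map ι ++ x :: (M₂.map ι ++ y :: M₃.map ι) ∧
      (halfEdges D').Perm (M₁ ++ (M₂ ++ M₃)) ∧
      ∀ (l : Y → F.Idx) (L : F.Idx → F.Idx → X → F.Idx), (∀ a b, L a b ∘ ι = l) →
        (∀ a b, L a b x = a) → (∀ a b, L a b y = b) → (halfEdges D').Nodup →
        ∑ a, ∑ b, F.invGram a b * (sgn (b.1 * totalParity (labelParity l) M₂) *
          vertexValue (L a b) D) =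
        koszulSign (labelParity l) (halfEdges D') (M₁ ++ (M₂ ++ M₃)) * vertexValue l D' := by
  cases h with
  | @merge g₁ g₂ u v ws₁ ws₂ R h₁ h₂ =>
    refine ⟨u, ws₁.flatten, v ++ (ws₂.flatten ++ halfEdges R), ?_, ?_, ?_⟩
    · simp [halfEdges_cons, halfEdges_mapData, List.map_flatten]
    · simp only [halfEdges_cons, List.flatten_cons, List.flatten_append, List.append_assoc]
      refine List.Perm.append_left _ ?_
      have := (List.perm_append_comm (l₁ := v ++ ws₂.flatten) (l₂ := ws₁.flatten)).append_right
        (halfEdges R)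
      simpa using this
    · intro l L hL hx hy hn
      have h3 : ∀ (a b : F.Idx) (w : List Y), (w.map ι).map (L a b) = w.map l := fun a b w => by
        rw [List.map_map, hL]
      have h4 : ∀ (a b : F.Idx) (ws : List (List Y)),
          (ws.map (List.map ι)).map (List.map (L a b)) = ws.map (List.map l) := fun a b ws => by
        rw [List.map_map]; exact List.map_congr_left fun w _ => h3 a b w
      simp only [vertexValue_cons, vertexValue_mapData, hL, List.map_cons, List.map_append, h3, h4,
        List.map_nil, hx, hy]
      have h5 := F.sum_surface_mul_surface (α := u.map l) (β := v.map l)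
        (ws₁ := ws₁.map (List.map l)) (ws₂ := ws₂.map (List.map l)) (g₁ := g₁) (g₂ := g₂)
        (by simpa using h₁) (by simpa using h₂)
      simp only [parity_flatten_map, parity_map] at h5
      -- The glued surface lists the circles `ws₂` before `ws₁`; this is the cost of restoring the
      -- original order, and it matches the sign in the gluing law.
      have h6 : koszulSign (labelParity l) (halfEdges ((g₁ + g₂, (u ++ v) :: (ws₂ ++ ws₁)) :: R))
          (u ++ (ws₁.flatten ++ (v ++ (ws₂.flatten ++ halfEdges R)))) =
          sgn ((totalParity (labelParity l) v + totalParity (labelParity l) ws₂.flatten) *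
            totalParity (labelParity l) ws₁.flatten) := by
        have e : halfEdges ((g₁ + g₂, (u ++ v) :: (ws₂ ++ ws₁)) :: R) =
            u ++ ((v ++ ws₂.flatten) ++ (ws₁.flatten ++ halfEdges R)) := by
          simp [halfEdges_cons]
        rw [e] at hn ⊢
        have := koszulSign_exchange (labelParity l) hn
        rw [totalParity_append] at this
        simpa using this
      rw [h6]
      rw [← mul_assoc, ← h5, Finset.sum_mul]
      refine Finset.sum_congr rfl fun a _ => ?_
      rw [Finset.sum_mul]
      exact Finset.sum_congr rfl fun b _ => by ring
  | @split g u v ws R =>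
    refine ⟨u, v, ws.flatten ++ halfEdges R, ?_, ?_, ?_⟩
    · simp [halfEdges_cons, halfEdges_mapData, List.map_flatten]
    · simp [halfEdges_cons]
    · intro l L hL hx hy hn
      have h3 : ∀ (a b : F.Idx) (w : List Y), (w.map ι).map (L a b) = w.map l := fun a b w => by
        rw [List.map_map, hL]
      have h4 : ∀ (a b : F.Idx) (ws : List (List Y)),
          (ws.map (List.map ι)).map (List.map (L a b)) = ws.map (List.map l) := fun a b ws => by
        rw [List.map_map]; exact List.map_congr_left fun w _ => h3 a b w
      simp only [vertexValue_cons, vertexValue_mapData, hL, List.map_cons, List.map_append, h3, h4,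
        List.map_nil, hx, hy]
      have e : halfEdges ((g, u :: v :: ws) :: R) = u ++ (v ++ (ws.flatten ++ halfEdges R)) := by
        simp [halfEdges_cons]
      rw [e] at hn ⊢
      rw [koszulSign_self _ hn, one_mul]
      -- Both ends lie on one circle: cutting off `v` by a strip is how `surfaceAux` defines the
      -- tensor with a further circle `v`.
      simp only [DGFrobenius.surface, F.surfaceAux_cons, DGFrobenius.strip, parity_map,
        Finset.sum_mul]
      exact Finset.sum_congr rfl fun a _ => Finset.sum_congr rfl fun b _ => by ring
  | @handle g u v ws R =>
    refine ⟨u, [], v ++ (ws.flatten ++ halfEdges R), ?_, ?_, ?_⟩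
    · simp [halfEdges_cons, halfEdges_mapData, List.map_flatten]
    · simp [halfEdges_cons]
    · intro l L hL hx hy hn
      have h3 : ∀ (a b : F.Idx) (w : List Y), (w.map ι).map (L a b) = w.map l := fun a b w => by
        rw [List.map_map, hL]
      have h4 : ∀ (a b : F.Idx) (ws : List (List Y)),
          (ws.map (List.map ι)).map (List.map (L a b)) = ws.map (List.map l) := fun a b ws => by
        rw [List.map_map]; exact List.map_congr_left fun w _ => h3 a b w
      simp only [vertexValue_cons, vertexValue_mapData, hL, List.map_cons, List.map_append, h3, h4,
        List.map_nil, hx, hy]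
      have e : halfEdges ((g + 1, (u ++ v) :: ws) :: R) =
          u ++ ([] ++ (v ++ (ws.flatten ++ halfEdges R))) := by simp [halfEdges_cons]
      rw [e] at hn ⊢
      -- Here `M₂` is empty because `x` ends one circle and `y` begins the next, so no sign arises.
      rw [koszulSign_self _ hn, one_mul, totalParity_nil, ← F.sum_surface_glue_circles,
        Finset.sum_mul]
      refine Finset.sum_congr rfl fun a _ => ?_
      rw [Finset.sum_mul]
      exact Finset.sum_congr rfl fun b _ => by rw [mul_zero, sgn_zero]; ring

end Gluing

/-! ### Lifting vertex data -/

theorem exists_map_eq {X Y : Type} {ι : Y → X} (w : List X) (h : ∀ x ∈ w, x ∈ Set.range ι) :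
    ∃ w' : List Y, w'.map ι = w := by
  have h2 : w ∈ Set.range (List.map ι) := by rw [Set.range_list_map]; exact h
  exact h2

theorem exists_map_map_eq {X Y : Type} {ι : Y → X} (ws : List (List X))
    (h : ∀ x ∈ ws.flatten, x ∈ Set.range ι) :
    ∃ ws' : List (List Y), ws'.map (List.map ι) = ws := by
  induction ws with
  | nil => exact ⟨[], rfl⟩
  | cons w ws ih =>
    obtain ⟨w', hw⟩ := exists_map_eq w fun x hx => h x (by simp [hx])
    obtain ⟨ws', hws⟩ := ih fun x hx => h x (by
      rw [List.flatten_cons]; exact List.mem_append_right _ hx)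
    exact ⟨w' :: ws', by rw [List.map_cons, hw, hws]⟩

theorem exists_mapData_eq {X Y : Type} {ι : Y → X} (D : VertexData X)
    (h : ∀ x ∈ halfEdges D, x ∈ Set.range ι) : ∃ D' : VertexData Y, mapData ι D' = D := by
  induction D with
  | nil => exact ⟨[], rfl⟩
  | cons e D ih =>
    obtain ⟨ws, hws⟩ := exists_map_map_eq e.2 fun x hx => h x (by
      rw [halfEdges_cons]; exact List.mem_append_left _ hx)
    obtain ⟨D', hD⟩ := ih fun x hx => h x (by
      rw [halfEdges_cons]; exact List.mem_append_right _ hx)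
    exact ⟨(e.1, ws) :: D', by rw [← hD]; simp [mapData, hws]⟩

end BWGraph

namespace BWGraph

/-! ## The contracted graph -/

section SameCycle

variable {X : Type} [Finite X] {f : Equiv.Perm X}

theorem sameCycle_of_isChain {a z : X} {w : List X}
    (h : List.IsChain (fun a b => f a = b) (a :: w)) (hz : z ∈ w) : f.SameCycle a z := by
  induction w generalizing a with
  | nil => simp at hz
  | cons b w ih =>
    rw [List.isChain_cons_cons] at h
    have hab : f.SameCycle a b := ⟨1, by simpa using h.1⟩
    rcases List.mem_cons.mp hz with rfl | hz
    · exact hab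
    · exact hab.trans (ih h.2 hz)

theorem IsCyc.sameCycle {a z : X} {w : List X} (h : IsCyc f (a :: w)) (hz : z ∈ w) :
    f.SameCycle a z :=
  sameCycle_of_isChain (w := w ++ [a]) h (List.mem_append_left _ hz)

theorem IsCyc.mem_of_sameCycle {a z : X} {w : List X} (h : IsCyc f w) (ha : a ∈ w)
    (hz : f.SameCycle a z) : z ∈ w := by
  obtain ⟨n, rfl⟩ := hz.exists_nat_pow_eq
  clear hz
  induction n with
  | zero => exact ha
  | succ n ih =>
    rw [pow_succ', Equiv.Perm.mul_apply]
    exact h.apply_mem ih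

end SameCycle

section

open scoped Classical

/-- The number of circles without half-edges which arise when a strip is glued. -/
noncomputable def newHoles {X : Type} (f : X → X) (x y : X) : ℕ :=
  (if f x = y then 1 else 0) + (if f y = x then 1 else 0) + (if f x = x ∧ f y = y then 1 else 0)

theorem newHoles_join {X : Type} {f : X → X} {x y : X} {u v : List X} (hx : IsCyc f (x :: u))
    (hy : IsCyc f (y :: v)) (hn : (x :: (v ++ y :: u)).Nodup) :
    newHoles f x y = [u ++ v].countP List.isEmpty := by
  have hn' := hn
  simp only [List.nodup_cons, List.nodup_append, List.mem_append, List.mem_cons, not_or] at hn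
  obtain ⟨⟨hxv, hxy, hxu⟩, hv, ⟨hyu, hu⟩, hd⟩ := hn
  have hyv : y ∉ v := fun h => hd y h y (by simp) rfl
  have h1 : f x ≠ y := fun h => by
    have := hx.apply_mem (z := x) (by simp)
    rw [h, List.mem_cons] at this
    exact this.elim (fun h => hxy h.symm) hyu
  have h2 : f y ≠ x := fun h => by
    have := hy.apply_mem (z := y) (by simp)
    rw [h, List.mem_cons] at this
    exact this.elim (fun h => hxy h) hxv
  rw [newHoles, if_neg h1, if_neg h2, hx.apply_eq_self_iff (by simp [hxu, hu]),
    hy.apply_eq_self_iff (by simp [hyv, hv])]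
  simp [List.countP_cons]

theorem newHoles_split {X : Type} {f : X → X} {x y : X} {u v : List X}
    (h : IsCyc f (x :: (v ++ y :: u))) (hn : (x :: (v ++ y :: u)).Nodup) :
    newHoles f x y = [u, v].countP List.isEmpty := by
  have h' : IsCyc f (y :: (u ++ x :: v)) := isCyc_rotate (x :: v) (y :: u) h
  have hn' : (y :: (u ++ x :: v)).Nodup :=
    (List.perm_append_comm (l₁ := x :: v) (l₂ := y :: u)).nodup_iff.mp hn
  rw [newHoles, h.apply_eq_iff hn, h'.apply_eq_iff hn', h.apply_eq_self_iff hn]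
  by_cases hu : u = [] <;> by_cases hv : v = [] <;> simp [hu, hv]

end

section Contract

open scoped Classical

variable {k : ℕ} (γ : BWGraph (k + 1)) (i : Fin (k + 1))

/-- The half-edges of the contracted graph are half-edges of the graph. -/
def contractVal (z : (γ.contract i).H) : γ.H := Subtype.val z

theorem contractVal_injective : Function.Injective (γ.contractVal i) := Subtype.val_injective

theorem mem_range_contractVal {z : γ.H} :
    z ∈ Set.range (γ.contractVal i) ↔ z ≠ γ.black i ∧ z ≠ γ.inv (γ.black i) :=
  ⟨fun ⟨w, hw⟩ => hw ▸ w.2, fun h => ⟨⟨z, h⟩, rfl⟩⟩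

/-- The vertex of the contracted graph which comes from a vertex. -/
def contractMk (v : γ.V) : (γ.contract i).V := Quot.mk _ v

theorem contractMk_surjective : Function.Surjective (γ.contractMk i) := Quot.mk_surjective

theorem contractMk_glue : γ.contractMk i (γ.vert (γ.black i)) =
    γ.contractMk i (γ.vert (γ.inv (γ.black i))) := Quot.sound ⟨rfl, rfl⟩

theorem contractMk_eq_iff {v w : γ.V} : γ.contractMk i v = γ.contractMk i w ↔
    v = w ∨ ((v = γ.vert (γ.black i) ∨ v = γ.vert (γ.inv (γ.black i))) ∧
      (w = γ.vert (γ.black i) ∨ w = γ.vert (γ.inv (γ.black i)))) := by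
  constructor
  · intro h
    -- A function which identifies the two ends of the edge and nothing else; it descends to the
    -- quotient and so separates its classes.
    let c : γ.V → γ.V := fun v => if v = γ.vert (γ.inv (γ.black i)) then γ.vert (γ.black i) else v
    have h1 : c v = c w := congrArg (Quot.lift c (by
      rintro a b ⟨rfl, rfl⟩
      simp [c])) h
    by_cases hv : v = γ.vert (γ.inv (γ.black i)) <;>
      by_cases hw : w = γ.vert (γ.inv (γ.black i)) <;> simp only [c, hv, hw, if_true, if_false] at h1 ⊢ <;>
      tauto
  · rintro (rfl | ⟨hv, hw⟩)
    · rfl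
    · rcases hv with rfl | rfl <;> rcases hw with rfl | rfl <;>
        simp [γ.contractMk_glue i]

theorem contract_genus (v : γ.V) : (γ.contract i).genus (γ.contractMk i v) =
    (∑ w ∈ Finset.univ.filter fun w => γ.contractMk i w = γ.contractMk i v, γ.genus w) +
      if γ.contractMk i v = γ.contractMk i (γ.vert (γ.black i)) ∧
        γ.vert (γ.black i) = γ.vert (γ.inv (γ.black i)) ∧
        ¬ γ.next.SameCycle (γ.black i) (γ.inv (γ.black i)) then 1 else 0 := rfl

theorem contract_holes (q : (γ.contract i).V) : (γ.contract i).holes q =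
    (∑ w ∈ Finset.univ.filter fun w => γ.contractMk i w = q, γ.holes w) +
      if q = γ.contractMk i (γ.vert (γ.black i)) then
        newHoles γ.next (γ.black i) (γ.inv (γ.black i)) else 0 := rfl

variable {γ i}

theorem vertexWords_contract {q : (γ.contract i).V} {ws : List (List (γ.contract i).H)}
    (hn : ((ws.map (List.map (γ.contractVal i))).flatten).Nodup)
    (hm : ∀ z, z ≠ γ.black i → z ≠ γ.inv (γ.black i) →
      (z ∈ (ws.map (List.map (γ.contractVal i))).flatten ↔ γ.contractMk i (γ.vert z) = q))
    (hc : ∀ w ∈ ws.map (List.map (γ.contractVal i)),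
      IsCyc (glued γ.next (γ.black i) (γ.inv (γ.black i))) w)
    (hh : ws.countP List.isEmpty = (γ.contract i).holes q) :
    (γ.contract i).VertexWords q ws where
  nodup := by rw [← List.map_flatten] at hn; exact hn.of_map _
  mem z := by
    rw [← List.map_flatten] at hm
    rw [← List.mem_map_of_injective (γ.contractVal_injective i)]
    exact hm (γ.contractVal i z) z.2.1 z.2.2
  cyc w hw := (hc _ (List.mem_map_of_mem hw)).of_map (γ.contractVal_injective i) fun _ => rfl
  holes := hh

theorem isVertexData_contract_of_ne {v : γ.V} (h₁ : v ≠ γ.vert (γ.black i))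
    (h₂ : v ≠ γ.vert (γ.inv (γ.black i))) {g : ℕ} {ws : List (List (γ.contract i).H)}
    (h : γ.IsVertexData v (g, ws.map (List.map (γ.contractVal i)))) :
    (γ.contract i).IsVertexData (γ.contractMk i v) (g, ws) := by
  have h3 : ∀ w, γ.contractMk i w = γ.contractMk i v ↔ w = v := fun w => by
    rw [contractMk_eq_iff]; tauto
  have h4 : (Finset.univ.filter fun w => γ.contractMk i w = γ.contractMk i v) = {v} := by
    ext w; simp [h3]
  have h5 : γ.contractMk i v ≠ γ.contractMk i (γ.vert (γ.black i)) := fun h =>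
    h₁ ((h3 _).mp h.symm).symm
  refine ⟨?_, vertexWords_contract h.2.nodup ?_ ?_ ?_⟩
  · rw [contract_genus, h4, if_neg fun h => h5 h.1, Finset.sum_singleton]
    exact h.1
  · intro z _ _
    rw [h.2.mem, h3]
  · intro w hw
    have hmem : ∀ z ∈ w, γ.vert z = v := fun z hz =>
      (h.2.mem z).mp (List.mem_flatten.mpr ⟨w, hw, hz⟩)
    exact isCyc_glued_of_notMem (h.2.cyc w hw) (fun hx => h₁ (hmem _ hx).symm)
      (fun hy => h₂ (hmem _ hy).symm)
  · rw [contract_holes, h4, if_neg h5, Finset.sum_singleton, ← h.2.holes, countP_isEmpty_map,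
      add_zero]

theorem forall₂_contract {vs : List γ.V} (hv : ∀ v ∈ vs, v ≠ γ.vert (γ.black i) ∧
    v ≠ γ.vert (γ.inv (γ.black i))) {R : VertexData (γ.contract i).H}
    (h : List.Forall₂ γ.IsVertexData vs (mapData (γ.contractVal i) R)) :
    List.Forall₂ (γ.contract i).IsVertexData (vs.map (γ.contractMk i)) R := by
  rw [mapData, List.forall₂_map_right_iff] at h
  rw [List.forall₂_map_left_iff]
  induction h with
  | nil => exact List.Forall₂.nil
  | cons he _ ih =>
    exact List.Forall₂.cons (isVertexData_contract_of_ne (hv _ (by simp)).1 (hv _ (by simp)).2 he)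
      (ih fun v hv' => hv v (List.mem_cons_of_mem _ hv'))

variable (γ i)

/-- The vertices which are not adjacent to a black edge. -/
noncomputable def otherVertices : List γ.V :=
  (Finset.univ.filter fun v => v ≠ γ.vert (γ.black i) ∧
    v ≠ γ.vert (γ.inv (γ.black i))).toList

theorem mem_otherVertices {v : γ.V} : v ∈ γ.otherVertices i ↔ v ≠ γ.vert (γ.black i) ∧
    v ≠ γ.vert (γ.inv (γ.black i)) := by simp [otherVertices]

theorem nodup_otherVertices : (γ.otherVertices i).Nodup := Finset.nodup_toList _

theorem exists_otherData : ∃ R : VertexData (γ.contract i).H,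
    List.Forall₂ γ.IsVertexData (γ.otherVertices i) (mapData (γ.contractVal i) R) := by
  let D : VertexData γ.H := (γ.otherVertices i).map fun v => (γ.genus v, γ.circleWords v)
  have hD : List.Forall₂ γ.IsVertexData (γ.otherVertices i) D := by
    rw [List.forall₂_map_right_iff, List.forall₂_same]
    exact fun v _ => ⟨rfl, γ.vertexWords_circleWords v⟩
  obtain ⟨R, hR⟩ := exists_mapData_eq (ι := γ.contractVal i) D (by
    intro z hz
    have h1 := (nodup_halfEdges_of_forall₂ (γ.nodup_otherVertices i) hD).2 z hz
    rw [mem_otherVertices] at h1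
    rw [mem_range_contractVal]
    exact ⟨fun h => h1.1 (by rw [h]), fun h => h1.2 (by rw [h])⟩)
  exact ⟨R, hR ▸ hD⟩

theorem nodup_contract_vertices :
    (γ.contractMk i (γ.vert (γ.black i)) :: (γ.otherVertices i).map (γ.contractMk i)).Nodup := by
  rw [List.nodup_cons]
  constructor
  · rw [List.mem_map]
    rintro ⟨v, hv, h⟩
    rw [mem_otherVertices] at hv
    rw [contractMk_eq_iff] at h
    tauto
  · refine List.Nodup.map_on ?_ (γ.nodup_otherVertices i)
    intro v hv w _ h
    have hv' := (γ.mem_otherVertices i).mp hv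
    rw [contractMk_eq_iff] at h
    tauto

theorem mem_contract_vertices (q : (γ.contract i).V) :
    q ∈ γ.contractMk i (γ.vert (γ.black i)) :: (γ.otherVertices i).map (γ.contractMk i) := by
  obtain ⟨v, rfl⟩ := γ.contractMk_surjective i q
  by_cases h₁ : v = γ.vert (γ.black i)
  · simp [h₁]
  by_cases h₂ : v = γ.vert (γ.inv (γ.black i))
  · simp [h₂, contractMk_glue]
  exact List.mem_cons_of_mem _ (List.mem_map_of_mem ((γ.mem_otherVertices i).mpr ⟨h₁, h₂⟩))

variable {γ i}

/-- The words on the circles at the vertex to which a black edge is contracted. -/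
theorem vertexWords_contract_glued {ws : List (List (γ.contract i).H)} {L : List γ.H}
    (hL : L.Nodup)
    (hm : ∀ z, z ∈ L ↔ (γ.vert z = γ.vert (γ.black i) ∨ γ.vert z = γ.vert (γ.inv (γ.black i))))
    (hp : L.Perm (γ.black i :: γ.inv (γ.black i) :: (ws.map (List.map (γ.contractVal i))).flatten))
    (hc : ∀ w ∈ ws.map (List.map (γ.contractVal i)),
      IsCyc (glued γ.next (γ.black i) (γ.inv (γ.black i))) w)
    (hh : ws.countP List.isEmpty =
      (∑ w ∈ {γ.vert (γ.black i), γ.vert (γ.inv (γ.black i))}, γ.holes w) +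
        newHoles γ.next (γ.black i) (γ.inv (γ.black i))) :
    (γ.contract i).VertexWords (γ.contractMk i (γ.vert (γ.black i))) ws := by
  have h3 : ∀ w, γ.contractMk i w = γ.contractMk i (γ.vert (γ.black i)) ↔
      w = γ.vert (γ.black i) ∨ w = γ.vert (γ.inv (γ.black i)) := fun w => by
    rw [contractMk_eq_iff]; tauto
  refine vertexWords_contract ?_ ?_ hc ?_
  · exact (List.nodup_cons.mp (List.nodup_cons.mp (hp.nodup_iff.mp hL)).2).2
  · intro z h₁ h₂
    rw [h3, ← hm, hp.mem_iff, List.mem_cons, List.mem_cons]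
    tauto
  · rw [contract_holes, if_pos rfl, hh]
    congr 2
    ext w; simp [h3]

/-- The circles at the two ends are rotated so that `x` comes last on its circle and `y` first.
Gluing joins them into one circle, which is new and empty exactly when `x` and `y` were alone on
theirs. -/
theorem exists_gluing_of_ne (hs : γ.IsStable)
    (hv : γ.vert (γ.black i) ≠ γ.vert (γ.inv (γ.black i))) :
    ∃ D D', γ.Presents D ∧ (γ.contract i).Presents D' ∧
      Gluing (γ.contractVal i) (γ.black i) (γ.inv (γ.black i)) D D' := by
  obtain ⟨R, hR⟩ := γ.exists_otherData i
  obtain ⟨u, ws₁, h₁⟩ := (γ.vertexWords_circleWords (γ.vert (γ.black i))).exists_cons rfl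
  obtain ⟨v, ws₂, h₂⟩ :=
    (γ.vertexWords_circleWords (γ.vert (γ.inv (γ.black i)))).exists_cons rfl
  obtain ⟨L, hL⟩ : ∃ L, L = ((γ.black i :: u) :: ws₁).flatten ++
    ((γ.inv (γ.black i) :: v) :: ws₂).flatten := ⟨_, rfl⟩
  have hLn : L.Nodup := by
    rw [hL]
    refine List.nodup_append.mpr ⟨h₁.nodup, h₂.nodup, ?_⟩
    rintro a ha b hb rfl
    exact hv (((h₁.mem a).mp ha).symm.trans ((h₂.mem a).mp hb))
  have hLm : ∀ z, z ∈ L ↔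
      (γ.vert z = γ.vert (γ.black i) ∨ γ.vert z = γ.vert (γ.inv (γ.black i))) := fun z => by
    rw [hL, List.mem_append, h₁.mem, h₂.mem]
  have hLp : L.Perm (γ.black i :: γ.inv (γ.black i) :: ((u ++ v) :: (ws₂ ++ ws₁)).flatten) := by
    rw [hL, List.perm_iff_count]
    intro a
    simp only [List.flatten_cons, List.flatten_append, List.count_append, List.count_cons]
    omega
  have hN := hLp.nodup_iff.mp hLn
  obtain ⟨hxN, hN2⟩ := List.nodup_cons.mp hN
  have hyN := (List.nodup_cons.mp hN2).1
  have hne : ∀ z ∈ ((u ++ v) :: (ws₂ ++ ws₁)).flatten,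
      z ≠ γ.black i ∧ z ≠ γ.inv (γ.black i) := fun z hz =>
    ⟨fun h => hxN (List.mem_cons_of_mem _ (h ▸ hz)), fun h => hyN (h ▸ hz)⟩
  obtain ⟨u, rfl⟩ := exists_map_eq (ι := γ.contractVal i) u fun z hz => (γ.mem_range_contractVal i).mpr <| hne z (by simp [hz])
  obtain ⟨v, rfl⟩ := exists_map_eq (ι := γ.contractVal i) v fun z hz => (γ.mem_range_contractVal i).mpr <| hne z (by simp [hz])
  obtain ⟨ws₁, rfl⟩ := exists_map_map_eq (ι := γ.contractVal i) ws₁ fun z hz => (γ.mem_range_contractVal i).mpr <| hne z (by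
    rw [List.flatten_cons, List.flatten_append]; simp [-List.mem_flatten, hz])
  obtain ⟨ws₂, rfl⟩ := exists_map_map_eq (ι := γ.contractVal i) ws₂ fun z hz => (γ.mem_range_contractVal i).mpr <| hne z (by
    rw [List.flatten_cons, List.flatten_append]; simp [-List.mem_flatten, hz])
  have e : (u.map (γ.contractVal i) ++ v.map (γ.contractVal i)) ::
      (ws₂.map (List.map (γ.contractVal i)) ++ ws₁.map (List.map (γ.contractVal i))) =
      ((u ++ v) :: (ws₂ ++ ws₁)).map (List.map (γ.contractVal i)) := by simp
  rw [e] at hLp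
  have hJ : (γ.black i :: (v.map (γ.contractVal i) ++ γ.inv (γ.black i) :: u.map (γ.contractVal i))).Nodup := by
    have p : (γ.black i :: γ.inv (γ.black i) ::
        (((u ++ v) :: (ws₂ ++ ws₁)).map (List.map (γ.contractVal i))).flatten).Perm
        ((γ.black i :: (v.map (γ.contractVal i) ++ γ.inv (γ.black i) :: u.map (γ.contractVal i))) ++
          ((ws₂ ++ ws₁).map (List.map (γ.contractVal i))).flatten) := by
      rw [List.perm_iff_count]
      intro a
      simp only [List.map_cons, List.map_append, List.flatten_cons, List.count_append,
        List.count_cons]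
      omega
    exact (List.nodup_append.mp (p.nodup_iff.mp (hLp.nodup_iff.mp hLn))).1
  have hP : γ.Presents ((γ.genus (γ.vert (γ.black i)), (u.map (γ.contractVal i) ++ [γ.black i]) ::
      ws₁.map (List.map (γ.contractVal i))) :: (γ.genus (γ.vert (γ.inv (γ.black i))),
      (γ.inv (γ.black i) :: v.map (γ.contractVal i)) :: ws₂.map (List.map (γ.contractVal i))) ::
      mapData (γ.contractVal i) R) := by
    refine ⟨γ.vert (γ.black i) :: γ.vert (γ.inv (γ.black i)) :: γ.otherVertices i, ?_, ?_,
      List.Forall₂.cons ⟨rfl, h₁.rotate_cons⟩ (List.Forall₂.cons ⟨rfl, h₂⟩ hR)⟩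
    · simp only [List.nodup_cons, List.mem_cons, mem_otherVertices]
      exact ⟨by tauto, by tauto, γ.nodup_otherVertices i⟩
    · intro w
      simp only [List.mem_cons, mem_otherVertices]
      tauto
  have hst := hP.isStable_iff.mp hs
  simp only [List.forall_mem_cons, IsStableEntry] at hst
  refine ⟨_, _, hP, ⟨_, γ.nodup_contract_vertices i, γ.mem_contract_vertices i, ?_⟩,
    Gluing.merge ?_ ?_⟩
  · refine List.Forall₂.cons ⟨?_, vertexWords_contract_glued hLn hLm hLp ?_ ?_⟩
      (forall₂_contract (fun w hw => (γ.mem_otherVertices i).mp hw) hR)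
    · rw [contract_genus, if_neg (by tauto), add_zero]
      refine (Finset.sum_pair (f := γ.genus) hv).symm.trans (Finset.sum_congr ?_ fun _ _ => rfl)
      ext w
      simp only [Finset.mem_insert, Finset.mem_singleton, Finset.mem_filter, Finset.mem_univ,
        true_and, contractMk_eq_iff]
      tauto
    · have hx := (List.forall_mem_cons.mp h₁.cyc)
      have hy := (List.forall_mem_cons.mp h₂.cyc)
      rw [← e, List.forall_mem_cons]
      refine ⟨isCyc_glued_join hx.1 hy.1 hJ, fun w hw => ?_⟩
      have hxw : ∀ z ∈ w, z ≠ γ.black i ∧ z ≠ γ.inv (γ.black i) := fun z hz => hne z (by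
        rw [List.flatten_cons]
        exact List.mem_append_right _ (List.mem_flatten.mpr ⟨w, hw, hz⟩))
      refine isCyc_glued_of_notMem ?_ (fun h => (hxw _ h).1 rfl) (fun h => (hxw _ h).2 rfl)
      exact (List.mem_append.mp hw).elim (hy.2 w) (hx.2 w)
    · rw [newHoles_join (List.forall_mem_cons.mp h₁.cyc).1 (List.forall_mem_cons.mp h₂.cyc).1 hJ,
        Finset.sum_pair hv, ← h₁.holes, ← h₂.holes]
      simp only [List.countP_cons, List.countP_append, List.countP_nil, countP_isEmpty_map,
        List.isEmpty_cons, ← List.map_append, List.isEmpty_map]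
      simp
      omega
  -- Otherwise the surface would be a disk with one half-edge, which is not stable. This is how the
  -- gluing law avoids the default value 0 of the disk with one interval.
  · by_contra! hcon
    obtain ⟨rfl, rfl, hg⟩ := hcon
    have := hst.1.2
    rw [hg] at this
    simp at this
  · by_contra! hcon
    obtain ⟨rfl, rfl, hg⟩ := hcon
    have := hst.2.1.2
    rw [hg] at this
    simp at this

/-- For a loop two cases arise: if `y` lies on the circle of `x`, that circle `x v y u` splits into
`u` and `v`; if it lies on another circle, the two circles join and the genus increases. -/
theorem exists_gluing_of_eq (hv : γ.vert (γ.black i) = γ.vert (γ.inv (γ.black i))) :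
    ∃ D D', γ.Presents D ∧ (γ.contract i).Presents D' ∧
      Gluing (γ.contractVal i) (γ.black i) (γ.inv (γ.black i)) D D' := by
  obtain ⟨R, hR⟩ := γ.exists_otherData i
  obtain ⟨u, ws, h⟩ := (γ.vertexWords_circleWords (γ.vert (γ.black i))).exists_cons rfl
  have hPres : ∀ ws, γ.VertexWords (γ.vert (γ.black i)) ws →
      γ.Presents ((γ.genus (γ.vert (γ.black i)), ws) :: mapData (γ.contractVal i) R) := by
    intro ws hws
    refine ⟨γ.vert (γ.black i) :: γ.otherVertices i, ?_, ?_,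
      List.Forall₂.cons ⟨rfl, hws⟩ hR⟩
    · simp only [List.nodup_cons, mem_otherVertices]
      exact ⟨by tauto, γ.nodup_otherVertices i⟩
    · intro w
      simp only [List.mem_cons, mem_otherVertices, ← hv]
      tauto
  have hgenus : (γ.contract i).genus (γ.contractMk i (γ.vert (γ.black i))) =
      γ.genus (γ.vert (γ.black i)) +
        if γ.next.SameCycle (γ.black i) (γ.inv (γ.black i)) then 0 else 1 := by
    rw [contract_genus]
    congr 1
    · rw [← Finset.sum_singleton γ.genus]
      refine Finset.sum_congr ?_ fun _ _ => rfl
      ext w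
      simp only [Finset.mem_singleton, Finset.mem_filter, Finset.mem_univ,
        true_and, contractMk_eq_iff, ← hv]
      tauto
    · simp [hv]
  have hm : ∀ {ws}, γ.VertexWords (γ.vert (γ.black i)) ws → ∀ z, z ∈ ws.flatten ↔
      (γ.vert z = γ.vert (γ.black i) ∨ γ.vert z = γ.vert (γ.inv (γ.black i))) := fun hws z => by
    rw [hws.mem, ← hv, or_self]
  have hsum : ∑ w ∈ {γ.vert (γ.black i), γ.vert (γ.inv (γ.black i))}, γ.holes w =
      γ.holes (γ.vert (γ.black i)) := by
    rw [← hv, Finset.pair_eq_singleton, Finset.sum_singleton]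
  have hy := (h.mem (γ.inv (γ.black i))).mpr hv.symm
  have hyx : γ.inv (γ.black i) ≠ γ.black i := γ.inv_ne _
  rw [List.flatten_cons, List.cons_append, List.mem_cons, List.mem_append] at hy
  rcases hy.resolve_left hyx with hy | hy
  · obtain ⟨v, u, rfl⟩ := List.append_of_mem hy
    have hN := h.nodup
    rw [List.flatten_cons] at hN
    have hJ := (List.nodup_append.mp hN).1
    have hLp : ((γ.black i :: (v ++ γ.inv (γ.black i) :: u)) :: ws).flatten.Perm
        (γ.black i :: γ.inv (γ.black i) :: (u :: v :: ws).flatten) := by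
      rw [List.perm_iff_count]
      intro a
      simp only [List.flatten_cons, List.count_append, List.count_cons]
      omega
    obtain ⟨hxN, hN2⟩ := List.nodup_cons.mp (hLp.nodup_iff.mp h.nodup)
    have hyN := (List.nodup_cons.mp hN2).1
    have hne : ∀ z ∈ (u :: v :: ws).flatten,
        z ≠ γ.black i ∧ z ≠ γ.inv (γ.black i) := fun z hz =>
      ⟨fun h => hxN (List.mem_cons_of_mem _ (h ▸ hz)), fun h => hyN (h ▸ hz)⟩
    obtain ⟨u, rfl⟩ := exists_map_eq (ι := γ.contractVal i) u fun z hz => (γ.mem_range_contractVal i).mpr <| hne z (by simp [hz])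
    obtain ⟨v, rfl⟩ := exists_map_eq (ι := γ.contractVal i) v fun z hz => (γ.mem_range_contractVal i).mpr <| hne z (by simp [hz])
    obtain ⟨ws, rfl⟩ := exists_map_map_eq (ι := γ.contractVal i) ws fun z hz => (γ.mem_range_contractVal i).mpr <| hne z (by
      rw [List.flatten_cons, List.flatten_cons]; simp [-List.mem_flatten, hz])
    have e : u.map (γ.contractVal i) :: v.map (γ.contractVal i) :: ws.map (List.map (γ.contractVal i)) =
        (u :: v :: ws).map (List.map (γ.contractVal i)) := by simp
    rw [e] at hLp
    have hC := List.forall_mem_cons.mp h.cyc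
    refine ⟨_, _, hPres _ (h.rotate (w' := u.map (γ.contractVal i) ++
      γ.black i :: (v.map (γ.contractVal i) ++ [γ.inv (γ.black i)])) ?_),
      ⟨_, γ.nodup_contract_vertices i, γ.mem_contract_vertices i, ?_⟩, Gluing.split⟩
    · have := List.isRotated_append
        (l := γ.black i :: (v.map (γ.contractVal i) ++ [γ.inv (γ.black i)])) (l' := u.map (γ.contractVal i))
      simpa using this
    refine List.Forall₂.cons ⟨?_, vertexWords_contract_glued h.nodup (hm h) hLp ?_ ?_⟩
      (forall₂_contract (fun w hw => (γ.mem_otherVertices i).mp hw) hR)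
    · rw [hgenus, if_pos (hC.1.sameCycle (by simp)), add_zero]
    · have hsp := isCyc_glued_split hC.1 hJ
      rw [← e, List.forall_mem_cons, List.forall_mem_cons]
      refine ⟨hsp.1, hsp.2, fun w hw => ?_⟩
      have hxw : ∀ z ∈ w, z ≠ γ.black i ∧ z ≠ γ.inv (γ.black i) := fun z hz => hne z (by
        rw [List.flatten_cons, List.flatten_cons]
        exact List.mem_append_right _ (List.mem_append_right _ (List.mem_flatten.mpr ⟨w, hw, hz⟩)))
      exact isCyc_glued_of_notMem (hC.2 w hw) (fun h => (hxw _ h).1 rfl) (fun h => (hxw _ h).2 rfl)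
    · rw [newHoles_split hC.1 hJ, hsum, ← h.holes]
      simp only [List.countP_cons, List.countP_nil, countP_isEmpty_map,
        List.isEmpty_cons, List.isEmpty_map]
      simp
      omega
  · obtain ⟨w, ws', hp, hw⟩ := exists_perm_cons_of_mem_flatten hy
    obtain ⟨v, hr⟩ := isRotated_cons_of_mem hw
    have h := (((h.perm (hp.cons _)).perm (List.Perm.swap _ _ _)).rotate hr).perm
      (List.Perm.swap _ _ _)
    clear hp hw hr hy
    have hLp : ((γ.black i :: u) :: (γ.inv (γ.black i) :: v) :: ws').flatten.Perm
        (γ.black i :: γ.inv (γ.black i) :: ((u ++ v) :: ws').flatten) := by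
      rw [List.perm_iff_count]
      intro a
      simp only [List.flatten_cons, List.count_append, List.count_cons]
      omega
    have hJ : (γ.black i :: (v ++ γ.inv (γ.black i) :: u)).Nodup := by
      have p : ((γ.black i :: u) :: (γ.inv (γ.black i) :: v) :: ws').flatten.Perm
          ((γ.black i :: (v ++ γ.inv (γ.black i) :: u)) ++ ws'.flatten) := by
        rw [List.perm_iff_count]
        intro a
        simp only [List.flatten_cons, List.count_append, List.count_cons]
        omega
      exact (List.nodup_append.mp (p.nodup_iff.mp h.nodup)).1
    obtain ⟨hxN, hN2⟩ := List.nodup_cons.mp (hLp.nodup_iff.mp h.nodup)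
    have hyN := (List.nodup_cons.mp hN2).1
    have hne : ∀ z ∈ ((u ++ v) :: ws').flatten,
        z ≠ γ.black i ∧ z ≠ γ.inv (γ.black i) := fun z hz =>
      ⟨fun h => hxN (List.mem_cons_of_mem _ (h ▸ hz)), fun h => hyN (h ▸ hz)⟩
    obtain ⟨u, rfl⟩ := exists_map_eq (ι := γ.contractVal i) u fun z hz => (γ.mem_range_contractVal i).mpr <| hne z (by simp [hz])
    obtain ⟨v, rfl⟩ := exists_map_eq (ι := γ.contractVal i) v fun z hz => (γ.mem_range_contractVal i).mpr <| hne z (by simp [hz])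
    obtain ⟨ws', rfl⟩ := exists_map_map_eq (ι := γ.contractVal i) ws' fun z hz => (γ.mem_range_contractVal i).mpr <| hne z (by
      rw [List.flatten_cons]; simp [-List.mem_flatten, hz])
    have e : (u.map (γ.contractVal i) ++ v.map (γ.contractVal i)) :: ws'.map (List.map (γ.contractVal i)) =
        ((u ++ v) :: ws').map (List.map (γ.contractVal i)) := by simp
    rw [e] at hLp
    have hC := List.forall_mem_cons.mp h.cyc
    have hC2 := List.forall_mem_cons.mp hC.2
    refine ⟨_, _, hPres _ h.rotate_cons,
      ⟨_, γ.nodup_contract_vertices i, γ.mem_contract_vertices i, ?_⟩, Gluing.handle⟩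
    refine List.Forall₂.cons ⟨?_, vertexWords_contract_glued h.nodup (hm h) hLp ?_ ?_⟩
      (forall₂_contract (fun w hw => (γ.mem_otherVertices i).mp hw) hR)
    · rw [hgenus, if_neg]
      intro hsc
      have h1 := hC.1.mem_of_sameCycle (by simp) hsc
      rcases List.mem_cons.mp h1 with h1 | h1
      · exact hyx h1
      · exact (hne _ (by rw [List.flatten_cons]; simp [-List.mem_map, h1])).2 rfl
    · rw [← e, List.forall_mem_cons]
      refine ⟨isCyc_glued_join hC.1 hC2.1 hJ, fun w hw => ?_⟩
      have hxw : ∀ z ∈ w, z ≠ γ.black i ∧ z ≠ γ.inv (γ.black i) := fun z hz => hne z (by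
        rw [List.flatten_cons]
        exact List.mem_append_right _ (List.mem_flatten.mpr ⟨w, hw, hz⟩))
      exact isCyc_glued_of_notMem (hC2.2 w hw) (fun h => (hxw _ h).1 rfl)
        (fun h => (hxw _ h).2 rfl)
    · rw [newHoles_join hC.1 hC2.1 hJ, hsum, ← h.holes]
      simp only [List.countP_cons, List.countP_nil, countP_isEmpty_map,
        List.isEmpty_cons, ← List.map_append, List.isEmpty_map]
      simp

/-- A presentation of the contracted graph. -/
theorem exists_gluing (hs : γ.IsStable) :
    ∃ D D', γ.Presents D ∧ (γ.contract i).Presents D' ∧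
      Gluing (γ.contractVal i) (γ.black i) (γ.inv (γ.black i)) D D' := by
  by_cases hv : γ.vert (γ.black i) = γ.vert (γ.inv (γ.black i))
  · exact exists_gluing_of_eq hv
  · exact exists_gluing_of_ne hs hv

end Contract

end BWGraph

namespace BWGraph

/-! ## The type of the contracted graph -/

theorem card_orbits_add_countP {X : Type} [Finite X] {f : Equiv.Perm X} {ws : List (List X)}
    (hn : ws.flatten.Nodup) (hm : ∀ x, x ∈ ws.flatten) (hc : ∀ w ∈ ws, IsCyc f w) :
    Fintype.card (Orbits f) + ws.countP List.isEmpty = ws.length := by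
  have h : IsCycleDecomposition f (ws.filter fun w => !w.isEmpty) := by
    refine ⟨?_, ?_, fun w hw => hc w (List.mem_filter.mp hw).1, fun w hw h => ?_⟩
    · rw [List.flatten_filter_not_isEmpty]; exact hn
    · rw [List.flatten_filter_not_isEmpty]; exact hm
    · have := (List.mem_filter.mp hw).2
      simp [h] at this
  have h2 := List.length_eq_countP_add_countP List.isEmpty (l := ws)
  rw [h.card_orbits, ← List.countP_eq_length_filter, h2, add_comm]
  congr 1
  exact List.countP_congr fun w _ => by simp

section

open scoped Classical

/-- The transposition in `glued` cancels against the one that removes the edge from `ι`. So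
contraction changes the boundary permutation `next * inv` of the whole surface only by deleting `x`
and `y` from its cycles. -/
theorem glued_mul {X : Type} (f ι : Equiv.Perm X) {x y : X} (hx : ι x = y) (hy : ι y = x) :
    glued f x y * (Equiv.swap x y * ι) = bypass (bypass (f * ι) x) y := by
  have h1 : f * Equiv.swap x y * (Equiv.swap x y * ι) = f * ι := by
    rw [mul_assoc, ← mul_assoc (Equiv.swap x y), Equiv.swap_mul_self, one_mul]
  have hx' : (Equiv.swap x y * ι) x = x := by simp [hx]
  have hy' : (Equiv.swap x y * ι) y = y := by simp [hy]
  have h2 : bypass (f * Equiv.swap x y) x * (Equiv.swap x y * ι) = bypass (f * ι) x := by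
    rw [bypass, bypass, mul_assoc, h1, ← h1, Equiv.Perm.mul_apply _ (Equiv.swap x y * ι), hx']
  rw [glued, bypass, mul_assoc, h2]
  conv_rhs => rw [bypass, ← h2, Equiv.Perm.mul_apply _ (Equiv.swap x y * ι), hy', h2]

end

section Contract

open scoped Classical

variable {k : ℕ} {γ : BWGraph (k + 1)} {i : Fin (k + 1)}

theorem contractVal_boundary (z : (γ.contract i).H) :
    bypass (bypass (γ.next * γ.inv) (γ.black i)) (γ.inv (γ.black i)) (γ.contractVal i z) =
      γ.contractVal i (((γ.contract i).next * (γ.contract i).inv) z) := by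
  rw [← glued_mul _ _ rfl (γ.inv_inv _), Equiv.Perm.mul_apply, Equiv.Perm.mul_apply]
  have h : Equiv.swap (γ.black i) (γ.inv (γ.black i)) (γ.inv (γ.contractVal i z)) =
      γ.inv (γ.contractVal i z) := by
    refine Equiv.swap_apply_of_ne_of_ne (fun h => ?_) (fun h => z.2.1 (γ.inv.injective h))
    have h1 : γ.contractVal i z = γ.inv (γ.black i) := by rw [← h, γ.inv_inv]
    exact z.2.2 h1
  rw [h]; rfl

/-- The number of orbits of the boundary permutation after a contraction. -/
theorem card_orbits_contract :
    Fintype.card (Orbits ((γ.contract i).next * (γ.contract i).inv)) +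
      newHoles γ.next (γ.black i) (γ.inv (γ.black i)) =
    Fintype.card (Orbits (γ.next * γ.inv)) := by
  -- The words `ws` are the boundary cycles with `x` and `y` deleted; empty words record cycles that
  -- have disappeared.
  have key : ∀ ws : List (List γ.H), ∀ L : List γ.H, L.Nodup → (∀ z, z ∈ L) →
      L.Perm (γ.black i :: γ.inv (γ.black i) :: ws.flatten) →
      (∀ w ∈ ws, IsCyc (bypass (bypass (γ.next * γ.inv) (γ.black i)) (γ.inv (γ.black i))) w) →
      Fintype.card (Orbits ((γ.contract i).next * (γ.contract i).inv)) +
        ws.countP List.isEmpty = ws.length := by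
    intro ws L hL hm hp hc
    have hN := hp.nodup_iff.mp hL
    obtain ⟨hxN, hN2⟩ := List.nodup_cons.mp hN
    obtain ⟨hyN, hN3⟩ := List.nodup_cons.mp hN2
    obtain ⟨ws, rfl⟩ := exists_map_map_eq (ι := γ.contractVal i) ws fun z hz =>
      (γ.mem_range_contractVal i).mpr
        ⟨fun h => hxN (List.mem_cons_of_mem _ (h ▸ hz)), fun h => hyN (h ▸ hz)⟩
    rw [countP_isEmpty_map, List.length_map]
    rw [← List.map_flatten] at hN3 hp
    refine card_orbits_add_countP (hN3.of_map _) (fun z => ?_) fun w hw =>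
      (hc _ (List.mem_map_of_mem hw)).of_map (γ.contractVal_injective i) contractVal_boundary
    rw [← List.mem_map_of_injective (γ.contractVal_injective i)]
    have := hp.mem_iff.mp (hm (γ.contractVal i z))
    rw [List.mem_cons, List.mem_cons] at this
    exact (this.resolve_left z.2.1).resolve_left z.2.2
  have hD := isCycleDecomposition_cycleWord (γ.next * γ.inv)
  rw [hD.card_orbits]
  have hempty := countP_isEmpty_eq_zero hD.ne_nil
  -- In terms of the boundary permutation, the new empty circles are its cycles supported on `{x,
  -- y}`: these are lost as cycles and reappear in `holes`.
  have hnew : newHoles γ.next (γ.black i) (γ.inv (γ.black i)) =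
      (if (γ.next * γ.inv) (γ.black i) = γ.black i then 1 else 0) +
        (if (γ.next * γ.inv) (γ.inv (γ.black i)) = γ.inv (γ.black i) then 1 else 0) +
        (if (γ.next * γ.inv) (γ.black i) = γ.inv (γ.black i) ∧
          (γ.next * γ.inv) (γ.inv (γ.black i)) = γ.black i then 1 else 0) := by
    simp only [newHoles, Equiv.Perm.mul_apply, γ.inv_inv]
    have gen : ∀ (p q r s : Prop) (d₁ : Decidable p) (d₂ : Decidable q) (d₃ : Decidable (r ∧ s))
        (d₄ : Decidable p) (d₅ : Decidable q) (d₆ : Decidable (s ∧ r)),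
        @ite ℕ p d₁ 1 0 + @ite ℕ q d₂ 1 0 + @ite ℕ (r ∧ s) d₃ 1 0 =
          @ite ℕ q d₅ 1 0 + @ite ℕ p d₄ 1 0 + @ite ℕ (s ∧ r) d₆ 1 0 := by
      intros
      split_ifs <;> tauto
    exact gen _ _ _ _ _ _ _ _ _ _
  obtain ⟨hn, hm, hc, -⟩ := hD
  generalize (Finset.univ.toList.map (cycleWord (γ.next * γ.inv))) = ws at *
  have hyx : γ.inv (γ.black i) ≠ γ.black i := γ.inv_ne _
  obtain ⟨w, ws', hp, hw⟩ := exists_perm_cons_of_mem_flatten (hm (γ.black i))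
  obtain ⟨u, hu⟩ := isRotated_cons_of_mem hw
  have hpf : ws.flatten.Perm ((γ.black i :: u) ++ ws'.flatten) :=
    hp.flatten.trans (hu.perm.append_right _)
  have hcu : IsCyc (γ.next * γ.inv) (γ.black i :: u) :=
    (hc w (hp.mem_iff.mpr (by simp))).of_isRotated hu
  have hcw : ∀ w ∈ ws', IsCyc (γ.next * γ.inv) w := fun w hw =>
    hc w (hp.mem_iff.mpr (List.mem_cons_of_mem _ hw))
  have he : ws'.countP List.isEmpty = 0 := by
    rw [hp.countP_eq, List.countP_cons] at hempty
    omega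
  rw [hp.length_eq, List.length_cons]
  clear hp hw hu hc hempty w
  have hN := hpf.nodup_iff.mp hn
  have hy := hpf.mem_iff.mp (hm (γ.inv (γ.black i)))
  rw [List.mem_append, List.mem_cons] at hy
  have hnot : ∀ {w : List γ.H}, w ∈ ws' → ∀ z ∈ w, z ∉ (γ.black i :: u) := fun hw z hz hz' =>
    (List.nodup_append.mp hN).2.2 z hz' z (List.mem_flatten.mpr ⟨_, hw, hz⟩) rfl
  rcases hy with (hy | hy) | hy
  · exact absurd hy hyx
  · obtain ⟨v, u, rfl⟩ := List.append_of_mem hy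
    have hJ := (List.nodup_append.mp hN).1
    have hu' : IsCyc (γ.next * γ.inv) (γ.inv (γ.black i) :: (u ++ γ.black i :: v)) :=
      isCyc_rotate (γ.black i :: v) (γ.inv (γ.black i) :: u) hcu
    have hJ' : (γ.inv (γ.black i) :: (u ++ γ.black i :: v)).Nodup :=
      (List.perm_append_comm (l₁ := γ.black i :: v) (l₂ := γ.inv (γ.black i) :: u)).nodup_iff.mp hJ
    have h1 := key ((u ++ v) :: ws') _ hn hm (hpf.trans (by
      rw [List.perm_iff_count]
      intro a
      simp only [List.flatten_cons, List.count_append, List.count_cons]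
      omega)) (by
      rw [List.forall_mem_cons]
      refine ⟨isCyc_bypass_bypass_same hcu hJ, fun w hw => ?_⟩
      exact isCyc_bypass_bypass_of_notMem (hcw w hw) (fun h => hnot hw _ h (by simp))
        (fun h => hnot hw _ h (by simp)))
    rw [hnew, hcu.apply_eq_self_iff hJ, hu'.apply_eq_self_iff hJ', hcu.apply_eq_iff hJ,
      hu'.apply_eq_iff hJ']
    rw [List.countP_cons, he] at h1
    simp at h1 ⊢
    rw [← h1]
    by_cases h2 : u = [] <;> by_cases h3 : v = [] <;> simp [h2, h3]
  · obtain ⟨w, ws'', hp, hw⟩ := exists_perm_cons_of_mem_flatten hy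
    obtain ⟨v, hv⟩ := isRotated_cons_of_mem hw
    have hpf' : ws'.flatten.Perm ((γ.inv (γ.black i) :: v) ++ ws''.flatten) :=
      hp.flatten.trans (hv.perm.append_right _)
    have hcv : IsCyc (γ.next * γ.inv) (γ.inv (γ.black i) :: v) :=
      (hcw w (hp.mem_iff.mpr (by simp))).of_isRotated hv
    have hN' : ((γ.black i :: u) ++ ((γ.inv (γ.black i) :: v) ++ ws''.flatten)).Nodup :=
      (hpf'.append_left _).nodup_iff.mp hN
    have hJ : (γ.black i :: (v ++ γ.inv (γ.black i) :: u)).Nodup := by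
      have p : ((γ.black i :: u) ++ ((γ.inv (γ.black i) :: v) ++ ws''.flatten)).Perm
          ((γ.black i :: (v ++ γ.inv (γ.black i) :: u)) ++ ws''.flatten) := by
        rw [List.perm_iff_count]
        intro a
        simp only [List.count_append, List.count_cons]
        omega
      exact (List.nodup_append.mp (p.nodup_iff.mp hN')).1
    have hnot' : ∀ {w : List γ.H}, w ∈ ws'' → ∀ z ∈ w, z ∉ (γ.inv (γ.black i) :: v) :=
      fun hw z hz hz' => (List.nodup_append.mp (List.nodup_append.mp hN').2.1).2.2 z hz' z
        (List.mem_flatten.mpr ⟨_, hw, hz⟩) rfl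
    have h1 := key (u :: v :: ws'') _ hn hm (hpf.trans ((hpf'.append_left _).trans (by
      rw [List.perm_iff_count]
      intro a
      simp only [List.flatten_cons, List.count_append, List.count_cons]
      omega))) (by
      rw [List.forall_mem_cons, List.forall_mem_cons]
      refine ⟨(isCyc_bypass_bypass_ne hcu hcv hJ).1, (isCyc_bypass_bypass_ne hcu hcv hJ).2,
        fun w hw => ?_⟩
      have hw' := hp.mem_iff.mpr (List.mem_cons_of_mem _ hw)
      exact isCyc_bypass_bypass_of_notMem (hcw w hw')
        (fun h => hnot hw' _ h (by simp)) (fun h => hnot' hw _ h (by simp)))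
    have hne : (γ.next * γ.inv) (γ.black i) ≠ γ.inv (γ.black i) := fun h => by
      have h2 := hcu.apply_mem (z := γ.black i) (by simp)
      rw [h, List.mem_cons] at h2
      rcases h2 with h2 | h2
      · exact hyx h2
      · have h3 := (List.nodup_cons.mp hJ).2
        exact (List.nodup_cons.mp (List.nodup_append.mp h3).2.1).1 h2
    have hnu : (γ.black i :: u).Nodup := (List.nodup_append.mp hN').1
    have hnv : (γ.inv (γ.black i) :: v).Nodup :=
      (List.nodup_append.mp (List.nodup_append.mp hN').2.1).1
    rw [hnew, if_neg (c := _ ∧ _) fun h => hne h.1, hcu.apply_eq_self_iff hnu,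
      hcv.apply_eq_self_iff hnv]
    rw [hp.countP_eq, List.countP_cons] at he
    rw [List.countP_cons, List.countP_cons] at h1
    rw [hp.length_eq]
    have he' : ws''.countP List.isEmpty = 0 := by omega
    rw [he'] at h1
    by_cases h2 : u = [] <;> by_cases h3 : v = [] <;> simp [h2, h3] at h1 ⊢ <;> omega

theorem sum_holes_contract : ∑ q, (γ.contract i).holes q =
    ∑ v, γ.holes v + newHoles γ.next (γ.black i) (γ.inv (γ.black i)) := by
  simp only [contract_holes]
  rw [Finset.sum_add_distrib]
  congr 1
  · convert Finset.sum_fiberwise Finset.univ (γ.contractMk i) γ.holes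
  · convert Finset.sum_ite_eq' Finset.univ _ _
    simp

theorem isConnected_contract (h : γ.IsConnected) : (γ.contract i).IsConnected := by
  obtain ⟨⟨v₀⟩, h⟩ := h
  refine ⟨⟨γ.contractMk i v₀⟩, fun q r => ?_⟩
  obtain ⟨v, rfl⟩ := γ.contractMk_surjective i q
  obtain ⟨w, rfl⟩ := γ.contractMk_surjective i r
  induction h v w with
  | refl => exact Relation.ReflTransGen.refl
  | @tail a b _ hab ih =>
    obtain ⟨z, rfl, rfl⟩ := hab
    by_cases hz : z ≠ γ.black i ∧ z ≠ γ.inv (γ.black i)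
    · exact ih.tail ⟨⟨z, hz⟩, rfl, rfl⟩
    · have : γ.contractMk i (γ.vert z) = γ.contractMk i (γ.vert (γ.inv z)) := by
        rw [not_and_or, not_not, not_not] at hz
        rcases hz with rfl | rfl
        · exact γ.contractMk_glue i
        · rw [γ.inv_inv]; exact (γ.contractMk_glue i).symm
      rw [← this]; exact ih

/-- A contraction does not change the type of the graph. -/
theorem IsOfType.contract {g n : ℕ} (h : γ.IsOfType g n) (i : Fin (k + 1)) :
    (γ.contract i).IsOfType g n := by
  obtain ⟨hc, hs, hb, he⟩ := h
  obtain ⟨D, D', hD, hD', hG⟩ := exists_gluing (i := i) hs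
  refine ⟨isConnected_contract hc, ?_, ?_, ?_⟩
  · rw [hD'.isStable_iff]
    exact hG.isStableEntry (hD.isStable_iff.mp hs)
  · rw [← hb, totalBoundary, totalBoundary, sum_holes_contract, ← card_orbits_contract (i := i)]
    omega
  · rw [← he, hD'.twiceEuler_eq, hD.twiceEuler_eq, hG.eulerSum_eq, hG.length_eq]
    push_cast
    ring

theorem allBlack_contract_iff : (γ.contract i).AllBlack ↔ γ.AllBlack := by
  constructor
  · intro h z
    by_cases hz : z ≠ γ.black i ∧ z ≠ γ.inv (γ.black i)
    · obtain ⟨j, hj⟩ := h ⟨z, hz⟩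
      exact ⟨i.succAbove j, hj.imp (congrArg (γ.contractVal i)) (congrArg (γ.contractVal i))⟩
    · exact ⟨i, by tauto⟩
  · intro h z
    obtain ⟨j, hj⟩ := h (γ.contractVal i z)
    have hji : j ≠ i := by
      rintro rfl
      exact hj.elim z.2.1 z.2.2
    obtain ⟨j, rfl⟩ := Fin.exists_succAbove_eq hji
    exact ⟨j, hj.imp (fun h => γ.contractVal_injective i h)
      (fun h => γ.contractVal_injective i h)⟩

end Contract

/-! ## The amplitude of the contracted graph -/

theorem finRange_succAbove {k : ℕ} (i : Fin (k + 1)) :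
    ∃ S T, List.finRange k = S ++ T ∧
      List.finRange (k + 1) = S.map i.succAbove ++ i :: T.map i.succAbove := by
  refine ⟨(List.finRange k).take i, (List.finRange k).drop i, (List.take_append_drop _ _).symm, ?_⟩
  refine List.ext_getElem (by simp; omega) fun n h₁ h₂ => ?_
  have hn : n < k + 1 := by simpa using h₁
  have hi := i.2
  rw [List.getElem_append]
  split
  · rename_i h
    have h' : n < i ∧ n < k := by simpa using h
    simp [Fin.succAbove, Fin.lt_def, h'.1]
  · rename_i h
    have h' : ¬ (n < i ∧ n < k) := by simpa using h
    have hni : (i : ℕ) ≤ n := by omega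
    rw [List.getElem_cons]
    have hmin : min (i : ℕ) k = i := by omega
    split
    · rename_i h0
      have h0' : n - min (i : ℕ) k = 0 := by simpa using h0
      simp [Fin.ext_iff]
      omega
    · rename_i h0
      have h0' : ¬ (n - min (i : ℕ) k = 0) := by simpa using h0
      simp [Fin.ext_iff, Fin.succAbove, Fin.lt_def]
      omega

/-- The adjacent pair `x, y` has even total parity and moves to the front for free. Both letters
then pass `M₁`, where their signs cancel, and `y` alone passes `M₂`. -/
theorem koszulSign_remove_pair {X Y : Type} [Fintype X] [Fintype Y] (p : X → ZMod 2)
    (q : Y → ZMod 2) {ι : Y → X} (hι : Function.Injective ι) (hq : ∀ z, p (ι z) = q z) {x y : X}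
    (hxy : p x = p y) {A B M₁ M₂ M₃ : List Y}
    (hn : (A.map ι ++ ([x, y] ++ B.map ι)).Nodup) (h : (A ++ B).Perm (M₁ ++ (M₂ ++ M₃))) :
    koszulSign p (A.map ι ++ ([x, y] ++ B.map ι))
        (M₁.map ι ++ x :: (M₂.map ι ++ y :: M₃.map ι)) =
      sgn (p y * totalParity q M₂) * koszulSign q (A ++ B) (M₁ ++ (M₂ ++ M₃)) := by
  have htp : ∀ M : List Y, totalParity p (M.map ι) = totalParity q M := fun M => by
    rw [totalParity, totalParity, List.map_map]
    congr 1
    exact List.map_congr_left fun z _ => hq z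
  have p1 : (A.map ι ++ ([x, y] ++ B.map ι)).Perm ([x, y] ++ (A.map ι ++ B.map ι)) := by
    rw [← List.append_assoc, ← List.append_assoc]
    exact List.perm_append_comm.append_right _
  have n1 := p1.nodup_iff.mp hn
  have e1 := koszulSign_exchange p (K := []) (L := [x, y]) (M := A.map ι) (N := B.map ι) n1
  simp only [List.nil_append, totalParity_cons, totalParity_nil, hxy, add_zero,
    parity_add_self, zero_mul, sgn_zero] at e1
  have p2 : (A.map ι ++ B.map ι).Perm (M₁.map ι ++ (M₂.map ι ++ M₃.map ι)) := by
    simpa using h.map ι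
  have p3 : (y :: (A.map ι ++ B.map ι)).Perm ((M₁.map ι ++ M₂.map ι) ++ y :: M₃.map ι) := by
    refine (p2.cons y).trans ?_
    rw [← List.append_assoc]
    exact List.perm_middle.symm
  have p4 : (x :: y :: (A.map ι ++ B.map ι)).Perm
      (M₁.map ι ++ x :: (M₂.map ι ++ y :: M₃.map ι)) := by
    refine (p3.cons x).trans ?_
    rw [List.append_assoc]
    exact List.perm_middle.symm
  have n2 : (x :: y :: (A.map ι ++ B.map ι)).Nodup := n1
  have n3 := (List.nodup_cons.mp n2).2
  have n4 : (A ++ B).Nodup := List.Nodup.of_map ι (by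
    rw [List.map_append]; exact (List.nodup_cons.mp n3).2)
  have e2 : koszulSign p ([x, y] ++ (A.map ι ++ B.map ι)) _ *
      koszulSign p _ (M₁.map ι ++ x :: (M₂.map ι ++ y :: M₃.map ι)) = _ :=
    koszulSign_trans p p1.symm p4
  rw [e1, one_mul] at e2
  rw [e2]
  change koszulSign p (x :: y :: (A.map ι ++ B.map ι)) _ = _
  have e3 : koszulSign p (A.map ι ++ B.map ι) (M₁.map ι ++ (M₂.map ι ++ M₃.map ι)) =
      koszulSign q (A ++ B) (M₁ ++ (M₂ ++ M₃)) := by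
    rw [← List.map_append, ← List.map_append, ← List.map_append]
    exact koszulSign_map p q ι hι hq n4 h
  rw [koszulSign_cons p n2 p4, ← List.append_assoc, koszulSign_cons p n3 p3, List.append_assoc, e3,
    totalParity_append, htp, htp, hxy, ← mul_assoc, ← sgn_add]
  congr 2
  have key : ∀ a b c : ZMod 2, a * b + a * (b + c) = a * c := by decide
  exact key _ _ _

/-! ### Labellings of the half-edges, split off at the two ends of an edge. -/

section Label

variable {X Y I : Type} [Fintype X] [Fintype Y] [Fintype I]

open scoped Classical in
/-- Extend a labelling by labels of two further points. -/
noncomputable def extendLabel (ι : Y → X) (x : X) (l : Y → I) (a b : I) (z : X) : I :=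
  if h : z ∈ Set.range ι then l h.choose else if z = x then a else b

variable {ι : Y → X} {x y : X} (l : Y → I) (a b : I)

theorem extendLabel_comp (hι : Function.Injective ι) : extendLabel ι x l a b ∘ ι = l := by
  funext z
  have h : ι z ∈ Set.range ι := ⟨z, rfl⟩
  rw [Function.comp_apply, extendLabel, dif_pos h, hι h.choose_spec]

theorem extendLabel_left (hx : x ∉ Set.range ι) : extendLabel ι x l a b x = a := by
  rw [extendLabel, dif_neg hx, if_pos rfl]

theorem extendLabel_right (hxy : y ≠ x) (hy : y ∉ Set.range ι) : extendLabel ι x l a b y = b := by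
  rw [extendLabel, dif_neg hy, if_neg hxy]

theorem sum_extendLabel (hι : Function.Injective ι) (hxy : y ≠ x)
    (hr : ∀ z, z ∈ Set.range ι ↔ z ≠ x ∧ z ≠ y) [Fintype (X → I)] [Fintype (Y → I)]
    (f : (X → I) → ℝ) :
    ∑ L, f L = ∑ l : Y → I, ∑ a, ∑ b, f (extendLabel ι x l a b) := by
  have hx : x ∉ Set.range ι := fun h => ((hr x).mp h).1 rfl
  have hy : y ∉ Set.range ι := fun h => ((hr y).mp h).2 rfl
  let e : (X → I) ≃ (Y → I) × I × I :=
    { toFun := fun L => (L ∘ ι, L x, L y)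
      invFun := fun t => extendLabel ι x t.1 t.2.1 t.2.2
      left_inv := fun L => by
        funext z
        by_cases hz : z ∈ Set.range ι
        · obtain ⟨w, rfl⟩ := hz
          exact congrFun (extendLabel_comp (L ∘ ι) (L x) (L y) hι) w
        · by_cases hzx : z = x
          · subst hzx; exact extendLabel_left _ _ _ hx
          · have hzy : z = y := by
              by_contra h
              exact hz ((hr z).mpr ⟨hzx, h⟩)
            subst hzy
            exact extendLabel_right _ _ _ hxy hy
      right_inv := fun t => by
        refine Prod.ext (extendLabel_comp _ _ _ hι) (Prod.ext (extendLabel_left _ _ _ hx)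
          (extendLabel_right _ _ _ hxy hy)) }
  rw [← e.symm.sum_comp f]
  rw [Fintype.sum_prod_type]
  refine Finset.sum_congr rfl fun l _ => ?_
  rw [Fintype.sum_prod_type]
  rfl

end Label

section Amplitude

variable {k : ℕ} {γ : BWGraph (k + 1)}
variable {A : Type*} [NonUnitalRing A] [Module ℝ A] [FiniteDimensional ℝ A] {F : DGFrobenius A}
  [IsScalarTower ℝ A A] [SMulCommClass ℝ A A]

theorem exists_blackOrder_eq (i : Fin (k + 1)) : ∃ B₁ B₂ : List (γ.contract i).H,
    (γ.contract i).blackOrder = B₁ ++ B₂ ∧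
      γ.blackOrder = B₁.map (γ.contractVal i) ++
        ([γ.black i, γ.inv (γ.black i)] ++ B₂.map (γ.contractVal i)) := by
  obtain ⟨S, T, h₁, h₂⟩ := finRange_succAbove i
  let b : Fin k → List (γ.contract i).H :=
    fun j => [(γ.contract i).black j, (γ.contract i).inv ((γ.contract i).black j)]
  refine ⟨S.flatMap b, T.flatMap b, ?_, ?_⟩
  · rw [blackOrder, h₁, List.flatMap_append]
  · rw [blackOrder, h₂, List.flatMap_append, List.flatMap_cons, List.flatMap_map, List.flatMap_map,
      List.map_flatMap, List.map_flatMap]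
    rfl

/-- If the inverse inner product is placed on an edge, then the edge can be contracted. -/
theorem AllBlack.amplitude_contract (h : γ.AllBlack) (hs : γ.IsStable) (i : Fin (k + 1))
    (P : Fin (k + 1) → A ⊗[ℝ] A) (hP : P i = F.invForm) :
    γ.amplitude F P 0 = (γ.contract i).amplitude F (fun j => P (i.succAbove j)) 0 := by
  classical
  obtain ⟨D, D', hD, hD', hG⟩ := exists_gluing (i := i) hs
  have h' := allBlack_contract_iff (i := i).mpr h
  rw [h.amplitude_eq hD, h'.amplitude_eq hD']
  obtain ⟨M₁, M₂, M₃, hM, hp, hV⟩ := hG.sum_vertexValue (F := F)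
  obtain ⟨B₁, B₂, hB', hB⟩ := exists_blackOrder_eq (γ := γ) i
  have hι := γ.contractVal_injective i
  have hr := fun z => γ.mem_range_contractVal i (z := z)
  have hyx : γ.inv (γ.black i) ≠ γ.black i := γ.inv_ne _
  have hx : γ.black i ∉ Set.range (γ.contractVal i) := fun h => ((hr _).mp h).1 rfl
  have hy : γ.inv (γ.black i) ∉ Set.range (γ.contractVal i) := fun h => ((hr _).mp h).2 rfl
  have hpB : (B₁ ++ B₂).Perm (halfEdges D') := by
    rw [← hB']
    exact (List.perm_ext_iff_of_nodup (γ.contract i).nodup_blackOrder hD'.nodup_halfEdges).mpr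
      fun z => iff_of_true (h'.mem_blackOrder z) (hD'.mem_halfEdges z)
  rw [sum_extendLabel hι hyx hr]
  refine Finset.sum_congr rfl fun l _ => ?_
  have hL := fun a b => extendLabel_comp (x := γ.black i) l a b hι
  have hLx := fun a b => extendLabel_left l a b hx
  have hLy := fun a b => extendLabel_right l a b hyx hy
  have hV' := hV l (extendLabel (γ.contractVal i) (γ.black i) l) hL hLx hLy hD'.nodup_halfEdges
  -- Everything except the contraction over the labels `a`, `b` at the ends of the edge factors out;
  -- the remaining double sum is evaluated by the gluing law `hV'`.
  have hterm : ∀ a b, koszulSign (labelParity (extendLabel (γ.contractVal i) (γ.black i) l a b))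
      γ.blackOrder (halfEdges D) *
      (∏ j, F.coef (P j) (extendLabel (γ.contractVal i) (γ.black i) l a b (γ.black j))
        (extendLabel (γ.contractVal i) (γ.black i) l a b (γ.inv (γ.black j)))) *
      vertexValue (extendLabel (γ.contractVal i) (γ.black i) l a b) D =
      (koszulSign (labelParity l) (B₁ ++ B₂) (M₁ ++ (M₂ ++ M₃)) *
        ∏ j, F.coef (P (i.succAbove j)) (l ((γ.contract i).black j))
          (l ((γ.contract i).inv ((γ.contract i).black j)))) *
      (F.invGram a b * (sgn (b.1 * totalParity (labelParity l) M₂) *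
        vertexValue (extendLabel (γ.contractVal i) (γ.black i) l a b) D)) := by
    intro a b
    have hprod : ∏ j, F.coef (P j) (extendLabel (γ.contractVal i) (γ.black i) l a b (γ.black j))
        (extendLabel (γ.contractVal i) (γ.black i) l a b (γ.inv (γ.black j))) =
        F.invGram a b * ∏ j, F.coef (P (i.succAbove j)) (l ((γ.contract i).black j))
          (l ((γ.contract i).inv ((γ.contract i).black j))) := by
      rw [Fin.prod_univ_succAbove _ i, hLx, hLy, hP]
      congr 1
      refine Finset.prod_congr rfl fun j _ => ?_
      rw [← congrFun (hL a b) ((γ.contract i).black j),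
        ← congrFun (hL a b) ((γ.contract i).inv ((γ.contract i).black j))]
      rfl
    rw [hprod]
    by_cases hab : F.invGram a b = 0
    · simp [hab]
    have hK := koszulSign_remove_pair
      (labelParity (extendLabel (γ.contractVal i) (γ.black i) l a b)) (labelParity l) hι
      (fun z => by
        rw [labelParity, labelParity]
        exact congrArg Sigma.fst (congrFun (hL a b) z))
      (x := γ.black i) (y := γ.inv (γ.black i))
      (by rw [labelParity, labelParity, hLx, hLy, F.invGram_parity hab])
      (hB ▸ γ.nodup_blackOrder) (hpB.trans hp)
    rw [labelParity, hLy] at hK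
    rw [hB, hM, hK]
    ring
  simp only [hterm, ← Finset.mul_sum]
  rw [hV', hB']
  -- The sign from the edge order to `M₁ M₂ M₃`, followed by the sign left by gluing, is the sign
  -- from the edge order to the vertex order of the contracted graph.
  have e1 := koszulSign_trans (labelParity l) (hpB.trans hp) ((hpB.trans hp).trans
    ((hpB.trans hp).symm.trans hpB))
  rw [koszulSign_comm _ (hp.nodup_iff.mp hD'.nodup_halfEdges) hp.symm] at e1
  linear_combination (∏ j, F.coef (P (i.succAbove j)) (l ((γ.contract i).black j))
    (l ((γ.contract i).inv ((γ.contract i).black j)))) * vertexValue l D' * e1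

end Amplitude

end BWGraph

namespace BWGraph

/-! ## Amplitudes and the differential -/

/-! ### Alternating sums along lists. -/

section AltSum

variable {X : Type} [Fintype X] (p : X → ZMod 2)

/-- The sum of the values of `G` along a list, with Koszul signs for an odd operation. -/
noncomputable def altSum (G : X → ℝ) : List X → ℝ
  | [] => 0
  | x :: L => G x + sgn (p x) * altSum G L

theorem altSum_append (G : X → ℝ) (L M : List X) :
    altSum p G (L ++ M) = altSum p G L + sgn (totalParity p L) * altSum p G M := by
  induction L with
  | nil => simp [altSum, totalParity_nil, sgn_zero]
  | cons x L ih =>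
    rw [List.cons_append, altSum, altSum, ih, totalParity_cons, sgn_add]
    ring

theorem altSum_congr {G G' : X → ℝ} {L : List X} (h : ∀ x ∈ L, G x = G' x) :
    altSum p G L = altSum p G' L := by
  induction L with
  | nil => rfl
  | cons x L ih =>
    rw [altSum, altSum, h x (by simp), ih fun y hy => h y (List.mem_cons_of_mem _ hy)]

theorem altSum_eq_zero {G : X → ℝ} {L : List X} (h : ∀ x ∈ L, G x = 0) : altSum p G L = 0 := by
  induction L with
  | nil => rfl
  | cons x L ih =>
    rw [altSum, h x (by simp), ih fun y hy => h y (List.mem_cons_of_mem _ hy), mul_zero, add_zero]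

theorem altSum_const_mul (c : ℝ) (G : X → ℝ) (L : List X) :
    altSum p (fun x => c * G x) L = c * altSum p G L := by
  induction L with
  | nil => simp [altSum]
  | cons x L ih => rw [altSum, altSum, ih]; ring

theorem altSum_mul_const (c : ℝ) (G : X → ℝ) (L : List X) :
    altSum p (fun x => G x * c) L = altSum p G L * c := by
  simp only [mul_comm _ c, altSum_const_mul]

theorem altSum_map {Y : Type} [Fintype Y] (f : Y → X) (G : X → ℝ) (L : List Y) :
    altSum p G (L.map f) = altSum (p ∘ f) (G ∘ f) L := by
  induction L with
  | nil => rfl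
  | cons x L ih => rw [List.map_cons, altSum, altSum, ih]; rfl

theorem altSum_finRange {n : ℕ} (G : Fin n → ℝ) :
    altSum (fun _ => 1) G (List.finRange n) = ∑ i : Fin n, (-1) ^ (i : ℕ) * G i := by
  induction n with
  | zero => simp [altSum]
  | succ n ih =>
    rw [List.finRange_succ, altSum, altSum_map, Fin.sum_univ_succ]
    have := ih (G ∘ Fin.succ)
    simp only [Function.comp_def] at this ⊢
    rw [this, sgn_one, Finset.mul_sum]
    simp [pow_succ]

/-- Whenever a block contributes, all others are odd, so the sign in front of it just counts the
blocks before it. -/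
theorem altSum_flatMap {ι : Type} [Fintype ι] (b : ι → List X) (G : X → ℝ) {J : List ι} (hJ : J.Nodup)
    (h : ∀ i ∈ J, ∀ j ∈ J, j ≠ i → altSum p G (b i) ≠ 0 → totalParity p (b j) = 1) :
    altSum p G (J.flatMap b) = altSum (fun _ => 1) (fun i => altSum p G (b i)) J := by
  induction J with
  | nil => rfl
  | cons j J ih =>
    have hJ' := List.nodup_cons.mp hJ
    rw [List.flatMap_cons, altSum_append, altSum, ih hJ'.2 fun i hi j hj =>
      h i (List.mem_cons_of_mem _ hi) j (List.mem_cons_of_mem _ hj)]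
    by_cases hj : totalParity p (b j) = 1
    · rw [hj]
    · have h0 : altSum (fun _ => 1) (fun i => altSum p G (b i)) J = 0 := by
        refine altSum_eq_zero _ fun i hi => ?_
        by_contra hne
        exact hj (h i (List.mem_cons_of_mem _ hi) j (by simp)
          (fun hji => hJ'.1 (hji ▸ hi)) hne)
      rw [h0, mul_zero, mul_zero]

open scoped Classical in
/-- The part of a list before an element. -/
noncomputable def before (L : List X) (x : X) : List X := L.takeWhile fun z => z ≠ x

theorem exists_before_append {L : List X} {x : X} (h : x ∈ L) :
    ∃ M, L = before L x ++ x :: M := by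
  classical
  induction L with
  | nil => simp at h
  | cons y L ih =>
    by_cases hyx : y = x
    · subst hyx
      exact ⟨L, by simp [before]⟩
    · obtain ⟨M, hM⟩ := ih ((List.mem_cons.mp h).resolve_left fun h => hyx h.symm)
      refine ⟨M, ?_⟩
      have : before (y :: L) x = y :: before L x := by simp [before, hyx]
      rw [this, List.cons_append, ← hM]

theorem notMem_before {L : List X} {x : X} : x ∉ before L x := fun h => by
  simpa using List.mem_takeWhile_imp h

open scoped Classical in
-- Makes alternating sums along the edge order and along the vertex order comparable term by term.
theorem altSum_eq_sum (G : X → ℝ) {L : List X} (hL : L.Nodup) (hm : ∀ x, x ∈ L) :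
    altSum p G L = ∑ x, sgn (totalParity p (before L x)) * G x := by
  suffices h : altSum p G L = ∑ x ∈ L.toFinset, sgn (totalParity p (before L x)) * G x by
    rw [h]
    exact Finset.sum_congr (by ext; simp [hm]) fun _ _ => rfl
  clear hm
  induction L with
  | nil => simp [altSum]
  | cons y L ih =>
    obtain ⟨hy, hL⟩ := List.nodup_cons.mp hL
    rw [altSum, ih hL, List.toFinset_cons, Finset.sum_insert (by simpa using hy), Finset.mul_sum]
    congr 1
    · have : before (y :: L) y = [] := by simp [before]
      rw [this, totalParity_nil, sgn_zero, one_mul]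
    · refine Finset.sum_congr rfl fun x hx => ?_
      have hyx : y ≠ x := fun h => hy (by simpa [h] using hx)
      have : before (y :: L) x = y :: before L x := by simp [before, hyx]
      rw [this, totalParity_cons, sgn_add, mul_assoc]

end AltSum

/-! ### Closedness of the tensors of the vertices. -/

section Closed

variable {A : Type*} [NonUnitalRing A] [Module ℝ A] [FiniteDimensional ℝ A] {F : DGFrobenius A}

open scoped Classical

theorem map_update_of_notMem {X I : Type} (l : X → I) {x : X} (c : I) {w : List X} (h : x ∉ w) :
    w.map (Function.update l x c) = w.map l :=
  List.map_congr_left fun z hz => by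
    have hzx : z ≠ x := fun hzx => h (hzx ▸ hz)
    rw [Function.update_of_ne hzx]

variable {X : Type} [Fintype X] (l : X → F.Idx)

theorem deriv_map (f : List F.Idx → ℝ) {w : List X} (hw : w.Nodup) :
    F.deriv f (w.map l) = altSum (labelParity l)
      (fun x => ∑ c, F.dCoef c (l x) * f (w.map (Function.update l x c))) w := by
  induction w generalizing f with
  | nil => rfl
  | cons a w ih =>
    obtain ⟨ha, hw⟩ := List.nodup_cons.mp hw
    rw [List.map_cons, DGFrobenius.deriv, altSum, ih _ hw]
    congr 1
    · refine Finset.sum_congr rfl fun c _ => ?_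
      rw [List.map_cons, Function.update_self, map_update_of_notMem _ _ ha]
    · have : sgn (l a).1 = sgn (labelParity l a) := rfl
      rw [this]
      congr 1
      refine altSum_congr _ fun x hx => Finset.sum_congr rfl fun c _ => ?_
      have hax : a ≠ x := fun h => ha (h ▸ hx)
      rw [List.map_cons, Function.update_of_ne hax]

theorem map_map_update_of_notMem {I : Type} (l : X → I) {x : X} (c : I) {ws : List (List X)}
    (h : x ∉ ws.flatten) :
    ws.map (List.map (Function.update l x c)) = ws.map (List.map l) :=
  List.map_congr_left fun w hw => map_update_of_notMem _ _ fun hx =>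
    h (List.mem_flatten.mpr ⟨w, hw, hx⟩)

theorem derivList_map (f : List (List F.Idx) → ℝ) {ws : List (List X)} (hw : ws.flatten.Nodup) :
    F.derivList f (ws.map (List.map l)) = altSum (labelParity l)
      (fun x => ∑ c, F.dCoef c (l x) * f (ws.map (List.map (Function.update l x c))))
      ws.flatten := by
  induction ws generalizing f with
  | nil => rfl
  | cons w ws ih =>
    rw [List.flatten_cons] at hw
    obtain ⟨h1, h2, h3⟩ := List.nodup_append.mp hw
    rw [List.map_cons, DGFrobenius.derivList, ih _ h2, deriv_map l _ h1, List.flatten_cons,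
      altSum_append, parity_map]
    congr 1
    · refine altSum_congr _ fun x hx => Finset.sum_congr rfl fun c _ => ?_
      rw [List.map_cons, map_map_update_of_notMem _ _ fun h => h3 x hx x h rfl]
    · congr 1
      refine altSum_congr _ fun x hx => Finset.sum_congr rfl fun c _ => ?_
      rw [List.map_cons, map_update_of_notMem _ _ fun h => h3 x h x hx rfl]

variable [IsScalarTower ℝ A A] [SMulCommClass ℝ A A]

theorem vertexValue_update_of_notMem {x : X} (c : F.Idx) {D : VertexData X}
    (h : x ∉ halfEdges D) : vertexValue (Function.update l x c) D = vertexValue l D := by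
  rw [vertexValue, vertexValue]
  congr 1
  refine List.map_congr_left fun e he => ?_
  rw [map_map_update_of_notMem _ _ fun hx => h (List.mem_flatMap.mpr ⟨e, he, hx⟩)]

/-- The product of the tensors of the vertices is closed. -/
theorem altSum_vertexValue {D : VertexData X} (hD : (halfEdges D).Nodup) :
    altSum (labelParity l)
      (fun x => ∑ c, F.dCoef c (l x) * vertexValue (Function.update l x c) D) (halfEdges D) = 0 := by
  induction D with
  | nil => rfl
  | cons e D ih =>
    rw [halfEdges_cons] at hD
    obtain ⟨h1, h2, h3⟩ := List.nodup_append.mp hD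
    rw [halfEdges_cons, altSum_append]
    have e1 : altSum (labelParity l)
        (fun x => ∑ c, F.dCoef c (l x) * vertexValue (Function.update l x c) (e :: D))
        e.2.flatten = F.derivList (F.surface e.1) (e.2.map (List.map l)) * vertexValue l D := by
      rw [derivList_map l _ h1, ← altSum_mul_const]
      refine altSum_congr _ fun x hx => ?_
      rw [Finset.sum_mul]
      refine Finset.sum_congr rfl fun c _ => ?_
      rw [vertexValue_cons, vertexValue_update_of_notMem l c fun h => h3 x hx x h rfl, mul_assoc]
    have e2 : altSum (labelParity l)
        (fun x => ∑ c, F.dCoef c (l x) * vertexValue (Function.update l x c) (e :: D))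
        (halfEdges D) = F.surface e.1 (e.2.map (List.map l)) * 0 := by
      rw [← ih h2, ← altSum_const_mul]
      refine altSum_congr _ fun x hx => ?_
      rw [Finset.mul_sum]
      refine Finset.sum_congr rfl fun c _ => ?_
      rw [vertexValue_cons, map_map_update_of_notMem _ _ fun h => h3 x h x hx rfl]
      ring
    rw [e1, e2, F.derivList_surface, zero_mul, mul_zero, mul_zero, add_zero]

end Closed

/-! ### The differential on the edges and summation by parts. -/

section Edges

variable {k : ℕ} {γ : BWGraph k}
variable {A : Type*} [NonUnitalRing A] [Module ℝ A] [FiniteDimensional ℝ A] {F : DGFrobenius A}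
  (h : HodgeDecomposition F)

open scoped Classical

/-- The differential of the product of the propagators. -/
theorem altSum_propagator (hπ : h.π = 0) (l : γ.H → F.Idx) :
    altSum (labelParity l) (fun x => ∑ c, F.dCoef (l x) c *
        ∏ j, F.coef h.propagator (Function.update l x c (γ.black j))
          (Function.update l x c (γ.inv (γ.black j)))) γ.blackOrder =
      ∑ i : Fin k, (-1) ^ (i : ℕ) * ∏ j, F.coef
        (Function.update (fun _ => h.propagator) i F.invForm j) (l (γ.black j))
          (l (γ.inv (γ.black j))) := by
  -- On the two halves of one edge the differential acts on one propagator only and turns it into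
  -- the inverse inner product.
  have hblock : ∀ i, altSum (labelParity l) (fun x => ∑ c, F.dCoef (l x) c *
        ∏ j, F.coef h.propagator (Function.update l x c (γ.black j))
          (Function.update l x c (γ.inv (γ.black j)))) [γ.black i, γ.inv (γ.black i)] =
      F.invGram (l (γ.black i)) (l (γ.inv (γ.black i))) *
        ∏ j ∈ Finset.univ.erase i, F.coef h.propagator (l (γ.black j))
          (l (γ.inv (γ.black j))) := by
    intro i
    have hyx : γ.inv (γ.black i) ≠ γ.black i := γ.inv_ne _
    have hne : ∀ j ∈ Finset.univ.erase i, γ.black j ≠ γ.black i ∧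
        γ.black j ≠ γ.inv (γ.black i) ∧ γ.inv (γ.black j) ≠ γ.black i ∧
        γ.inv (γ.black j) ≠ γ.inv (γ.black i) := fun j hj => by
      have hji := (Finset.mem_erase.mp hj).1
      exact ⟨fun h => hji (γ.black_injective h), γ.black_ne_inv _ _,
        fun h => γ.black_ne_inv _ _ h.symm,
        fun h => hji (γ.black_injective (γ.inv.injective h))⟩
    have h1 : ∀ c, ∏ j, F.coef h.propagator (Function.update l (γ.black i) c (γ.black j))
          (Function.update l (γ.black i) c (γ.inv (γ.black j))) =
        F.coef h.propagator c (l (γ.inv (γ.black i))) * ∏ j ∈ Finset.univ.erase i,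
          F.coef h.propagator (l (γ.black j)) (l (γ.inv (γ.black j))) := by
      intro c
      rw [← Finset.mul_prod_erase _ _ (Finset.mem_univ i), Function.update_self,
        Function.update_of_ne hyx]
      congr 1
      refine Finset.prod_congr rfl fun j hj => ?_
      rw [Function.update_of_ne (hne j hj).1, Function.update_of_ne (hne j hj).2.2.1]
    have h2 : ∀ c, ∏ j, F.coef h.propagator
          (Function.update l (γ.inv (γ.black i)) c (γ.black j))
          (Function.update l (γ.inv (γ.black i)) c (γ.inv (γ.black j))) =
        F.coef h.propagator (l (γ.black i)) c * ∏ j ∈ Finset.univ.erase i,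
          F.coef h.propagator (l (γ.black j)) (l (γ.inv (γ.black j))) := by
      intro c
      rw [← Finset.mul_prod_erase _ _ (Finset.mem_univ i), Function.update_self,
        Function.update_of_ne hyx.symm]
      congr 1
      refine Finset.prod_congr rfl fun j hj => ?_
      rw [Function.update_of_ne (hne j hj).2.1, Function.update_of_ne (hne j hj).2.2.2]
    simp only [altSum, h1, h2, ← mul_assoc, ← Finset.sum_mul, mul_zero, add_zero]
    rw [← add_mul, ← h.dCoef_propagator hπ]
    rfl
  rw [blackOrder, altSum_flatMap _ _ _ (List.nodup_finRange k), altSum_finRange]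
  · refine Finset.sum_congr rfl fun i _ => ?_
    rw [hblock, ← Finset.mul_prod_erase _ _ (Finset.mem_univ i), Function.update_self]
    congr 2
    refine Finset.prod_congr rfl fun j hj => ?_
    rw [Function.update_of_ne (Finset.mem_erase.mp hj).1]
  -- A contribution from edge `i` requires nonzero propagators on all other edges, and these have
  -- odd total parity.
  · intro i _ j _ hji hne
    rw [hblock] at hne
    have h3 := Finset.prod_ne_zero_iff.mp (right_ne_zero_of_mul hne) j
      (Finset.mem_erase.mpr ⟨hji, Finset.mem_univ _⟩)
    rw [totalParity_cons, totalParity_cons, totalParity_nil, add_zero]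
    exact h.coef_propagator_parity h3

/-- Exchanging the label at `x` with a replacement `c` is an involution of pairs (labelling, label).
This is summation by parts at one half-edge. -/
theorem sum_update_comm {X I : Type} [Fintype X] [Fintype I] (x : X)
    (f : (X → I) → I → (X → I) → I → ℝ) :
    ∑ l : X → I, ∑ c, f l (l x) (Function.update l x c) c =
      ∑ l : X → I, ∑ c, f (Function.update l x c) c l (l x) := by
  let g : (X → I) × I → (X → I) × I := fun t => (Function.update t.1 x t.2, t.1 x)
  have hg : Function.Involutive g := fun t => by simp [g]
  have h1 := Equiv.sum_comp hg.toPerm fun t : (X → I) × I =>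
    f (Function.update t.1 x t.2) t.2 t.1 (t.1 x)
  rw [Fintype.sum_prod_type, Fintype.sum_prod_type] at h1
  rw [← h1]
  refine Finset.sum_congr rfl fun l _ => Finset.sum_congr rfl fun c _ => ?_
  simp [g]

variable [IsScalarTower ℝ A A] [SMulCommClass ℝ A A]

/-- The amplitude with propagators on all edges is closed. -/
theorem AllBlack.sum_amplitude_eq_zero (hγ : γ.AllBlack) (hπ : h.π = 0) :
    ∑ i : Fin k, (-1) ^ (i : ℕ) *
      γ.amplitude F (Function.update (fun _ => h.propagator) i F.invForm) 0 = 0 := by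
  have hD := γ.presents_standardData
  generalize γ.standardData = D at hD
  let K : (γ.H → F.Idx) → ℝ := fun l => koszulSign (labelParity l) γ.blackOrder (halfEdges D)
  let W : (γ.H → F.Idx) → ℝ := fun l =>
    ∏ j, F.coef h.propagator (l (γ.black j)) (l (γ.inv (γ.black j)))
  have hp : γ.blackOrder.Perm (halfEdges D) :=
    (List.perm_ext_iff_of_nodup γ.nodup_blackOrder hD.nodup_halfEdges).mpr fun x =>
      iff_of_true (hγ.mem_blackOrder x) (hD.mem_halfEdges x)
  have h1 : ∑ i : Fin k, (-1) ^ (i : ℕ) *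
      γ.amplitude F (Function.update (fun _ => h.propagator) i F.invForm) 0 =
      ∑ l : γ.H → F.Idx, K l * vertexValue l D * altSum (labelParity l)
        (fun x => ∑ c, F.dCoef (l x) c * W (Function.update l x c)) γ.blackOrder := by
    simp only [W, altSum_propagator h hπ, hγ.amplitude_eq hD, Finset.mul_sum]
    rw [Finset.sum_comm]
    exact Finset.sum_congr rfl fun l _ => Finset.sum_congr rfl fun i _ => by ring
  have h2 : ∑ l : γ.H → F.Idx, K l * W l * altSum (labelParity l)
      (fun x => ∑ c, F.dCoef c (l x) * vertexValue (Function.update l x c) D) (halfEdges D) = 0 :=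
    Finset.sum_eq_zero fun l _ => by
      rw [altSum_vertexValue l hD.nodup_halfEdges, mul_zero]
  rw [h1, ← h2]
  simp only [altSum_eq_sum _ _ γ.nodup_blackOrder hγ.mem_blackOrder,
    altSum_eq_sum _ _ hD.nodup_halfEdges hD.mem_halfEdges, Finset.mul_sum]
  refine Finset.sum_comm.trans (Eq.trans ?_ Finset.sum_comm)
  refine Finset.sum_congr rfl fun x _ => ?_
  -- The differential at `x` passes from the vertex tensors to the edge tensors, so that both sums
  -- have the same terms up to sign.
  have h3 := sum_update_comm x fun (l' : γ.H → F.Idx) c' l c => K l' * W l' *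
    (sgn (totalParity (labelParity l') (before (halfEdges D) x)) *
      (F.dCoef c c' * vertexValue l D))
  rw [h3]
  refine Finset.sum_congr rfl fun l _ => Finset.sum_congr rfl fun c _ => ?_
  by_cases hd : F.dCoef (l x) c = 0
  · simp [hd]
  obtain ⟨L₂, hL⟩ := exists_before_append (hγ.mem_blackOrder x)
  obtain ⟨M₂, hM⟩ := exists_before_append (hD.mem_halfEdges x)
  have hq : ∀ y, y ≠ x → labelParity l y = labelParity (Function.update l x c) y := fun y hy => by
    rw [labelParity, labelParity, Function.update_of_ne hy]
  -- As `d` is odd, the two labellings differ in parity exactly at `x`; the change of the Koszul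
  -- sign compensates for the different positions of `x` in the edge order and the vertex order.
  have h4 := koszulSign_flip (labelParity (Function.update l x c)) (q := labelParity l) (x := x)
    (by rw [labelParity, labelParity, Function.update_self, F.dCoef_parity hd]) hq
    (hL ▸ γ.nodup_blackOrder) (hL ▸ hM ▸ hp)
  rw [← hL, ← hM] at h4
  have h5 : totalParity (labelParity (Function.update l x c)) (before γ.blackOrder x) =
      totalParity (labelParity l) (before γ.blackOrder x) := by
    rw [totalParity, totalParity]
    congr 1
    exact List.map_congr_left fun y hy => (hq y fun hyx => notMem_before (hyx ▸ hy)).symm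
  rw [h5] at h4
  simp only [K]
  linear_combination -(W (Function.update l x c) * F.dCoef (l x) c * vertexValue l D) * h4

end Edges

end BWGraph

/-! ## The heat kernel of a contractible algebra -/

/-- Needed so that the sum of the exponential series in `expEnd` is unique and `HasSum` determines
it. -/
theorem t2Space_moduleTopology (W : Type*) [AddCommGroup W] [Module ℝ W] [FiniteDimensional ℝ W] :
    @T2Space W (moduleTopology ℝ W) := by
  let _ : TopologicalSpace W := moduleTopology ℝ W
  have : IsModuleTopology ℝ W := ⟨rfl⟩
  exact T2Space.of_injective_continuous (Module.finBasis ℝ W).equivFun.injective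
    (IsModuleTopology.continuous_of_linearMap (Module.finBasis ℝ W).equivFun.toLinearMap)

section

variable {A : Type*} [NonUnitalRing A] [Module ℝ A] [FiniteDimensional ℝ A]

theorem expEnd_smul_one (c : ℝ) : expEnd (c • (1 : Module.End ℝ A)) = Real.exp c • 1 := by
  let _ : TopologicalSpace (Module.End ℝ A) := moduleTopology ℝ (Module.End ℝ A)
  have : IsModuleTopology ℝ (Module.End ℝ A) := ⟨rfl⟩
  have : IsTopologicalRing (Module.End ℝ A) := IsModuleTopology.isTopologicalRing ℝ _
  have : T2Space (Module.End ℝ A) := t2Space_moduleTopology _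
  change NormedSpace.exp (c • (1 : Module.End ℝ A)) = _
  rw [NormedSpace.exp_eq_tsum ℝ]
  have h : HasSum (fun n : ℕ => ((n.factorial : ℝ)⁻¹ • c ^ n) • (1 : Module.End ℝ A))
      (Real.exp c • 1) := by
    refine HasSum.smul_const ?_ _
    rw [Real.exp_eq_exp_ℝ]
    exact NormedSpace.exp_series_hasSum_exp' c
  have h2 := h.tsum_eq
  simp only [smul_pow, one_pow]
  simpa only [smul_smul, smul_eq_mul] using h2

namespace HodgeDecomposition

variable {F : DGFrobenius A} (h : HodgeDecomposition F)

theorem π_eq_zero (hF : F.Contractible) : h.π = 0 := by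
  ext a
  obtain ⟨b, hb⟩ := hF (h.π a) (h.d_π a)
  rw [LinearMap.zero_apply, ← h.π_π a, ← hb, h.π_d]

theorem laplacian_eq_one (hπ : h.π = 0) : h.laplacian = 1 := by
  ext a
  have := h.homotopy a
  rw [hπ, LinearMap.zero_apply, sub_zero] at this
  exact this

theorem heatKernel_eq (hπ : h.π = 0) (t : ℝ) : h.heatKernel t = Real.exp (-t) • F.invForm := by
  rw [heatKernel, h.laplacian_eq_one hπ, expEnd_smul_one, LinearMap.rTensor_smul,
    LinearMap.smul_apply]
  congr 1
  exact LinearMap.congr_fun (LinearMap.rTensor_id A A) F.invForm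

theorem heatKernelDt_eq (hπ : h.π = 0) (t : ℝ) :
    h.heatKernelDt t = Real.exp (-t) • h.propagator := by
  rw [heatKernelDt, h.heatKernel_eq hπ, map_smul, propagator]

theorem kernelAtInfinity_eq_zero (hπ : h.π = 0) : h.kernelAtInfinity = 0 := by
  rw [kernelAtInfinity, hπ, LinearMap.rTensor_zero, LinearMap.zero_apply]

theorem tendsto_heatKernel (hπ : h.π = 0) :
    Tendsto h.heatKernel atTop (@nhds (A ⊗[ℝ] A) (moduleTopology ℝ (A ⊗[ℝ] A)) 0) := by
  let _ : TopologicalSpace (A ⊗[ℝ] A) := moduleTopology ℝ (A ⊗[ℝ] A)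
  have : IsModuleTopology ℝ (A ⊗[ℝ] A) := ⟨rfl⟩
  have h1 : Tendsto (fun t : ℝ => Real.exp (-t) • F.invForm) atTop (𝓝 ((0 : ℝ) • F.invForm)) :=
    Real.tendsto_exp_neg_atTop_nhds_zero.smul_const _
  rw [zero_smul] at h1
  exact h1.congr fun t => (h.heatKernel_eq hπ t).symm

end HodgeDecomposition

end

namespace BWGraph

/-! ## The integrals -/

section Integral

variable {k : ℕ} (γ : BWGraph k)
variable {A : Type*} [NonUnitalRing A] [Module ℝ A] [FiniteDimensional ℝ A] {F : DGFrobenius A}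

theorem amplitude_smul (c : Fin k → ℝ) (P : Fin k → A ⊗[ℝ] A) (Q : A ⊗[ℝ] A) :
    γ.amplitude F (fun i => c i • P i) Q = (∏ i, c i) * γ.amplitude F P Q := by
  simp only [amplitude, F.coef_smul, Finset.prod_mul_distrib, Finset.mul_sum]
  exact Finset.sum_congr rfl fun l _ => by ring

theorem dtWedge_id : dtWedge (id : Fin k → Fin k) (fun i => Pi.single i 1) = 1 := by
  have h1 : Matrix.of (fun i => (Pi.single i 1 : Fin k → ℝ)) = 1 := by
    ext i j
    simp [Matrix.one_apply, Pi.single_apply, eq_comm]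
  change (Matrix.of fun i => (Pi.single i 1 : Fin k → ℝ)).det = 1
  rw [h1, Matrix.det_one]

theorem orderEmbedding_fin_eq_refl (e : Fin k ↪o Fin k) : e = RelEmbedding.refl _ := by
  have h : ⇑e = id := (StrictMono.range_inj e.strictMono strictMono_id).mp (by
    rw [(Finite.injective_iff_surjective.mp e.injective).range_eq, Set.range_id])
  ext i
  rw [h]; rfl

/-- In top degree every black edge must contribute its `dt` component, which is `e^{-t_i}` times the
propagator; multilinearity pulls the exponentials out. -/
theorem omegaTop_eq (h : HodgeDecomposition F) (hπ : h.π = 0) (t : Fin k → ℝ) :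
    γ.omegaTop h t = (-1) ^ (k * (k - 1) / 2) * γ.amplitude F (fun _ => h.propagator) 0 *
      ∏ i, Real.exp (-t i) := by
  rw [omegaTop, omega,
    Fintype.sum_eq_single (RelEmbedding.refl _) fun e he =>
      absurd (orderEmbedding_fin_eq_refl e) he, AlternatingMap.smul_apply]
  have h1 : dtWedge ⇑(RelEmbedding.refl (· ≤ ·) : Fin k ↪o Fin k)
      (fun i => Pi.single i (1 : ℝ)) = 1 := dtWedge_id
  have h2 : ∀ i, i ∈ Set.range ⇑(RelEmbedding.refl (· ≤ ·) : Fin k ↪o Fin k) := fun i => ⟨i, rfl⟩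
  simp only [h2, if_true, h.heatKernelDt_eq hπ, h.kernelAtInfinity_eq_zero hπ]
  rw [h1, amplitude_smul γ (fun i => Real.exp (-t i)) fun _ => h.propagator, smul_eq_mul]
  ring

theorem restrict_nonneg :
    (volume : Measure (Fin k → ℝ)).restrict {t | ∀ i, 0 ≤ t i} =
      Measure.pi fun _ => volume.restrict (Set.Ici 0) := by
  have : {t : Fin k → ℝ | ∀ i, 0 ≤ t i} = Set.univ.pi fun _ => Set.Ici 0 := by
    ext t; simp
    rfl
  rw [this, volume_pi, Measure.restrict_pi_pi]

theorem integrableOn_prod_exp :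
    IntegrableOn (fun t : Fin k → ℝ => ∏ i, Real.exp (-t i)) {t | ∀ i, 0 ≤ t i} volume := by
  rw [IntegrableOn, restrict_nonneg]
  refine Integrable.fintype_prod (f := fun _ s => Real.exp (-s)) fun _ => ?_
  have := integrableOn_exp_neg_Ioi 0
  rwa [← integrableOn_Ici_iff_integrableOn_Ioi] at this

theorem integral_prod_exp :
    ∫ t in {t : Fin k → ℝ | ∀ i, 0 ≤ t i}, ∏ i, Real.exp (-t i) = 1 := by
  rw [restrict_nonneg, integral_fintype_prod_eq_prod (fun _ s => Real.exp (-s))]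
  refine Finset.prod_eq_one fun _ _ => ?_
  rw [integral_Ici_eq_integral_Ioi, integral_exp_neg_Ioi_zero]

theorem integrableOn_omegaTop (h : HodgeDecomposition F) (hπ : h.π = 0) :
    IntegrableOn (γ.omegaTop h) {t | ∀ i, 0 ≤ t i} volume := by
  have : γ.omegaTop h = fun t => (-1) ^ (k * (k - 1) / 2) *
      γ.amplitude F (fun _ => h.propagator) 0 * ∏ i, Real.exp (-t i) :=
    funext fun t => γ.omegaTop_eq h hπ t
  rw [this]
  exact integrableOn_prod_exp.const_mul _

open scoped Classical in
theorem integralCochain_eq (h : HodgeDecomposition F) (hπ : h.π = 0) (g n : ℕ) :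
    integralCochain h g n k γ = if γ.IsOfType g n then
      (-1) ^ (k * (k - 1) / 2) * γ.amplitude F (fun _ => h.propagator) 0 else 0 := by
  rw [integralCochain]
  congr 1
  simp only [γ.omegaTop_eq h hπ]
  rw [integral_const_mul, integral_prod_exp, mul_one]

variable {γ} in
theorem integralCochain_eq_zero (h : HodgeDecomposition F) (hπ : h.π = 0) (g n : ℕ)
    (hγ : ¬ (γ.IsOfType g n ∧ γ.AllBlack)) : integralCochain h g n k γ = 0 := by
  rw [integralCochain_eq γ h hπ]
  split_ifs with ht
  · rw [amplitude_eq_zero fun hb => hγ ⟨ht, hb⟩, mul_zero]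
  · rfl

end Integral

/-! ## Graphs with a white loop -/

/-- The graph with a single vertex and a single white loop. -/
def whiteLoop (f : Equiv.Perm Bool) (g m : ℕ) : BWGraph 0 where
  H := Bool
  V := Unit
  vert _ := ()
  inv := Equiv.boolNot
  inv_inv x := by simp
  inv_ne x := by simp
  next := f
  vert_next _ := rfl
  genus _ := g
  holes _ := m
  black := Fin.elim0
  black_injective i := i.elim0
  black_ne_inv i := i.elim0

theorem not_allBlack_whiteLoop (f : Equiv.Perm Bool) (g m : ℕ) :
    ¬ (whiteLoop f g m).AllBlack := fun h => (h true).choose.elim0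

theorem isOfType_whiteLoop {f : Equiv.Perm Bool} {g m g' n : ℕ} {ws bs : List (List Bool)}
    (hws : IsCycleDecomposition f ws)
    (hbs : IsCycleDecomposition (f * Equiv.boolNot : Equiv.Perm Bool) bs)
    (hs : 2 < 2 * (2 * g + (ws.length + m) - 1) + 2) (hw : 1 ≤ ws.length)
    (hb : bs.length + m = n)
    (he : 2 * (2 - 2 * (g : ℤ) - (ws.length + m : ℕ)) - 2 = 2 * (2 - 2 * (g' : ℤ) - n)) :
    (whiteLoop f g m).IsOfType g' n := by
  have hfl : (ws ++ List.replicate m ([] : List Bool)).flatten = ws.flatten := by simp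
  have hlen : (ws ++ List.replicate m ([] : List Bool)).flatten.length = 2 := by
    rw [hfl, ← card_subtype_eq_length (q := fun _ => True) hws.nodup
      (fun x => iff_of_true (hws.mem x) trivial)]
    simp
  have hcount : (ws ++ List.replicate m ([] : List Bool)).countP List.isEmpty = m := by
    rw [List.countP_append, countP_isEmpty_eq_zero hws.ne_nil]
    simp [List.countP_replicate]
  have hcard : (ws ++ List.replicate m ([] : List Bool)).length = ws.length + m := by simp
  have hP : (whiteLoop f g m).Presents [(g, ws ++ List.replicate m ([] : List Bool))] := by
    refine ⟨[()], List.nodup_singleton _, fun _ => List.mem_cons_self,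
      List.Forall₂.cons ⟨rfl, ?_, ?_, ?_, ?_⟩ List.Forall₂.nil⟩
    · exact hfl ▸ hws.nodup
    · exact fun x => iff_of_true (hfl ▸ hws.mem x) rfl
    · intro w hw
      rcases List.mem_append.mp hw with hw | hw
      · exact hws.cyc w hw
      · rw [List.eq_of_mem_replicate hw]; trivial
    · exact hcount
  refine ⟨⟨⟨()⟩, fun _ _ => Relation.ReflTransGen.refl⟩, ?_, ?_, ?_⟩
  · rw [hP.isStable_iff]
    intro e he
    rw [List.mem_singleton.mp he]
    change 1 ≤ (ws ++ List.replicate m ([] : List Bool)).length ∧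
      2 < 2 * (2 * g + (ws ++ List.replicate m ([] : List Bool)).length - 1) +
        (ws ++ List.replicate m ([] : List Bool)).flatten.length
    rw [hlen, hcard]
    exact ⟨by omega, hs⟩
  · rw [totalBoundary, hP.sum_holes]
    have h1 : Fintype.card (Orbits ((whiteLoop f g m).next * (whiteLoop f g m).inv)) =
        bs.length := hbs.card_orbits
    have h2 : holesCount [(g, ws ++ List.replicate m ([] : List Bool))] = m := by
      simp [holesCount, hcount]
    exact h1 ▸ h2.symm ▸ hb
  · rw [hP.twiceEuler_eq, ← he]
    have h1 : eulerSum [(g, ws ++ List.replicate m ([] : List Bool))] =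
        2 - 2 * (g : ℤ) - (ws.length + m : ℕ) := by
      simp [eulerSum]
    have h2 : (halfEdges [(g, ws ++ List.replicate m ([] : List Bool))]).length = 2 := by
      rw [← hlen]; simp [halfEdges]
    exact congrArg₂ (fun (a : ℤ) (b : ℕ) => 2 * a - (b : ℤ)) h1 h2

theorem isCycleDecomposition_one :
    IsCycleDecomposition (1 : Equiv.Perm Bool) [[false], [true]] where
  nodup := by simp
  mem x := by cases x <;> simp
  cyc := by
    simp only [List.mem_cons, List.not_mem_nil, or_false]
    rintro w (rfl | rfl) <;>
      exact List.isChain_cons_cons.mpr ⟨rfl, List.isChain_singleton _⟩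
  ne_nil := by simp

theorem isCycleDecomposition_boolNot :
    IsCycleDecomposition (Equiv.boolNot : Equiv.Perm Bool) [[false, true]] where
  nodup := by simp
  mem x := by cases x <;> simp
  cyc := by
    simp only [List.mem_cons, List.not_mem_nil, or_false]
    rintro w rfl
    exact List.isChain_cons_cons.mpr ⟨rfl, List.isChain_cons_cons.mpr
      ⟨rfl, List.isChain_singleton _⟩⟩
  ne_nil := by simp

/-- For `n = 1` necessarily `g ≥ 1`, and a white loop joins the two circles of a surface of genus `g
- 1`. For `n ≥ 2` the loop has both ends on one circle, which it splits, and the other `n - 2`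
circles are empty. -/
theorem exists_not_allBlack {g n : ℕ} (hn : 1 ≤ n) (hgn : 2 < 2 * g + n) :
    ∃ γ : BWGraph 0, γ.IsOfType g n ∧ ¬ γ.AllBlack := by
  by_cases h : n = 1
  · refine ⟨whiteLoop 1 (g - 1) 0, ?_, not_allBlack_whiteLoop _ _ _⟩
    refine isOfType_whiteLoop isCycleDecomposition_one
      (by rw [one_mul]; exact isCycleDecomposition_boolNot) ?_ ?_ ?_ ?_ <;>
      simp only [List.length_cons, List.length_nil] <;> omega
  · refine ⟨whiteLoop Equiv.boolNot g (n - 2), ?_, not_allBlack_whiteLoop _ _ _⟩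
    have h1 : (Equiv.boolNot * Equiv.boolNot : Equiv.Perm Bool) = 1 := by ext x; cases x <;> rfl
    refine isOfType_whiteLoop isCycleDecomposition_boolNot
      (by rw [h1]; exact isCycleDecomposition_one) ?_ ?_ ?_ ?_ <;>
      simp only [List.length_cons, List.length_nil] <;> omega

/-! ## The cocycle -/

section Cocycle

variable {A : Type*} [NonUnitalRing A] [Module ℝ A] [FiniteDimensional ℝ A] {F : DGFrobenius A}
  [IsScalarTower ℝ A A] [SMulCommClass ℝ A A] (h : HodgeDecomposition F)

theorem integralCochain_iso (hπ : h.π = 0) (g n : ℕ) {k : ℕ} {γ γ' : BWGraph k} (φ : Iso γ γ') :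
    integralCochain h g n k γ' =
      ((Equiv.Perm.sign φ.perm : ℤ) : ℝ) * integralCochain h g n k γ := by
  rw [integralCochain_eq γ h hπ, integralCochain_eq γ' h hπ, φ.amplitude_eq h]
  by_cases ht : γ.IsOfType g n
  · rw [if_pos ht, if_pos (φ.isOfType ht)]; ring
  · rw [if_neg ht, if_neg (mt φ.isOfType_iff.mpr ht), mul_zero]

theorem isCochainInf_integralCochain (hπ : h.π = 0) (g n : ℕ) :
    IsCochainInf g n (integralCochain h g n) :=
  ⟨fun _ _ hγ => if_neg hγ, fun _ _ _ φ => integralCochain_iso h hπ g n φ⟩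

/-- All contractions have `k` black edges, so the sign `(-1)^(k(k-1)/2)` is a common factor, and the
alternating sum is that of `sum_amplitude_eq_zero` after placing the inverse inner product on the
contracted edge. -/
theorem sum_integralCochain_contract (hπ : h.π = 0) {g n k : ℕ} {γ : BWGraph (k + 1)}
    (hγ : γ.IsOfType g n) :
    ∑ i : Fin (k + 1), (-1) ^ (i : ℕ) * integralCochain h g n k (γ.contract i) = 0 := by
  by_cases hb : γ.AllBlack
  · have h1 : ∀ i, integralCochain h g n k (γ.contract i) = (-1) ^ (k * (k - 1) / 2) *
        γ.amplitude F (Function.update (fun _ => h.propagator) i F.invForm) 0 := by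
      intro i
      rw [integralCochain_eq _ h hπ, if_pos (hγ.contract i),
        hb.amplitude_contract hγ.2.1 i _ (Function.update_self _ _ _)]
      congr 2
      funext j
      rw [Function.update_of_ne (Fin.succAbove_ne i j)]
    have h2 := hb.sum_amplitude_eq_zero h hπ
    have h3 := congrArg (fun r => (-1) ^ (k * (k - 1) / 2) * r) h2
    simp only [mul_zero, Finset.mul_sum] at h3
    rw [← h3]
    exact Finset.sum_congr rfl fun i _ => by rw [h1]; ring
  · refine Finset.sum_eq_zero fun i _ => ?_
    rw [integralCochain_eq_zero h hπ g n fun hc => hb (allBlack_contract_iff.mp hc.2), mul_zero]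

theorem not_allBlack_whiten {k : ℕ} (γ : BWGraph (k + 1)) (i : Fin (k + 1)) :
    ¬ (γ.whiten i).AllBlack := fun hb => by
  obtain ⟨j, hj⟩ := hb (γ.black i)
  rcases hj with hj | hj
  · exact Fin.succAbove_ne i j (γ.black_injective hj).symm
  · exact γ.black_ne_inv _ _ hj

theorem isCocycleInf_integralCochain (hπ : h.π = 0) (g n : ℕ) :
    IsCocycleInf g n (integralCochain h g n) := by
  refine ⟨isCochainInf_integralCochain h hπ g n, fun k γ hγ => ?_⟩
  have h1 : ∀ i, integralCochain h g n k (γ.whiten i) = 0 := fun i =>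
    integralCochain_eq_zero h hπ g n fun hc => γ.not_allBlack_whiten i hc.2
  simp only [coboundaryInf, h1, zero_sub, mul_neg, Finset.sum_neg_distrib,
    sum_integralCochain_contract h hπ hγ, neg_zero]

/-- The cochain on the one-point compactification which is given by the integrals. -/
noncomputable def pointCochain (g n : ℕ) : PointCochain where
  onGraph := integralCochain h g n
  atInfinity := 0

theorem isCocycle_pointCochain (hπ : h.π = 0) (g n : ℕ) :
    (pointCochain h g n).IsCocycle g n := by
  refine ⟨⟨fun _ _ hγ => integralCochain_eq_zero h hπ g n hγ,
    fun _ _ _ φ => integralCochain_iso h hπ g n φ⟩, fun k γ hγ _ => ?_⟩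
  simp only [PointCochain.coboundary, pointCochain, mul_neg, Finset.sum_neg_distrib,
    sum_integralCochain_contract h hπ hγ, neg_zero, ite_self, add_zero]

theorem pullback_pointCochain (hπ : h.π = 0) (g n : ℕ) :
    (pointCochain h g n).pullback g n = integralCochain h g n := by
  funext k γ
  rw [PointCochain.pullback]
  split_ifs with h1 h2 h3
  · rfl
  · exact (integralCochain_eq_zero h hπ g n fun hc => h2 hc.2).symm
  · exact (integralCochain_eq_zero h hπ g n fun hc => h2 hc.2).symm
  · exact (integralCochain_eq_zero h hπ g n fun hc => h1 hc.1).symm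

/-- The value at infinity is read off from a graph without black edges but with a white one; this is
where the bounds on `g` and `n` enter. -/
theorem eq_pointCochain (hπ : h.π = 0) {g n : ℕ} (hn : 1 ≤ n) (hgn : 2 < 2 * g + n)
    {c : PointCochain} (hc : c.IsCochain g n)
    (hp : c.pullback g n = integralCochain h g n) : c = pointCochain h g n := by
  refine PointCochain.ext ?_ ?_
  · funext k γ
    by_cases hγ : γ.IsOfType g n ∧ γ.AllBlack
    · have h1 := congrFun (congrFun hp k) γ
      rw [PointCochain.pullback, if_pos hγ.1, if_pos hγ.2] at h1
      exact h1
    · rw [hc.1 k γ hγ]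
      exact (integralCochain_eq_zero h hπ g n hγ).symm
  · obtain ⟨γ, h1, h2⟩ := exists_not_allBlack hn hgn
    have h3 := congrFun (congrFun hp 0) γ
    rw [PointCochain.pullback, if_pos h1, if_neg h2, if_pos rfl,
      integralCochain_eq_zero h hπ g n fun hc => h2 hc.2] at h3
    exact h3

end Cocycle

end BWGraph

end CellTCFT

theorem mainTheorem2 {A : Type*} [NonUnitalRing A] [Module ℝ A] [IsScalarTower ℝ A A]
    [SMulCommClass ℝ A A] [FiniteDimensional ℝ A] (F : CellTCFT.DGFrobenius A)
    (h : CellTCFT.HodgeDecomposition F) (hF : F.Contractible) :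
    h.π = 0 ∧
    Tendsto h.heatKernel atTop (@nhds (A ⊗[ℝ] A) (moduleTopology ℝ (A ⊗[ℝ] A)) 0) ∧
    ∀ g n : ℕ, 1 ≤ n → 2 < 2 * g + n →
      (∀ (k : ℕ) (γ : CellTCFT.BWGraph k), γ.IsOfType g n →
        IntegrableOn (γ.omegaTop h) {t | ∀ i, 0 ≤ t i} volume) ∧
      CellTCFT.BWGraph.IsCocycleInf g n (CellTCFT.BWGraph.integralCochain h g n) ∧
      ∃ c : CellTCFT.BWGraph.PointCochain, c.IsCocycle g n ∧
        c.pullback g n = CellTCFT.BWGraph.integralCochain h g n ∧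
        ∀ c' : CellTCFT.BWGraph.PointCochain, c'.IsCochain g n →
          c'.pullback g n = CellTCFT.BWGraph.integralCochain h g n → c' = c := by
  have hπ := h.π_eq_zero hF
  refine ⟨hπ, h.tendsto_heatKernel hπ, fun g n hn hgn => ⟨fun k γ _ =>
    γ.integrableOn_omegaTop h hπ, CellTCFT.BWGraph.isCocycleInf_integralCochain h hπ g n,
    CellTCFT.BWGraph.pointCochain h g n, CellTCFT.BWGraph.isCocycle_pointCochain h hπ g n,
    CellTCFT.BWGraph.pullback_pointCochain h hπ g n, fun c' hc' hp =>
    CellTCFT.BWGraph.eq_pointCochain h hπ hn hgn hc' hp⟩⟩
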